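/- Let $M=(M,g)$ and $M'=(M',g')$ be closed (compact, without boundary), connected, smooth Riemannian manifolds of dimension $n\ge 1$. Let $\mathcal B(M)$ be the set of sequences $b=\{\varphi^b_j\}_{j\ge 0}$ of real smooth eigenfunctions of the Laplacian $\Delta=-\mathrm{div}\circ\mathrm{grad}$ of $M$ that form an orthonormal basis of $L^2(M)$ with respect to the Riemannian measure $V$ and are listed in nondecreasing order of eigenvalues, with $\varphi^b_0\equiv V(M)^{-1/2}$. For $m\in\mathbb N$ and $b\in\mathcal B(M)$ put $\Phi^m_b:M\to\mathbb R^m$, $\Phi^m_b(x)=(\varphi^b_1(x),\dots,\varphi^b_m(x))$. The maximal embedding dimension of $M$ is the smallest $m$ such that $\Phi^m_b$ is a smooth embedding for every $b\in\mathcal B(M)$. The same notation is used for $M'$. For $b\in\mathcal B(M)$, $b'\in\mathcal B(M')$ a closest-point correspondence $\alpha(\cdot\,;b,b',m):M\to M'$ is a map with $$\alpha(x;b,b',m)\in\operatorname*{arg\,min}_{x'\in M'}\ \|\Phi^m_{b'}(x')-\Phi^m_b(x)\|_{\mathbb R^m}\qquad(x\in M),$$ ties being broken arbitrarily. Suppose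 that $M$ and $M'$ are isometric, i.e. there is a diffeomorphism $F:M\to M'$ with $F^*g'=g$, and that $m$ is at least the maximal embedding dimension of $M$ and of $M'$. Then there are $b\in\mathcal B(M)$ and $b'\in\mathcal B(M')$ such that $\alpha(\cdot\,;b,b',m)$ exists and is an isometry (a diffeomorphism pulling $g'$ back to $g$), however ties are broken. -/

import Mathlib

open scoped Manifold ContDiff Topology ENNReal
open MeasureTheory

noncomputable section

namespace EigenmapRegistration

section Riemannian

variable {n : ℕ} {M : Type*} [TopologicalSpace M] [ChartedSpace (EuclideanSpace ℝ (Fin n)) M]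
  [IsManifold (𝓡 n) ∞ M]

variable (n M) in
/-- A smooth Riemannian metric on an `n`-dimensional smooth manifold `M` (without boundary). -/
abbrev SmoothMetric :=
  Bundle.ContMDiffRiemannianMetric (𝓡 n) ∞ (EuclideanSpace ℝ (Fin n))
    (fun x : M => TangentSpace (𝓡 n) x)

/-- The coordinate vector field `∂ᵢ` of the chart `e`, at the point with coordinates `u`. -/
def coordVec (e : OpenPartialHomeomorph M (EuclideanSpace ℝ (Fin n)))
    (u : EuclideanSpace ℝ (Fin n)) (i : Fin n) : TangentSpace (𝓡 n) (e.symm u) :=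
  mfderiv (𝓡 n) (𝓡 n) e.symm u (EuclideanSpace.single i (1 : ℝ))

/-- The coefficients `gᵢⱼ = g(∂ᵢ, ∂ⱼ)` of the metric in the chart `e`. -/
def gram (g : SmoothMetric n M) (e : OpenPartialHomeomorph M (EuclideanSpace ℝ (Fin n)))
    (u : EuclideanSpace ℝ (Fin n)) : Matrix (Fin n) (Fin n) ℝ :=
  Matrix.of fun i j => g.inner (e.symm u) (coordVec e u i) (coordVec e u j)

/-- The Riemannian density `√(det gᵢⱼ)` in the chart `e`. -/
def density (g : SmoothMetric n M) (e : OpenPartialHomeomorph M (EuclideanSpace ℝ (Fin n)))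
    (u : EuclideanSpace ℝ (Fin n)) : ℝ :=
  √(gram g e u).det

/-- The `i`-th partial derivative of a function of the coordinates. -/
def partialDeriv (i : Fin n) (h : EuclideanSpace ℝ (Fin n) → ℝ)
    (u : EuclideanSpace ℝ (Fin n)) : ℝ :=
  fderiv ℝ h u (EuclideanSpace.single i (1 : ℝ))

/-- The `i`-th component `∑ⱼ gⁱʲ ∂ⱼ f` of the Riemannian gradient of `f` in the chart `e`. -/
def gradInChart (g : SmoothMetric n M) (e : OpenPartialHomeomorph M (EuclideanSpace ℝ (Fin n)))
    (f : M → ℝ) (u : EuclideanSpace ℝ (Fin n)) (i : Fin n) : ℝ :=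
  ∑ j, (gram g e u)⁻¹ i j * partialDeriv j (f ∘ e.symm) u

/-- The Riemannian divergence `(1/√det g) ∑ᵢ ∂ᵢ(√det g · Xⁱ)` in the chart `e` of the vector field
with components `Xⁱ`. -/
def divInChart (g : SmoothMetric n M) (e : OpenPartialHomeomorph M (EuclideanSpace ℝ (Fin n)))
    (X : EuclideanSpace ℝ (Fin n) → Fin n → ℝ) (u : EuclideanSpace ℝ (Fin n)) : ℝ :=
  (density g e u)⁻¹ * ∑ i, partialDeriv i (fun w => density g e w * X w i) u

/-- The Laplacian `Δ f = -div (grad f)` in the chart `e`. -/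
def laplacianInChart (g : SmoothMetric n M)
    (e : OpenPartialHomeomorph M (EuclideanSpace ℝ (Fin n)))
    (f : M → ℝ) (u : EuclideanSpace ℝ (Fin n)) : ℝ :=
  -divInChart g e (gradInChart g e f) u

/-- `f` is a smooth function with `Δ f = lam • f` on `M`. The equation is required in every smooth
coordinate chart (its validity at a point does not depend on the chart around the point). -/
def IsLaplaceSolution (g : SmoothMetric n M) (lam : ℝ) (f : M → ℝ) : Prop :=
  ContMDiff (𝓡 n) 𝓘(ℝ, ℝ) ∞ f ∧
    ∀ e ∈ IsManifold.maximalAtlas (𝓡 n) ∞ M, ∀ u ∈ e.target,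
      laplacianInChart g e f u = lam * f (e.symm u)

/-- The measure `√(det gᵢⱼ) du` on the domain of the chart `e`, extended by zero to `M`. -/
def chartVolume [MeasurableSpace M] (g : SmoothMetric n M)
    (e : OpenPartialHomeomorph M (EuclideanSpace ℝ (Fin n))) : Measure M :=
  ((volume.restrict e.target).withDensity
    (fun u => ENNReal.ofReal (density g e u))).map e.symm

/-- The canonical Riemannian measure. The measures `chartVolume g e` agree on the overlaps of the
chart domains, and their least upper bound is the measure that restricts to `√(det gᵢⱼ) du` on the
domain of each smooth chart. -/
def riemannianVolume [MeasurableSpace M] (g : SmoothMetric n M) : Measure M :=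
  ⨆ e ∈ IsManifold.maximalAtlas (𝓡 n) ∞ M, chartVolume g e

/-- `φ 0, φ 1, φ 2, …` is an orthonormal basis of `L²(M)` made of real smooth eigenfunctions of the
Laplacian, listed in nondecreasing order of their eigenvalues (so with multiplicity), where
`φ 0` is the constant `V(M)^(-1/2)`. -/
def IsEigenbasis [MeasurableSpace M] (g : SmoothMetric n M) (φ : ℕ → M → ℝ) : Prop :=
  (∃ lam : ℕ → ℝ, Monotone lam ∧ ∀ j, IsLaplaceSolution g (lam j) (φ j)) ∧
  (∃ B : HilbertBasis ℕ ℝ (Lp ℝ 2 (riemannianVolume g)),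
    ∀ j, (B j : M → ℝ) =ᵐ[riemannianVolume g] φ j) ∧
  ∀ x, φ 0 x = 1 / √((riemannianVolume g).real Set.univ)

end Riemannian

/-- The eigenfunction map `x ↦ (φ 1 x, …, φ m x)` into Euclidean space. -/
def eigenmap {M : Type*} (φ : ℕ → M → ℝ) (m : ℕ) (x : M) : EuclideanSpace ℝ (Fin m) :=
  WithLp.toLp 2 fun j : Fin m => φ (j + 1) x

/-- The maximal embedding dimension: the smallest `m` such that the eigenfunction map into `ℝᵐ` is
a smooth embedding for every choice of the eigenbasis (`⊤` if there is no such `m`). -/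
def maximalEmbeddingDimension {n : ℕ} {M : Type*} [TopologicalSpace M]
    [ChartedSpace (EuclideanSpace ℝ (Fin n)) M] [IsManifold (𝓡 n) ∞ M] [MeasurableSpace M]
    (g : SmoothMetric n M) : ℕ∞ :=
  sInf {k : ℕ∞ | ∃ m : ℕ, k = m ∧ ∀ φ : ℕ → M → ℝ, IsEigenbasis g φ →
    Manifold.IsSmoothEmbedding (𝓡 n) (𝓡 m) ∞ (eigenmap φ m)}

/-- `α` is a closest point correspondence `α(·; b, b', m)`: for every `x`, the point `α x` attains
the infimum over `x'` of `‖Φ_{b'} x' - Φ_b x‖`. There is one such `α` for every way of breaking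
ties. -/
def IsClosestPointMap {M M' : Type*} (b : ℕ → M → ℝ) (b' : ℕ → M' → ℝ) (m : ℕ)
    (α : M → M') : Prop :=
  ∀ x : M, ∀ x' : M',
    ‖eigenmap b' m (α x) - eigenmap b m x‖ ≤ ‖eigenmap b' m x' - eigenmap b m x‖

/-- `F : M → M'` is an isometry of Riemannian manifolds: a diffeomorphism with `F^* g' = g`. -/
def IsRiemannianIsometry {n : ℕ} {M M' : Type*}
    [TopologicalSpace M] [ChartedSpace (EuclideanSpace ℝ (Fin n)) M] [IsManifold (𝓡 n) ∞ M]
    [TopologicalSpace M'] [ChartedSpace (EuclideanSpace ℝ (Fin n)) M'] [IsManifold (𝓡 n) ∞ M']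
    (g : SmoothMetric n M) (g' : SmoothMetric n M') (F : M → M') : Prop :=
  (∃ D : Diffeomorph (𝓡 n) (𝓡 n) M M' ∞, ⇑D = F) ∧
    ∀ (x : M) (v w : TangentSpace (𝓡 n) x),
      g'.inner (F x) (mfderiv (𝓡 n) (𝓡 n) F x v) (mfderiv (𝓡 n) (𝓡 n) F x w) = g.inner x v w

end EigenmapRegistration

end

/-! Let `D : M → M'` be the isometry and `b'` any eigenbasis of `M'`. Isometries preserve the
Riemannian measure and the Laplacian, so `b = b' ∘ D` is an eigenbasis of `M`, and `eigenmap b' m (D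
x) = eigenmap b m x`. The minimal distance is therefore zero and is attained at `D x`. Since `m` is
at least the maximal embedding dimension of `M'`, the map `eigenmap b' m` is injective, so `D x` is
the only minimizer: there are no ties and every closest-point map is `D`. These are
`IsEigenbasis.comp_isometry` and `injective_eigenmap`.

Most of the work is the existence of an eigenbasis, `exists_isEigenbasis`: the spectral theorem for
the Laplacian of a closed manifold. Smooth functions carry the scalar product `∫ f h + ⟨∇f, ∇h⟩` of
`1 + Δ` (`EnergySpace`). On its completion `H` the inclusion in `L²` extends to a contraction `J`
with dense range, and `J` is compact by a quantitative Rellich theorem: the `L²` norm is controlled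
by finitely many functionals up to a small multiple of the energy norm
(`exists_frequencies_integral_sq_le`, `exists_functionals_norm_sq_inclusion_le`). The compact
positive operator `J J*` has an orthonormal eigenbasis, and the inverses of its eigenvalues are the
eigenvalues of `1 + Δ` in the weak sense (`exists_weak_eigenbasis`). Injectivity of `J` is never
needed, because weak eigenvectors are only used as limits of smooth functions.

Weak eigenfunctions are smooth by a Fourier argument (`exists_contDiff_of_weak_solution`). In a
chart, the weak equation is tested with a plane wave of frequency `ξ` times a cutoff divided by the
principal symbol in the direction of `ξ`. This trades a factor `‖ξ‖²` for terms of order at most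
`‖ξ‖`, so the Fourier transform of a localized solution gains one order of decay, and induction
gives all orders. Local smooth representatives glue together, and integration by parts in the other
direction turns the weak equation into the classical one. -/

namespace EigenmapRegistration

/-! ### Compact symmetric operators -/

/-- A real function with finite sublevel sets on an infinite type can be listed monotonically,
starting at any prescribed minimum. -/
theorem exists_equiv_nat_monotone {S : Type*} [Infinite S] (f : S → ℝ)
    (hf : ∀ c, {s | f s ≤ c}.Finite) (s₀ : S) (h₀ : ∀ s, f s₀ ≤ f s) :
    ∃ e : ℕ ≃ S, Monotone (f ∘ e) ∧ e 0 = s₀ := by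
  classical
  -- The value at `s₀` is lowered by one, which makes `s₀` the strict minimum. The arbitrary well
  -- order in the second component of `key` only breaks ties.
  let f' : S → ℝ := fun s => if s = s₀ then f s₀ - 1 else f s
  let _ : LinearOrder S := linearOrderOfSTO WellOrderingRel
  let key : S → ℝ ×ₗ S := fun s => toLex (f' s, s)
  have hkey : Function.Injective key := fun s t h => congrArg (fun p => (ofLex p).2) h
  have hlt : ∀ s t : S, key s < key t → f' s ≤ f' t := fun s t h => by
    rcases (Prod.Lex.lt_iff).1 h with h1 | h1
    · exact h1.le
    · exact h1.1.le
  have hfin : ∀ s : S, {t | key t < key s}.Finite := fun s => by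
    refine ((hf (f' s)).union (Set.finite_singleton s₀)).subset fun t ht => ?_
    have := hlt t s ht
    by_cases h : t = s₀
    · exact Or.inr h
    · refine Or.inl ?_
      simpa [f', h] using this
  -- The rank is the number of predecessors. It embeds `S` as an infinite subset of `ℕ`, and such a
  -- subset is order isomorphic to `ℕ`.
  let r : S → ℕ := fun s => {t | key t < key s}.ncard
  have hr : ∀ s t : S, key s < key t → r s < r t := fun s t h => by
    refine Set.ncard_lt_ncard ⟨fun u hu => ?_, fun hsub => ?_⟩ (hfin t)
    · exact lt_trans hu h
    · exact lt_irrefl (key s) (hsub h)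
  have hinj : Function.Injective r := fun s t h => by
    rcases lt_trichotomy (key s) (key t) with h1 | h1 | h1
    · exact absurd h (hr s t h1).ne
    · exact hkey h1
    · exact absurd h (hr t s h1).ne'
  have : Infinite (Set.range r) := Set.infinite_coe_iff.2 (Set.infinite_range_of_injective hinj)
  let e₁ : ℕ ≃o Set.range r := Nat.Subtype.orderIsoOfNat (Set.range r)
  let e₂ : S ≃ Set.range r := Equiv.ofInjective r hinj
  have he : ∀ i, r (e₂.symm (e₁ i)) = e₁ i := fun i => by
    exact congrArg Subtype.val (e₂.apply_symm_apply (e₁ i))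
  have hzero : e₂.symm (e₁ 0) = s₀ := by
    have hs₀ : r s₀ = 0 := by
      rw [Set.ncard_eq_zero (hfin s₀)]
      refine Set.eq_empty_iff_forall_notMem.2 fun t ht => ?_
      have h1 := hlt t s₀ ht
      by_cases h : t = s₀
      · subst h; exact lt_irrefl (key t) ht
      · have := h₀ t
        simp only [f', h, if_false, if_true] at h1
        linarith
    apply hinj
    rw [he, hs₀]
    have h1 : e₁ 0 ≤ ⟨r s₀, s₀, rfl⟩ := by
      rw [← e₁.apply_symm_apply ⟨r s₀, s₀, rfl⟩]
      exact e₁.monotone (Nat.zero_le _)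
    have : (e₁ 0 : ℕ) ≤ r s₀ := h1
    omega
  refine ⟨e₁.toEquiv.trans e₂.symm, ?_, hzero⟩
  intro i j hij
  rcases hij.eq_or_lt with rfl | hij
  · exact le_rfl
  have h1 : r (e₂.symm (e₁ i)) < r (e₂.symm (e₁ j)) := by
    rw [he, he]; exact e₁.strictMono hij
  have h2 : f' (e₂.symm (e₁ i)) ≤ f' (e₂.symm (e₁ j)) := by
    rcases lt_trichotomy (key (e₂.symm (e₁ i))) (key (e₂.symm (e₁ j))) with h | h | h
    · exact hlt _ _ h
    · rw [hkey h]
    · exact absurd (hr _ _ h) h1.not_gt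
  have h3 : e₂.symm (e₁ j) ≠ s₀ := fun h => by
    rw [← hzero] at h
    have := e₁.injective (e₂.symm.injective h)
    omega
  change f (e₂.symm (e₁ i)) ≤ f (e₂.symm (e₁ j))
  by_cases h : e₂.symm (e₁ i) = s₀
  · rw [h]; exact h₀ _
  · simpa [f', h, h3] using h2

section CompactOperator

variable {L : Type*} [NormedAddCommGroup L] [InnerProductSpace ℝ L]

/-- An injective compact symmetric operator has an orthonormal Hilbert basis of eigenvectors that
contains a prescribed unit eigenvector. -/
theorem exists_hilbertBasis_eigenvectors [CompleteSpace L] (T : L →L[ℝ] L) (hc : IsCompactOperator T)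
    (hs : (T : L →ₗ[ℝ] L).IsSymmetric) (hinj : ∀ x, T x = 0 → x = 0) (e₀ : L) (he₀ : ‖e₀‖ = 1)
    (μ₀ : ℝ) (hμ₀ : T e₀ = μ₀ • e₀) :
    ∃ (s : Set L) (B : HilbertBasis s ℝ L), e₀ ∈ s ∧ ⇑B = ((↑) : s → L) ∧
      ∀ v ∈ s, ∃ μ : ℝ, T v = μ • v := by
  -- Zorn's lemma is applied to orthonormal sets of eigenvectors, above the singleton of `e₀`.
  let F : Set (Set L) := {s | Orthonormal ℝ ((↑) : s → L) ∧ ∀ v ∈ s, ∃ μ : ℝ, T v = μ • v}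
  have hF : ({e₀} : Set L) ∈ F := by
    refine ⟨⟨fun i => ?_, fun i j hij => ?_⟩, fun v hv => ⟨μ₀, ?_⟩⟩
    · have := i.2
      rw [Set.mem_singleton_iff] at this
      rw [this, he₀]
    · exact absurd (Subsingleton.elim i j) hij
    · rw [Set.mem_singleton_iff.1 hv, hμ₀]
  obtain ⟨s, hsub, hmax⟩ := zorn_subset_nonempty F (fun c hcF hcc hne => by
    refine ⟨⋃₀ c, ⟨?_, ?_⟩, fun t ht => Set.subset_sUnion_of_mem ht⟩
    · exact orthonormal_sUnion_of_directed hcc.directedOn fun t ht => (hcF ht).1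
    · rintro v ⟨t, ht, hv⟩
      exact (hcF ht).2 v hv) {e₀} hF
  obtain ⟨⟨hon, heig⟩, hmax⟩ := hmax
  -- By symmetry the orthogonal complement of the span is invariant. Were it nonzero, the
  -- restriction of `T` to it would be a nonzero compact symmetric operator and would have an
  -- eigenvector, whose normalization enlarges the maximal set.
  have hbot : (Submodule.span ℝ (Set.range ((↑) : s → L)))ᗮ = ⊥ := by
    rw [Subtype.range_coe]
    set K := (Submodule.span ℝ s)ᗮ with hK
    have hinv : ∀ x ∈ K, T x ∈ K := fun x hx => by
      rw [hK, Submodule.mem_orthogonal] at hx ⊢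
      intro u hu
      refine Submodule.span_induction (p := fun u _ => inner ℝ u (T x) = 0) ?_ ?_ ?_ ?_ hu
      · intro v hv
        obtain ⟨μ, hμ⟩ := heig v hv
        have : inner ℝ (T v) x = inner ℝ v (T x) := hs v x
        rw [← this, hμ, inner_smul_left, hx v (Submodule.subset_span hv), mul_zero]
      · simp
      · intro a b _ _ ha hb
        rw [inner_add_left, ha, hb, add_zero]
      · intro a b _ hb
        rw [inner_smul_left, hb, mul_zero]
    let S : K →L[ℝ] K := T.restrict hinv
    have hSc : IsCompactOperator S := hc.restrict' hinv
    have hSs : (S : K →ₗ[ℝ] K).IsSymmetric := hs.restrict_invariant hinv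
    have hS0 : ∀ x : K, S x = 0 → x = 0 := fun x hx => by
      apply Subtype.ext
      exact hinj _ (congrArg Subtype.val hx)
    by_contra hne
    obtain ⟨x, hxK, hx⟩ := Submodule.exists_mem_ne_zero_of_ne_bot hne
    have hSne : S ≠ 0 := fun h => hx (by
      have := hS0 ⟨x, hxK⟩ (by rw [h]; rfl)
      exact congrArg Subtype.val this)
    have := (ContinuousLinearMap.eq_zero_of_forall_hasEigenvalue_eq_zero hSc hSs).not.2 hSne
    push Not at this
    obtain ⟨μ, hμ, -⟩ := this
    obtain ⟨v, hv⟩ := hμ.exists_hasEigenvector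
    have hv1 : S v = μ • v := hv.apply_eq_smul
    have hv2 : (v : L) ≠ 0 := fun h => hv.2 (Subtype.ext h)
    have hTv : T (v : L) = μ • (v : L) := congrArg Subtype.val hv1
    set w : L := ‖(v : L)‖⁻¹ • (v : L) with hw
    have hw1 : ‖w‖ = 1 := by
      rw [hw, norm_smul, norm_inv, norm_norm, inv_mul_cancel₀ (norm_ne_zero_iff.2 hv2)]
    have hwK : w ∈ K := K.smul_mem _ v.2
    have hwins : insert w s ∈ F := by
      refine ⟨?_, ?_⟩
      · classical
        rw [orthonormal_subtype_iff_ite]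
        intro a ha b hb
        have hon' := orthonormal_subtype_iff_ite.1 hon
        have hperp : ∀ c ∈ s, inner ℝ c w = 0 := fun c hcs =>
          (Submodule.mem_orthogonal _ _).1 hwK c (Submodule.subset_span hcs)
        have hws : ∀ c ∈ s, c ≠ w := fun c hcs h => by
          have := hperp c hcs
          rw [h, real_inner_self_eq_norm_sq, hw1] at this
          norm_num at this
        rcases ha with rfl | ha <;> rcases hb with rfl | hb
        · simp [hw1]
        · rw [real_inner_comm, hperp b hb, if_neg (hws b hb).symm]
        · rw [hperp a ha, if_neg (hws a ha)]
        · exact hon' a ha b hb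
      · rintro a (rfl | ha)
        · exact ⟨μ, by rw [hw, map_smul, hTv, smul_comm]⟩
        · exact heig a ha
    have hws : w ∈ s := hmax hwins (Set.subset_insert w s) (Set.mem_insert w s)
    have := (Submodule.mem_orthogonal _ _).1 hwK w (Submodule.subset_span hws)
    rw [real_inner_self_eq_norm_sq, hw1] at this
    norm_num at this
  exact ⟨s, HilbertBasis.mkOfOrthogonalEqBot hon hbot, hsub rfl,
    HilbertBasis.coe_mkOfOrthogonalEqBot hon hbot, heig⟩

/-- Only finitely many members of an orthonormal family of eigenvectors of a compact operator have
eigenvalues above a positive bound. -/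
theorem finite_eigenvalue_ge (T : L →L[ℝ] L) (hc : IsCompactOperator T) {ι : Type*} {v : ι → L}
    (hv : Orthonormal ℝ v) {μ : ι → ℝ} (hμ : ∀ i, T (v i) = μ i • v i) {δ : ℝ} (hδ : 0 < δ) :
    {i | δ ≤ μ i}.Finite := by
  by_contra hinf
  have hK := hc.isCompact_closure_image_closedBall (1 : ℝ)
  -- The images of two eigenvectors that share a point of a `δ / 2`-net are less than `δ` apart.
  -- Pairing their difference with `v i` shows that they are at least `μ i ≥ δ` apart.
  obtain ⟨t, htf, ht⟩ := Metric.totallyBounded_iff.1 hK.totallyBounded (δ / 2) (half_pos hδ)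
  have hmem : ∀ i, ∃ y ∈ t, T (v i) ∈ Metric.ball y (δ / 2) := fun i => by
    have : T (v i) ∈ closure (T '' Metric.closedBall 0 1) :=
      subset_closure ⟨v i, by simp [hv.1 i], rfl⟩
    simpa using ht this
  choose c hct hcb using hmem
  obtain ⟨i, hi, j, hj, hij, hcc⟩ := Set.Infinite.exists_ne_map_eq_of_mapsTo
    (s := {i | δ ≤ μ i}) (t := t) (f := c) hinf (fun i _ => hct i) htf
  have h1 : dist (T (v i)) (T (v j)) < δ := by
    have h2 := hcb i
    have h3 := hcb j
    rw [← hcc] at h3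
    rw [Metric.mem_ball] at h2 h3
    calc _ ≤ dist (T (v i)) (c i) + dist (T (v j)) (c i) := dist_triangle_right _ _ _
      _ < δ := by linarith
  have h2 : inner ℝ (v i) (T (v i) - T (v j)) = μ i := by
    rw [hμ, hμ, inner_sub_right, inner_smul_right, inner_smul_right, hv.2 hij,
      real_inner_self_eq_norm_sq, hv.1 i]
    ring
  have h3 : μ i ≤ ‖T (v i) - T (v j)‖ := by
    rw [← h2]
    refine (real_inner_le_norm _ _).trans ?_
    rw [hv.1 i, one_mul]
  rw [dist_eq_norm] at h1
  have : δ ≤ μ i := hi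
  linarith

/-- The spectral theorem for an injective compact positive operator bounded by `1`, with the
eigenvalues listed in nonincreasing order and a prescribed first eigenvector. -/
theorem exists_sorted_eigenbasis [CompleteSpace L] (hL : ¬ FiniteDimensional ℝ L) (T : L →L[ℝ] L)
    (hc : IsCompactOperator T) (hs : (T : L →ₗ[ℝ] L).IsSymmetric)
    (hpos : ∀ x, x ≠ 0 → 0 < inner ℝ (T x) x) (hle : ∀ x, inner ℝ (T x) x ≤ ‖x‖ ^ 2)
    (e₀ : L) (he₀ : ‖e₀‖ = 1) (hTe₀ : T e₀ = e₀) :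
    ∃ (B : HilbertBasis ℕ ℝ L) (μ : ℕ → ℝ), Antitone μ ∧ (∀ j, 0 < μ j) ∧
      (∀ j, T (B j) = μ j • B j) ∧ B 0 = e₀ := by
  obtain ⟨s, B, h₀, hB, heig⟩ := exists_hilbertBasis_eigenvectors T hc hs (fun x hx => by
    by_contra h
    have := hpos x h
    rw [hx, inner_zero_left] at this
    exact lt_irrefl _ this) e₀ he₀ 1 (by rw [hTe₀, one_smul])
  have hBon : Orthonormal ℝ ((↑) : s → L) := hB ▸ B.orthonormal
  have heig' : ∀ v : s, ∃ μ : ℝ, T v = μ • (v : L) := fun v => heig v v.2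
  choose μ hμ using heig'
  have hμi : ∀ v : s, inner ℝ (T (v : L)) (v : L) = μ v := fun v => by
    rw [hμ, inner_smul_left, real_inner_self_eq_norm_sq, hBon.1 v]
    simp
  have hμpos : ∀ v, 0 < μ v := fun v => by
    rw [← hμi]
    refine hpos _ fun h => ?_
    have := hBon.1 v
    rw [h, norm_zero] at this
    norm_num at this
  have hμ1 : ∀ v, μ v ≤ 1 := fun v => by
    rw [← hμi]
    refine (hle _).trans ?_
    rw [hBon.1 v]; norm_num
  have hμ0 : μ ⟨e₀, h₀⟩ = 1 := by
    rw [← hμi]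
    simp only [hTe₀, real_inner_self_eq_norm_sq, he₀]
    norm_num
  have : Infinite s := by
    by_contra hfin
    rw [not_infinite_iff_finite] at hfin
    have := Fintype.ofFinite s
    exact hL (Module.Basis.finiteDimensional_of_finite (B.toOrthonormalBasis.toBasis))
  -- Listing by inverse eigenvalues: sublevel sets are finite by compactness, and `e₀` has the
  -- largest possible eigenvalue, namely 1.
  obtain ⟨e, hmono, he0⟩ := exists_equiv_nat_monotone (fun v : s => (μ v)⁻¹) (fun c => by
    by_cases hcp : 0 < c
    · refine (finite_eigenvalue_ge T hc hBon hμ (inv_pos.2 hcp)).subset fun v hv => ?_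
      exact inv_le_of_inv_le₀ (hμpos v) hv
    · refine Set.finite_empty.subset fun v hv => ?_
      exact hcp ((inv_pos.2 (hμpos v)).trans_le hv)) ⟨e₀, h₀⟩ (fun v => by
    simp only [hμ0, inv_one]
    exact (one_le_inv₀ (hμpos v)).2 (hμ1 v))
  have hBon' : Orthonormal ℝ (fun j => B (e j)) := B.orthonormal.comp e e.injective
  have hsp : (Submodule.span ℝ (Set.range fun j => B (e j)))ᗮ = ⊥ := by
    have hr : (Set.range fun j => B (e j)) = Set.range B := e.surjective.range_comp B
    rw [hr, ← Submodule.orthogonal_closure, B.dense_span, Submodule.top_orthogonal_eq_bot]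
  refine ⟨HilbertBasis.mkOfOrthogonalEqBot hBon' hsp, fun j => μ (e j), ?_, fun j => hμpos _, ?_, ?_⟩
  · intro i j hij
    exact (inv_le_inv₀ (hμpos _) (hμpos _)).1 (hmono hij)
  · intro j
    rw [HilbertBasis.coe_mkOfOrthogonalEqBot, hB]
    exact hμ _
  · rw [HilbertBasis.coe_mkOfOrthogonalEqBot, hB, he0]

end CompactOperator

end EigenmapRegistration

/-! ### The weak eigenvalue problem of a quadratic form with compact domain inclusion -/

namespace EigenmapRegistration

section WeakEigenbasis

variable {L : Type*} [NormedAddCommGroup L] [InnerProductSpace ℝ L] [CompleteSpace L]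

/-- A bounded operator that is small up to finitely many linear functionals is compact. -/
theorem isCompactOperator_of_norm_sq_le {H : Type*} [NormedAddCommGroup H] [InnerProductSpace ℝ H]
    [CompleteSpace H] (J : H →L[ℝ] L)
    (hJ : ∀ ε : ℝ, 0 < ε → ∃ (κ : Type) (_ : Fintype κ) (l : κ → H →L[ℝ] ℝ),
      ∀ f, ‖J f‖ ^ 2 ≤ ∑ k, l k f ^ 2 + ε * ‖f‖ ^ 2) : IsCompactOperator J := by
  -- On the common kernel `W` of the functionals, `J` has norm at most `δ`. The functionals separate
  -- the points of `Wᗮ`, which is therefore finite dimensional, so `J` composed with the projection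
  -- onto `Wᗮ` is compact and within `δ` of `J`.
  have key : ∀ δ : ℝ, 0 < δ → ∃ S : H →L[ℝ] L, IsCompactOperator S ∧ ‖S - J‖ ≤ δ := by
    intro δ hδ
    obtain ⟨κ, _, l, hl⟩ := hJ (δ ^ 2) (by positivity)
    let A : H →L[ℝ] (κ → ℝ) := ContinuousLinearMap.pi l
    let W : Submodule ℝ H := LinearMap.ker (A : H →ₗ[ℝ] κ → ℝ)
    have hWc : IsClosed (W : Set H) := A.isClosed_ker
    have : CompleteSpace W := hWc.completeSpace_coe
    have hinj : Function.Injective ((A : H →ₗ[ℝ] κ → ℝ).comp Wᗮ.subtype) := by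
      rw [← LinearMap.ker_eq_bot, LinearMap.ker_eq_bot']
      intro x hx
      have h1 : (x : H) ∈ W := hx
      have h2 := Submodule.inner_right_of_mem_orthogonal h1 x.2
      exact Subtype.ext (inner_self_eq_zero.1 h2)
    have : FiniteDimensional ℝ Wᗮ := FiniteDimensional.of_injective _ hinj
    refine ⟨(J.comp Wᗮ.subtypeL).comp Wᗮ.orthogonalProjectionOnto, ?_, ?_⟩
    · exact (isCompactOperator_of_locallyCompactSpace_rng
        (J.comp Wᗮ.subtypeL)).comp_clm Wᗮ.orthogonalProjectionOnto
    · refine ContinuousLinearMap.opNorm_le_bound _ hδ.le fun x => ?_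
      set y : H := x - (Wᗮ.orthogonalProjectionOnto x : H) with hy
      have hyW : y ∈ W := by
        have := Submodule.sub_starProjection_mem_orthogonal (K := Wᗮ) x
        rwa [Submodule.orthogonal_orthogonal] at this
      have h0 : ∀ k, l k y = 0 := fun k => congrFun (show A y = 0 from hyW) k
      have hyx : ‖y‖ ≤ ‖x‖ := by
        have h1 : inner ℝ y (Wᗮ.orthogonalProjectionOnto x : H) = 0 :=
          Submodule.inner_right_of_mem_orthogonal hyW (Wᗮ.orthogonalProjectionOnto x).2
        have h2 : x = y + (Wᗮ.orthogonalProjectionOnto x : H) := by rw [hy]; abel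
        have h3 := norm_add_sq_eq_norm_sq_add_norm_sq_real h1
        rw [← h2] at h3
        nlinarith [norm_nonneg x, norm_nonneg y,
          mul_self_nonneg ‖(Wᗮ.orthogonalProjectionOnto x : H)‖]
      have h1 := hl y
      simp only [h0] at h1
      have h2 : ‖J y‖ ≤ δ * ‖y‖ := by
        refine le_of_sq_le_sq ?_ (by positivity)
        rw [mul_pow]
        simpa using h1
      calc _ = ‖J y‖ := by
            rw [← norm_neg]
            simp [hy]
        _ ≤ δ * ‖y‖ := h2
        _ ≤ δ * ‖x‖ := by gcongr
  choose S hS hSn using fun k : ℕ => key (1 / ((k : ℝ) + 1)) (by positivity)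
  refine isCompactOperator_of_tendsto (F := S) (l := Filter.atTop) ?_
    (Filter.Eventually.of_forall hS)
  rw [tendsto_iff_norm_sub_tendsto_zero]
  exact squeeze_zero (fun _ => norm_nonneg _) hSn tendsto_one_div_add_atTop_nhds_zero_nat

/-- For a compact dense contraction `J` the operator `J J*` has an eigenbasis: these are the weak
eigenvectors of the quadratic form of the domain of `J`. -/
theorem exists_eigenbasis_comp_adjoint (hL : ¬ FiniteDimensional ℝ L) {H : Type*}
    [NormedAddCommGroup H] [InnerProductSpace ℝ H] [CompleteSpace H] (J : H →L[ℝ] L)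
    (hc : IsCompactOperator J) (hJ : ∀ h, ‖J h‖ ≤ ‖h‖) (hd : DenseRange J) (o : H)
    (ho : ∀ h, inner ℝ o h = inner ℝ (J o) (J h)) (ho1 : ‖J o‖ = 1) :
    ∃ (B : HilbertBasis ℕ ℝ L) (ν : ℕ → ℝ), Monotone ν ∧ B 0 = J o ∧
      ∀ j, ∃ w : H, J w = B j ∧ ∀ h, inner ℝ w h = ν j * inner ℝ (B j) (J h) := by
  let Js := ContinuousLinearMap.adjoint J
  have hadj : ∀ x h, inner ℝ (Js x) h = inner ℝ x (J h) := fun x h =>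
    ContinuousLinearMap.adjoint_inner_left J h x
  have hadj' : ∀ x h, inner ℝ h (Js x) = inner ℝ (J h) x := fun x h =>
    ContinuousLinearMap.adjoint_inner_right J h x
  let T : L →L[ℝ] L := J.comp Js
  have hTx : ∀ x y, inner ℝ (T x) y = inner ℝ (Js x) (Js y) := fun x y => (hadj' y (Js x)).symm
  have hs : (T : L →ₗ[ℝ] L).IsSymmetric := fun x y => by
    change inner ℝ (T x) y = inner ℝ x (T y)
    rw [hTx, ← real_inner_comm, ← hTx, real_inner_comm]
  -- The adjoint is injective because the range of `J` is dense.
  have hinj : ∀ x, Js x = 0 → x = 0 := fun x hx => by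
    have h0 : ∀ y, inner ℝ x y = 0 := by
      intro y
      have hcl : IsClosed {y : L | inner ℝ x y = 0} :=
        isClosed_eq (by fun_prop) continuous_const
      have hsub : Set.range J ⊆ {y : L | inner ℝ x y = 0} := by
        rintro _ ⟨h, rfl⟩
        change inner ℝ x (J h) = 0
        rw [← hadj, hx, inner_zero_left]
      have := closure_minimal hsub hcl
      rw [hd.closure_range] at this
      exact this (Set.mem_univ y)
    exact inner_self_eq_zero.1 (h0 x)
  have hnorm : ∀ x, ‖Js x‖ ≤ ‖x‖ := fun x => by
    have h1 : ‖Js x‖ ^ 2 ≤ ‖x‖ * ‖Js x‖ := by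
      rw [← real_inner_self_eq_norm_sq, hadj]
      exact (real_inner_le_norm _ _).trans (by gcongr; exact hJ _)
    rcases (norm_nonneg (Js x)).eq_or_lt with h | h
    · rw [← h]; exact norm_nonneg x
    · nlinarith
  -- This makes `J o` an eigenvector of `J J*` with eigenvalue 1, the top of the spectrum since `J`
  -- is a contraction.
  have hJo : Js (J o) = o := by
    refine ext_inner_right ℝ fun h => ?_
    rw [hadj, ho]
  obtain ⟨B, μ, hanti, hpos, heig, h0⟩ := exists_sorted_eigenbasis hL T (hc.comp_clm Js) hs
    (fun x hx => by
      rw [hTx]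
      exact real_inner_self_pos.2 fun h => hx (hinj x h))
    (fun x => by
      rw [hTx, real_inner_self_eq_norm_sq]
      exact pow_le_pow_left₀ (norm_nonneg _) (hnorm x) 2)
    (J o) ho1 (congrArg J hJo)
  -- With `w = μ⁻¹ J* B j`, the eigenvector equation gives `J w = B j`, and the adjoint identity
  -- turns pairings with `w` into `μ⁻¹` times pairings in `L`.
  refine ⟨B, fun j => (μ j)⁻¹, fun i j hij => ?_, h0, fun j => ⟨(μ j)⁻¹ • Js (B j), ?_, fun h => ?_⟩⟩
  · exact (inv_le_inv₀ (hpos i) (hpos j)).2 (hanti hij)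
  · have : J (Js (B j)) = μ j • B j := heig j
    rw [map_smul, this, smul_smul, inv_mul_cancel₀ (hpos j).ne', one_smul]
  · rw [inner_smul_left, hadj]
    rfl

/-- The weak eigenvalue problem of a form: `E` is the form domain with its own inner product, and
`ι` is its dense inclusion in the Hilbert space `L`. -/
theorem exists_weak_eigenbasis (hL : ¬ FiniteDimensional ℝ L) {E : Type*}
    [NormedAddCommGroup E] [InnerProductSpace ℝ E] (ι : E →L[ℝ] L)
    (hι : ∀ f, ‖ι f‖ ≤ ‖f‖) (hd : DenseRange ι)
    (hcomp : ∀ ε : ℝ, 0 < ε → ∃ (κ : Type) (_ : Fintype κ) (l : κ → E →L[ℝ] ℝ),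
      ∀ f, ‖ι f‖ ^ 2 ≤ ∑ k, l k f ^ 2 + ε * ‖f‖ ^ 2)
    (o : E) (ho : ∀ f, inner ℝ o f = inner ℝ (ι o) (ι f)) (ho1 : ‖ι o‖ = 1) :
    ∃ (B : HilbertBasis ℕ ℝ L) (ν : ℕ → ℝ), Monotone ν ∧ B 0 = ι o ∧
      ∀ j, ∃ w : ℕ → E, Filter.Tendsto (fun k => ι (w k)) Filter.atTop (𝓝 (B j)) ∧
        ∀ f, Filter.Tendsto (fun k => inner ℝ (w k) f) Filter.atTop
          (𝓝 (ν j * inner ℝ (B j) (ι f))) := by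
  let H := UniformSpace.Completion E
  let c : E →L[ℝ] H := UniformSpace.Completion.toComplL
  have hc : ∀ f, c f = (f : H) := fun f => rfl
  have hcd : DenseRange c := UniformSpace.Completion.denseRange_coe
  have hci : IsUniformInducing c := UniformSpace.Completion.isUniformInducing_coe E
  have hnc : ∀ f, ‖c f‖ = ‖f‖ := UniformSpace.Completion.norm_coe
  let J : H →L[ℝ] L := ι.extend c
  have hJc : ∀ f, J (c f) = ι f := fun f => ContinuousLinearMap.extend_eq ι hcd hci f
  have hJ : ∀ h, ‖J h‖ ≤ ‖h‖ := fun h => by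
    refine hcd.induction_on h (isClosed_le (by fun_prop) (by fun_prop)) fun f => ?_
    rw [hJc, hnc]; exact hι f
  have hJd : DenseRange J := by
    refine hd.mono ?_
    rintro _ ⟨f, rfl⟩
    exact ⟨c f, hJc f⟩
  have hJcomp : IsCompactOperator J := by
    refine isCompactOperator_of_norm_sq_le J fun ε hε => ?_
    obtain ⟨κ, _, l, hl⟩ := hcomp ε hε
    refine ⟨κ, inferInstance, fun k => (l k).extend c, fun h => ?_⟩
    refine hcd.induction_on h (isClosed_le (by fun_prop) (by fun_prop)) fun f => ?_
    rw [hJc, hnc]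
    refine (hl f).trans (le_of_eq ?_)
    congr 1
    refine Finset.sum_congr rfl fun k _ => ?_
    rw [ContinuousLinearMap.extend_eq (l k) hcd hci f]
  obtain ⟨B, ν, hν, hB0, hB⟩ := exists_eigenbasis_comp_adjoint hL J hJcomp hJ hJd (c o) (fun h => by
    refine hcd.induction_on h (isClosed_eq (by fun_prop) (by fun_prop)) fun f => ?_
    rw [hJc, hJc, ← ho]
    exact UniformSpace.Completion.inner_coe o f) (by rw [hJc, ho1])
  refine ⟨B, ν, hν, by rw [hB0, hJc], fun j => ?_⟩
  obtain ⟨w, hw, hwi⟩ := hB j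
  -- The weak eigenvector lives in the completion. Approximating it from `E` yields a conclusion
  -- that mentions only elements of `E`, even if `J` is not injective.
  obtain ⟨x, hx, hxw⟩ := mem_closure_iff_seq_limit.1 (hcd w)
  choose y hy using hx
  refine ⟨y, ?_, fun f => ?_⟩
  · have := (J.continuous.tendsto w).comp hxw
    rw [hw] at this
    refine this.congr fun k => ?_
    rw [Function.comp_apply, ← hy k, hJc]
  · have h1 : Filter.Tendsto (fun k => inner ℝ (x k) (c f)) Filter.atTop (𝓝 (inner ℝ w (c f))) :=
      hxw.inner tendsto_const_nhds
    rw [hwi, hJc] at h1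
    refine h1.congr fun k => ?_
    rw [← hy k]
    exact UniformSpace.Completion.inner_coe _ _

end WeakEigenbasis

end EigenmapRegistration

/-! ### Decay of the Fourier transform -/

namespace EigenmapRegistration

section Fourier

open scoped FourierTransform

variable {V : Type*} [NormedAddCommGroup V] [InnerProductSpace ℝ V] [FiniteDimensional ℝ V]
  [MeasurableSpace V] [BorelSpace V]

omit [FiniteDimensional ℝ V] [MeasurableSpace V] [BorelSpace V] in
theorem norm_iteratedFDeriv_slice_le {p : V × V → ℂ} (hp : ContDiff ℝ ∞ p) (j : ℕ) (θ x : V) :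
    ‖iteratedFDeriv ℝ j (fun y => p (y, θ)) x‖ ≤ ‖iteratedFDeriv ℝ j p (x, θ)‖ := by
  have h1 : (fun y => p (y, θ)) =
      (fun q => p (q + (0, θ))) ∘ (ContinuousLinearMap.inl ℝ V V) := by
    ext y; simp
  have hq : ContDiff ℝ ∞ (fun q => p (q + (0, θ))) := hp.comp (contDiff_id.add contDiff_const)
  rw [h1, ContinuousLinearMap.iteratedFDeriv_comp_right _ hq x (by exact_mod_cast le_top),
    iteratedFDeriv_comp_add_right]
  refine (ContinuousMultilinearMap.norm_compContinuousLinearMap_le _ _).trans ?_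
  have h2 : ‖ContinuousLinearMap.inl ℝ V V‖ ≤ 1 :=
    ContinuousLinearMap.opNorm_le_bound _ zero_le_one fun y => by simp
  simp only [Finset.prod_const, Finset.card_univ, Fintype.card_fin, ContinuousLinearMap.inl_apply,
    Prod.mk_add_mk, add_zero, zero_add]
  exact mul_le_of_le_one_right (norm_nonneg _) (pow_le_one₀ (norm_nonneg _) h2)

omit [FiniteDimensional ℝ V] [MeasurableSpace V] [BorelSpace V] in
theorem iteratedFDeriv_slice_eq_zero {p : V × V → ℂ} {K : Set V} (hK : IsCompact K)
    (hpK : ∀ x ∉ K, ∀ θ, p (x, θ) = 0) (j : ℕ) (θ : V) {x : V} (hx : x ∉ K) :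
    iteratedFDeriv ℝ j (fun y => p (y, θ)) x = 0 := by
  have h1 : (fun y => p (y, θ)) =ᶠ[𝓝 x] fun _ => 0 :=
    Filter.mem_of_superset (hK.isClosed.isOpen_compl.mem_nhds hx) fun y hy => hpK y hy θ
  have h2 := (h1.iteratedFDeriv ℝ j).eq_of_nhds
  rw [h2]
  exact congrFun iteratedFDeriv_fun_zero x

/-- The Fourier transforms of a compact family of test functions decay rapidly, uniformly in the
parameter. -/
theorem exists_fourier_decay_slice {p : V × V → ℂ} (hp : ContDiff ℝ ∞ p) {K Θ : Set V}
    (hK : IsCompact K) (hΘ : IsCompact Θ) (hpK : ∀ x ∉ K, ∀ θ, p (x, θ) = 0) (N : ℕ) :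
    ∃ C : ℝ, ∀ θ ∈ Θ, ∀ η, (1 + ‖η‖) ^ N * ‖𝓕 (fun x => p (x, θ)) η‖ ≤ C := by
  have hsl : ∀ θ, ContDiff ℝ ∞ (fun x => p (x, θ)) := fun θ =>
    hp.comp (contDiff_id.prodMk contDiff_const)
  -- Compactness of `K × Θ` gives one bound for all parameters, and the indicator of `K` makes it
  -- integrable.
  have hM : ∀ j : ℕ, ∃ M : ℝ, 0 ≤ M ∧ ∀ x, ∀ θ ∈ Θ,
      ‖iteratedFDeriv ℝ j (fun y => p (y, θ)) x‖ ≤ K.indicator (fun _ => M) x := fun j => by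
    have hc : Continuous fun q => ‖iteratedFDeriv ℝ j p q‖ :=
      (hp.continuous_iteratedFDeriv (by exact_mod_cast le_top)).norm
    obtain ⟨M, hM⟩ := (hK.prod hΘ).bddAbove_image hc.continuousOn
    refine ⟨max M 0, le_max_right _ _, fun x θ hθ => ?_⟩
    by_cases hx : x ∈ K
    · rw [Set.indicator_of_mem hx]
      exact (norm_iteratedFDeriv_slice_le hp j θ x).trans
        ((hM ⟨(x, θ), ⟨hx, hθ⟩, rfl⟩).trans (le_max_left _ _))
    · rw [iteratedFDeriv_slice_eq_zero hK hpK j θ hx, norm_zero, Set.indicator_of_notMem hx]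
  choose M hM0 hM using hM
  have hInd : ∀ j, Integrable (K.indicator fun _ : V => M j) := fun j =>
    (integrable_indicator_iff hK.measurableSet).2 (integrableOn_const hK.measure_lt_top.ne)
  have hint : ∀ θ, ∀ j : ℕ, Integrable (fun x => iteratedFDeriv ℝ j (fun y => p (y, θ)) x) :=
    fun θ j => by
      refine Continuous.integrable_of_hasCompactSupport
        ((hsl θ).continuous_iteratedFDeriv (by exact_mod_cast le_top)) ?_
      exact HasCompactSupport.intro hK fun x hx => iteratedFDeriv_slice_eq_zero hK hpK j θ hx
  have hpow : ∀ n : ℕ, ∀ θ ∈ Θ, ∀ η, ‖η‖ ^ n * ‖𝓕 (fun x => p (x, θ)) η‖ ≤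
      2 ^ n * ∑ q ∈ Finset.range 1 ×ˢ Finset.range (n + 1),
        ∫ v, K.indicator (fun _ : V => M q.2) v := fun n θ hθ η => by
    have h := Real.pow_mul_norm_iteratedFDeriv_fourier_le (K := 0) (N := ⊤) (k := 0) (n := n)
      (f := fun x => p (x, θ)) (hsl θ) (fun k m hk _ => by
        have hk0 : k = 0 := by simpa using hk
        subst hk0
        simpa using (hint θ m).norm) le_rfl le_top η
    simp only [norm_iteratedFDeriv_zero, pow_zero, Nat.cast_zero, mul_zero, zero_add,
      one_mul] at h
    refine h.trans ?_
    refine mul_le_mul_of_nonneg_left (Finset.sum_le_sum fun q hq => ?_)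
      (pow_nonneg (zero_le_two : (0 : ℝ) ≤ 2) n)
    have hq1 : q.1 = 0 := by
      have := (Finset.mem_product.1 hq).1
      simpa using this
    rw [hq1]
    simp only [pow_zero, one_mul]
    exact integral_mono (hint θ q.2).norm (hInd q.2) fun x => hM q.2 x θ hθ
  refine ⟨2 ^ N * ((2 ^ 0 * ∑ q ∈ Finset.range 1 ×ˢ Finset.range (0 + 1),
        ∫ v, K.indicator (fun _ : V => M q.2) v) +
      (2 ^ N * ∑ q ∈ Finset.range 1 ×ˢ Finset.range (N + 1),
        ∫ v, K.indicator (fun _ : V => M q.2) v)), fun θ hθ η => ?_⟩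
  have h1 : (1 + ‖η‖) ^ N ≤ 2 ^ N * (1 + ‖η‖ ^ N) := by
    rcases le_total ‖η‖ 1 with h | h
    · calc (1 + ‖η‖) ^ N ≤ 2 ^ N := pow_le_pow_left₀ (by positivity) (by linarith) N
        _ ≤ 2 ^ N * (1 + ‖η‖ ^ N) :=
          le_mul_of_one_le_right (by positivity) (by linarith [pow_nonneg (norm_nonneg η) N])
    · calc (1 + ‖η‖) ^ N ≤ (2 * ‖η‖) ^ N := pow_le_pow_left₀ (by positivity) (by linarith) N
        _ = 2 ^ N * ‖η‖ ^ N := mul_pow _ _ _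
        _ ≤ 2 ^ N * (1 + ‖η‖ ^ N) := by gcongr; linarith
  calc _ ≤ 2 ^ N * (1 + ‖η‖ ^ N) * ‖𝓕 (fun x => p (x, θ)) η‖ := by gcongr
    _ = 2 ^ N * (‖η‖ ^ 0 * ‖𝓕 (fun x => p (x, θ)) η‖ + ‖η‖ ^ N * ‖𝓕 (fun x => p (x, θ)) η‖) := by
      rw [pow_zero]; ring
    _ ≤ _ := mul_le_mul_of_nonneg_left (add_le_add (hpow 0 θ hθ η) (hpow N θ hθ η)) (by positivity)

/-- This is the self-adjointness of the Fourier transform for the bilinear pairing, after the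
substitution `x ↦ -x` that exchanges `𝓕` and `𝓕⁻`. -/
theorem integral_fourierInv_smul_eq {f g : V → ℂ} (hf : Integrable f) (hg : Integrable g) :
    ∫ x, 𝓕⁻ f x * g x = ∫ x, f x * 𝓕⁻ g x := by
  have h := VectorFourier.integral_fourierIntegral_smul_eq_flip (𝕜 := ℝ) (L := innerₗ V)
    (μ := (volume : Measure V)) (ν := (volume : Measure V)) (e := Real.fourierChar)
    Real.continuous_fourierChar continuous_inner hf (hg.comp_neg)
  have e1 : ∀ u : V → ℂ, VectorFourier.fourierIntegral Real.fourierChar volume (innerₗ V) u = 𝓕 u :=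
    fun u => rfl
  rw [flip_innerₗ, e1, e1] at h
  simp only [smul_eq_mul] at h
  have e2 : ∀ x, 𝓕⁻ f x * g x = (fun y => 𝓕 f y * g (-y)) (-x) := fun x => by
    simp [Real.fourierInv_eq_fourier_neg]
  rw [integral_congr_ae (Filter.Eventually.of_forall e2),
    integral_neg_eq_self (fun y => 𝓕 f y * g (-y)), h]
  refine integral_congr_ae (Filter.Eventually.of_forall fun x => ?_)
  simp only [Real.fourierInv_eq_fourier_comp_neg]

/-- The Fourier transform of a product with a function that has an integrable Fourier
transform. -/
theorem fourier_mul_eq_integral {p w : V → ℂ} (hpc : Continuous p) (hp : Integrable p)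
    (hp' : Integrable (𝓕 p)) (hw : Integrable w) (ξ : V) :
    𝓕 (fun x => p x * w x) ξ = ∫ η, 𝓕 p η * 𝓕 w (ξ - η) := by
  have h1 : ∀ x, 𝓕⁻ (𝓕 p) x = p x := fun x => congrFun (hpc.fourierInv_fourier_eq hp hp') x
  -- The convolution formula is the multiplication formula for `𝓕 p` and `w` modulated by the
  -- character of frequency `ξ`, whose inverse transform at `η` is `𝓕 w (ξ - η)`.
  have hW : Integrable (fun x => Real.fourierChar (-inner ℝ x ξ) • w x) := by
    have := (Real.fourierIntegral_convergent_iff' (innerSL ℝ) (f := w) ξ).2 hw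
    simpa using this
  have h2 : ∀ η, 𝓕⁻ (fun x => Real.fourierChar (-inner ℝ x ξ) • w x) η = 𝓕 w (ξ - η) := fun η => by
    rw [Real.fourierInv_eq, Real.fourier_eq]
    refine integral_congr_ae (Filter.Eventually.of_forall fun x => ?_)
    simp only [smul_smul, ← AddChar.map_add_eq_mul, inner_sub_right]
    congr 2
    ring
  have h3 := integral_fourierInv_smul_eq hp' hW
  simp_rw [h2, h1] at h3
  rw [← h3, Real.fourier_eq]
  refine integral_congr_ae (Filter.Eventually.of_forall fun x => ?_)
  simp only [Circle.smul_def, smul_eq_mul]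
  ring

/-- The extra `finrank + 1` powers in the hypothesis pay for integrability over the whole space. -/
theorem integrable_of_fourier_decay {q : V → ℂ} (hq : AEStronglyMeasurable q volume) {C : ℝ}
    (k : ℕ) (h : ∀ η, (1 + ‖η‖) ^ (k + (Module.finrank ℝ V + 1)) * ‖q η‖ ≤ C) :
    Integrable (fun η => (1 + ‖η‖) ^ k * ‖q η‖) := by
  have hI : Integrable (fun η : V => C * (1 + ‖η‖) ^ (-((Module.finrank ℝ V + 1 : ℕ) : ℝ))) :=
    (integrable_one_add_norm (by push_cast; linarith)).const_mul C
  refine hI.mono' (by fun_prop) (Filter.Eventually.of_forall fun η => ?_)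
  have h1 : (0 : ℝ) < 1 + ‖η‖ := by positivity
  rw [Real.rpow_neg h1.le, Real.rpow_natCast, ← div_eq_mul_inv, le_div_iff₀ (by positivity),
    Real.norm_of_nonneg (by positivity)]
  calc _ = (1 + ‖η‖) ^ (k + (Module.finrank ℝ V + 1)) * ‖q η‖ := by rw [pow_add]; ring
    _ ≤ C := h η

theorem continuous_fourier {w : V → ℂ} (hw : Integrable w) : Continuous (𝓕 w) :=
  VectorFourier.fourierIntegral_continuous Real.continuous_fourierChar
    (by exact continuous_inner) hw

/-- Multiplication by a compact family of test functions preserves the rate of decay of the Fourier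
transform, uniformly in the parameter. -/
theorem exists_fourier_decay_mul {p : V × V → ℂ} (hp : ContDiff ℝ ∞ p) {K Θ : Set V}
    (hK : IsCompact K) (hΘ : IsCompact Θ) (hpK : ∀ x ∉ K, ∀ θ, p (x, θ) = 0) (s : ℕ) {w : V → ℂ}
    (hw : Integrable w) {C : ℝ} (hC : ∀ ξ, (1 + ‖ξ‖) ^ s * ‖𝓕 w ξ‖ ≤ C) :
    ∃ C' : ℝ, ∀ θ ∈ Θ, ∀ ξ, (1 + ‖ξ‖) ^ s * ‖𝓕 (fun x => p (x, θ) * w x) ξ‖ ≤ C' := by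
  -- Of these powers, `s` absorb the weight moved onto `η`, and the others make the convolution
  -- integral converge.
  obtain ⟨D, hD⟩ := exists_fourier_decay_slice hp hK hΘ hpK (s + (Module.finrank ℝ V + 1))
  refine ⟨∫ η : V, D * (1 + ‖η‖) ^ (-((Module.finrank ℝ V + 1 : ℕ) : ℝ)) * C, fun θ hθ ξ => ?_⟩
  have hsl : ContDiff ℝ ∞ (fun x => p (x, θ)) := hp.comp (contDiff_id.prodMk contDiff_const)
  have hpi : Integrable (fun x => p (x, θ)) :=
    hsl.continuous.integrable_of_hasCompactSupport (HasCompactSupport.intro hK fun x hx => hpK x hx θ)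
  have hFi : Integrable (𝓕 (fun x => p (x, θ))) := by
    have hm := (continuous_fourier hpi).aestronglyMeasurable (μ := volume)
    obtain ⟨D', hD'⟩ := exists_fourier_decay_slice hp hK hΘ hpK (0 + (Module.finrank ℝ V + 1))
    have := integrable_of_fourier_decay hm 0 (hD' θ hθ)
    simp only [pow_zero, one_mul] at this
    exact (integrable_norm_iff hm).1 this
  rw [fourier_mul_eq_integral hsl.continuous hpi hFi hw]
  have hI : Integrable (fun η : V => D * (1 + ‖η‖) ^ (-((Module.finrank ℝ V + 1 : ℕ) : ℝ)) * C) :=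
    ((integrable_one_add_norm (by push_cast; linarith)).const_mul D).mul_const C
  rw [← Real.norm_of_nonneg (show 0 ≤ (1 + ‖ξ‖) ^ s by positivity), ← norm_smul, ← integral_smul]
  refine norm_integral_le_of_norm_le hI (Filter.Eventually.of_forall fun η => ?_)
  rw [norm_smul, norm_mul, Real.norm_of_nonneg (show 0 ≤ (1 + ‖ξ‖) ^ s by positivity)]
  have h1 : (0 : ℝ) < 1 + ‖η‖ := by positivity
  have h2 : (1 + ‖η‖) ^ s * ‖𝓕 (fun x => p (x, θ)) η‖ ≤
      D * (1 + ‖η‖) ^ (-((Module.finrank ℝ V + 1 : ℕ) : ℝ)) := by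
    rw [Real.rpow_neg h1.le, Real.rpow_natCast, ← div_eq_mul_inv, le_div_iff₀ (by positivity)]
    calc _ = (1 + ‖η‖) ^ (s + (Module.finrank ℝ V + 1)) * ‖𝓕 (fun x => p (x, θ)) η‖ := by
          rw [pow_add]; ring
      _ ≤ D := hD θ hθ η
  -- Submultiplicativity of the weight distributes it over the two factors of the convolution.
  have h3 : (1 + ‖ξ‖) ^ s ≤ (1 + ‖η‖) ^ s * (1 + ‖ξ - η‖) ^ s := by
    rw [← mul_pow]
    refine pow_le_pow_left₀ (by positivity) ?_ s
    have : ‖ξ‖ ≤ ‖η‖ + ‖ξ - η‖ := by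
      calc ‖ξ‖ = ‖η + (ξ - η)‖ := by congr 1; abel
        _ ≤ _ := norm_add_le _ _
    nlinarith [norm_nonneg η, norm_nonneg (ξ - η),
      mul_nonneg (norm_nonneg η) (norm_nonneg (ξ - η))]
  calc _ ≤ (1 + ‖η‖) ^ s * (1 + ‖ξ - η‖) ^ s *
          (‖𝓕 (fun x => p (x, θ)) η‖ * ‖𝓕 w (ξ - η)‖) := by gcongr
    _ = ((1 + ‖η‖) ^ s * ‖𝓕 (fun x => p (x, θ)) η‖) *
          ((1 + ‖ξ - η‖) ^ s * ‖𝓕 w (ξ - η)‖) := by ring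
    _ ≤ _ := mul_le_mul h2 (hC _) (by positivity) ((by positivity : (0 : ℝ) ≤ _).trans h2)

/-- An integrable function whose Fourier transform decays rapidly is almost everywhere equal to a
smooth function. -/
theorem exists_contDiff_of_fourier_decay {v : V → ℂ} (hv : Integrable v)
    (h : ∀ s : ℕ, ∃ C : ℝ, ∀ ξ, (1 + ‖ξ‖) ^ s * ‖𝓕 v ξ‖ ≤ C) :
    ∃ U : V → ℂ, ContDiff ℝ ∞ U ∧ v =ᵐ[volume] U := by
  have hcont : Continuous (𝓕 v) := continuous_fourier hv
  have hint : ∀ k : ℕ, Integrable (fun ξ => (1 + ‖ξ‖) ^ k * ‖𝓕 v ξ‖) := fun k => by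
    obtain ⟨C, hC⟩ := h (k + (Module.finrank ℝ V + 1))
    exact integrable_of_fourier_decay hcont.aestronglyMeasurable k hC
  have hFv : Integrable (𝓕 v) := by
    have := hint 0
    simp only [pow_zero, one_mul] at this
    exact (integrable_norm_iff hcont.aestronglyMeasurable).1 this
  have hU : ContDiff ℝ ∞ (𝓕⁻ (𝓕 v)) := by
    have h1 : ContDiff ℝ ((⊤ : ℕ∞) : WithTop ℕ∞) (𝓕 (𝓕 v)) :=
      Real.contDiff_fourier (N := ⊤) fun k _ => by
        refine (hint k).mono' (by fun_prop) (Filter.Eventually.of_forall fun ξ => ?_)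
        rw [Real.norm_of_nonneg (by positivity)]
        gcongr
        linarith
    have h2 : 𝓕⁻ (𝓕 v) = fun x => 𝓕 (𝓕 v) (-x) := by
      ext x; exact Real.fourierInv_eq_fourier_neg _ _
    rw [h2]
    exact h1.comp contDiff_neg
  refine ⟨𝓕⁻ (𝓕 v), hU, ?_⟩
  -- As `v` is only integrable, the inversion formula is verified against test functions, by moving
  -- the transforms from one factor to the other.
  refine ae_eq_of_integral_contDiff_smul_eq hv.locallyIntegrable
    hU.continuous.locallyIntegrable fun g hg hgc => ?_
  let φ : V → ℂ := fun x => (g x : ℂ)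
  have hφ : ContDiff ℝ ∞ φ := Complex.ofRealCLM.contDiff.comp hg
  have hφc : HasCompactSupport φ := hgc.comp_left (g := fun r : ℝ => (r : ℂ)) rfl
  have hφi : Integrable φ := hφ.continuous.integrable_of_hasCompactSupport hφc
  have hFφ : Integrable (𝓕 φ) := by
    have := ((hφc.toSchwartzMap hφ).fourier_coe ▸
      (𝓕 (hφc.toSchwartzMap hφ)).integrable (μ := volume))
    exact this
  have h1 : ∀ x, 𝓕⁻ (𝓕 φ) x = φ x := fun x =>
    congrFun (hφ.continuous.fourierInv_fourier_eq hφi hFφ) x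
  have h2 : ∫ x, φ x * v x = ∫ x, 𝓕 φ x * 𝓕⁻ v x := by
    rw [← integral_fourierInv_smul_eq hFφ hv]
    simp_rw [h1]
  have h3 : ∫ x, φ x * 𝓕⁻ (𝓕 v) x = ∫ x, 𝓕 v x * 𝓕⁻ φ x := by
    rw [← integral_fourierInv_smul_eq hFv hφi]
    simp_rw [mul_comm]
  have h4 : ∫ x, 𝓕 φ x * 𝓕⁻ v x = ∫ x, 𝓕 v x * 𝓕⁻ φ x := by
    rw [← integral_neg_eq_self (fun x => 𝓕 v x * 𝓕⁻ φ x)]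
    refine integral_congr_ae (Filter.Eventually.of_forall fun x => ?_)
    simp only [Real.fourierInv_eq_fourier_neg, neg_neg]
    exact mul_comm _ _
  have h5 : ∀ u : V → ℂ, ∫ x, g x • u x = ∫ x, φ x * u x := fun u => by
    refine integral_congr_ae (Filter.Eventually.of_forall fun x => ?_)
    simp [φ]
  rw [h5, h5, h2, h3, h4]

end Fourier

end EigenmapRegistration

/-! ### Divergence form operators acting on plane waves -/

namespace EigenmapRegistration

section PartialDeriv

variable {n : ℕ}

local notation "𝔼" => EuclideanSpace ℝ (Fin n)

theorem partialDeriv_mul {f h : 𝔼 → ℝ} {x : 𝔼} (i : Fin n) (hf : DifferentiableAt ℝ f x)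
    (hh : DifferentiableAt ℝ h x) :
    partialDeriv i (fun y => f y * h y) x = f x * partialDeriv i h x + partialDeriv i f x * h x := by
  unfold partialDeriv
  rw [fderiv_fun_mul hf hh]
  simp [mul_comm]

theorem partialDeriv_add {f h : 𝔼 → ℝ} {x : 𝔼} (i : Fin n) (hf : DifferentiableAt ℝ f x)
    (hh : DifferentiableAt ℝ h x) :
    partialDeriv i (fun y => f y + h y) x = partialDeriv i f x + partialDeriv i h x := by
  unfold partialDeriv
  rw [fderiv_fun_add hf hh]
  simp

theorem partialDeriv_congr {f h : 𝔼 → ℝ} {x : 𝔼} (i : Fin n) (hfh : f =ᶠ[𝓝 x] h) :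
    partialDeriv i f x = partialDeriv i h x := by
  unfold partialDeriv
  rw [hfh.fderiv_eq]

theorem contDiff_partialDeriv {f : 𝔼 → ℝ} (i : Fin n) (hf : ContDiff ℝ ∞ f) :
    ContDiff ℝ ∞ (partialDeriv i f) :=
  (hf.fderiv_right (m := ∞) (by simp)).clm_apply contDiff_const

theorem tsupport_partialDeriv_subset (f : 𝔼 → ℝ) (i : Fin n) :
    tsupport (partialDeriv i f) ⊆ tsupport f := by
  refine (closure_mono ?_).trans (closure_minimal (support_fderiv_subset ℝ (f := f))
    isClosed_closure)
  intro x hx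
  rw [Function.mem_support] at hx ⊢
  intro h
  exact hx (by unfold partialDeriv; rw [h]; rfl)

/-- The second order operator `∑ᵢ ∂ᵢ(∑ⱼ aᵢⱼ ∂ⱼ ψ) + c ψ` in divergence form. -/
noncomputable def divFormOp (a : Fin n → Fin n → 𝔼 → ℝ) (c : 𝔼 → ℝ) (ψ : 𝔼 → ℝ) (x : 𝔼) : ℝ :=
  ∑ i, partialDeriv i (fun y => ∑ j, a i j y * partialDeriv j ψ y) x + c x * ψ x

/-- The partial derivative in the first variable. -/
noncomputable def partialFst (i : Fin n) (f : 𝔼 × 𝔼 → ℝ) (q : 𝔼 × 𝔼) : ℝ :=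
  fderiv ℝ f q (EuclideanSpace.single i (1 : ℝ), 0)

theorem contDiff_partialFst {f : 𝔼 × 𝔼 → ℝ} (i : Fin n) (hf : ContDiff ℝ ∞ f) :
    ContDiff ℝ ∞ (partialFst i f) :=
  (hf.fderiv_right (m := ∞) (by simp)).clm_apply contDiff_const

theorem partialDeriv_slice {f : 𝔼 × 𝔼 → ℝ} (i : Fin n) (hf : ContDiff ℝ ∞ f) (x θ : 𝔼) :
    partialDeriv i (fun y => f (y, θ)) x = partialFst i f (x, θ) := by
  have h1 : HasFDerivAt (fun y : 𝔼 => (y, θ)) (ContinuousLinearMap.inl ℝ 𝔼 𝔼) x :=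
    hasFDerivAt_prodMk_left x θ
  have h2 : HasFDerivAt f (fderiv ℝ f (x, θ)) (x, θ) :=
    (hf.differentiable (by simp) _).hasFDerivAt
  have h3 := h2.comp x h1
  unfold partialDeriv partialFst
  have h4 : fderiv ℝ (fun y => f (y, θ)) x = _ := h3.fderiv
  rw [h4]
  simp

theorem partialFst_eq_zero {f : 𝔼 × 𝔼 → ℝ} {K : Set 𝔼} (hK : IsClosed K)
    (hf : ∀ x ∉ K, ∀ θ, f (x, θ) = 0) (i : Fin n) : ∀ x ∉ K, ∀ θ, partialFst i f (x, θ) = 0 := by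
  intro x hx θ
  have h1 : f =ᶠ[𝓝 (x, θ)] fun _ => 0 := by
    have : {q : 𝔼 × 𝔼 | q.1 ∈ Kᶜ} ∈ 𝓝 (x, θ) :=
      (hK.isOpen_compl.preimage continuous_fst).mem_nhds hx
    exact Filter.mem_of_superset this fun q hq => hf q.1 hq q.2
  unfold partialFst
  rw [h1.fderiv_eq]
  simp

/-- The action of a divergence form operator on the product of `m` with a plane wave `φ` of
frequency `t • θ` whose derivative is `φ'`. -/
theorem divFormOp_mul_wave {a : Fin n → Fin n → 𝔼 → ℝ} {c : 𝔼 → ℝ}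
    (ha : ∀ i j, ContDiff ℝ ∞ (a i j)) {m φ φ' : 𝔼 → ℝ} (hm : ContDiff ℝ ∞ m)
    (hφ : Differentiable ℝ φ) (hφ' : Differentiable ℝ φ') {θ : 𝔼} {t κ : ℝ}
    (h1 : ∀ i x, partialDeriv i φ x = t * θ i * φ' x)
    (h2 : ∀ i x, partialDeriv i φ' x = -κ * (t * θ i) * φ x) (x : 𝔼) :
    divFormOp a c (fun y => m y * φ y) x =
      (∑ i, partialDeriv i (fun y => ∑ j, a i j y * partialDeriv j m y) x + c x * m x) * φ x +
      t * (∑ i, ((∑ j, a i j x * partialDeriv j m x) * θ i +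
        partialDeriv i (fun y => m y * ∑ j, a i j y * θ j) x)) * φ' x -
      κ * t ^ 2 * (m x * ∑ i, ∑ j, a i j x * (θ i * θ j)) * φ x := by
  have hmd : Differentiable ℝ m := hm.differentiable (by simp)
  have hB : ∀ i, Differentiable ℝ fun y => ∑ j, a i j y * partialDeriv j m y := fun i =>
    (ContDiff.sum fun j _ => (ha i j).mul (contDiff_partialDeriv j hm) :
      ContDiff ℝ ∞ _).differentiable (by simp)
  have hQ : ∀ i, Differentiable ℝ fun y => m y * ∑ j, a i j y * θ j := fun i =>
    (hm.mul (ContDiff.sum fun j _ => (ha i j).mul contDiff_const) :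
      ContDiff ℝ ∞ _).differentiable (by simp)
  -- Each derivative that falls on the wave produces a factor `t` and exchanges `φ` with `φ'`;
  -- sorting by the number of such derivatives gives the three terms.
  have e1 : ∀ i, (fun y => ∑ j, a i j y * partialDeriv j (fun z => m z * φ z) y) =
      fun y => (∑ j, a i j y * partialDeriv j m y) * φ y +
        t * ((m y * ∑ j, a i j y * θ j) * φ' y) := fun i => by
    ext y
    rw [Finset.sum_mul, Finset.mul_sum, Finset.sum_mul, Finset.mul_sum, ← Finset.sum_add_distrib]
    refine Finset.sum_congr rfl fun j _ => ?_
    rw [partialDeriv_mul j (hmd y) (hφ y), h1]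
    ring
  have e2 : ∀ i, partialDeriv i
      (fun y => ∑ j, a i j y * partialDeriv j (fun z => m z * φ z) y) x =
      partialDeriv i (fun y => ∑ j, a i j y * partialDeriv j m y) x * φ x +
      t * ((∑ j, a i j x * partialDeriv j m x) * θ i +
        partialDeriv i (fun y => m y * ∑ j, a i j y * θ j) x) * φ' x -
      κ * t ^ 2 * (m x * ∑ j, a i j x * (θ i * θ j)) * φ x := fun i => by
    rw [e1, partialDeriv_add i ((hB i x).fun_mul (hφ x))
      (((hQ i x).fun_mul (hφ' x)).const_mul t),
      partialDeriv_mul i (hB i x) (hφ x), partialDeriv_mul i (by fun_prop)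
      ((hQ i x).fun_mul (hφ' x)), partialDeriv_mul i (hQ i x) (hφ' x), h1, h2]
    have e3 : partialDeriv i (fun _ : 𝔼 => t) x = 0 := by simp [partialDeriv]
    have e4 : ∑ j, a i j x * (θ i * θ j) = θ i * ∑ j, a i j x * θ j := by
      rw [Finset.mul_sum]
      exact Finset.sum_congr rfl fun j _ => by ring
    rw [e3, e4]
    ring
  unfold divFormOp
  simp_rw [e2]
  rw [Finset.sum_sub_distrib, Finset.sum_add_distrib]
  simp only [Finset.sum_mul, Finset.mul_sum, add_mul]
  ring

end PartialDeriv

end EigenmapRegistration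

/-! ### Cutoffs, cosine and sine integrals, and division by the principal symbol -/

namespace EigenmapRegistration

theorem exists_cutoff {V : Type*} [NormedAddCommGroup V] [NormedSpace ℝ V] [FiniteDimensional ℝ V]
    {K Ω : Set V} (hK : IsCompact K) (hΩ : IsOpen Ω) (h : K ⊆ Ω) :
    ∃ χ : V → ℝ, ContDiff ℝ ∞ χ ∧ HasCompactSupport χ ∧ tsupport χ ⊆ Ω ∧
      (∀ᶠ x in 𝓝ˢ K, χ x = 1) ∧ ∀ x, χ x ∈ Set.Icc (0 : ℝ) 1 := by
  obtain ⟨K', hK', hKK', hK'Ω⟩ := exists_compact_between hK hΩ h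
  obtain ⟨f, hf1, hf0, hf⟩ := exists_contMDiffMap_one_nhds_of_subset_interior 𝓘(ℝ, V)
    (n := (⊤ : ℕ∞)) hK.isClosed hKK'
  have hsub : tsupport f ⊆ K' :=
    closure_minimal (fun x hx => by_contra fun hxK => hx (hf0 x hxK)) hK'.isClosed
  exact ⟨f, contMDiff_iff_contDiff.1 f.contMDiff, hK'.of_isClosed_subset isClosed_closure hsub,
    hsub.trans hK'Ω, hf1, hf⟩

section Regularity

open scoped FourierTransform

variable {n : ℕ}

local notation "𝔼" => EuclideanSpace ℝ (Fin n)

/-- The weak equation is real and is tested with real waves. This formula and the three estimates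
after it pass between cosine and sine integrals and the complex transform. -/
theorem fourier_ofReal_eq {f : 𝔼 → ℝ} (hf : Integrable f) (ξ : 𝔼) :
    𝓕 (fun x => (f x : ℂ)) ξ =
      ((∫ x, f x * Real.cos (2 * Real.pi * inner ℝ x ξ) : ℝ) : ℂ) -
        ((∫ x, f x * Real.sin (2 * Real.pi * inner ℝ x ξ) : ℝ) : ℂ) * Complex.I := by
  rw [Real.fourier_eq', ← integral_complex_ofReal, ← integral_complex_ofReal,
    ← integral_mul_const, ← integral_sub]
  · refine integral_congr_ae (Filter.Eventually.of_forall fun x => ?_)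
    simp only [smul_eq_mul, Complex.exp_mul_I]
    push_cast
    have : (-2 * (Real.pi : ℂ) * (inner ℝ x ξ : ℝ)) = -(2 * (Real.pi : ℂ) * (inner ℝ x ξ : ℝ)) := by
      ring
    rw [this, Complex.cos_neg, Complex.sin_neg]
    ring
  · refine Integrable.ofReal (hf.mul_bdd (c := 1) (by fun_prop) ?_)
    exact Filter.Eventually.of_forall fun x => Real.abs_cos_le_one _
  · refine (Integrable.ofReal (hf.mul_bdd (c := 1) (by fun_prop) ?_)).mul_const _
    exact Filter.Eventually.of_forall fun x => Real.abs_sin_le_one _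

theorem abs_integral_cos_le {f : 𝔼 → ℝ} (hf : Integrable f) (ξ : 𝔼) :
    |∫ x, f x * Real.cos (2 * Real.pi * inner ℝ x ξ)| ≤ ‖𝓕 (fun x => (f x : ℂ)) ξ‖ := by
  refine le_trans (le_of_eq ?_) (Complex.abs_re_le_norm _)
  rw [fourier_ofReal_eq hf]
  simp

theorem abs_integral_sin_le {f : 𝔼 → ℝ} (hf : Integrable f) (ξ : 𝔼) :
    |∫ x, f x * Real.sin (2 * Real.pi * inner ℝ x ξ)| ≤ ‖𝓕 (fun x => (f x : ℂ)) ξ‖ := by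
  refine le_trans (le_of_eq ?_) (Complex.abs_im_le_norm _)
  rw [fourier_ofReal_eq hf]
  simp

theorem norm_fourier_ofReal_le {f : 𝔼 → ℝ} (hf : Integrable f) (ξ : 𝔼) :
    ‖𝓕 (fun x => (f x : ℂ)) ξ‖ ≤ |∫ x, f x * Real.cos (2 * Real.pi * inner ℝ x ξ)| +
      |∫ x, f x * Real.sin (2 * Real.pi * inner ℝ x ξ)| := by
  rw [fourier_ofReal_eq hf]
  refine (norm_sub_le _ _).trans (le_of_eq ?_)
  rw [norm_mul, Complex.norm_I, mul_one, Complex.norm_real, Complex.norm_real]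
  rfl

/-- The coefficients produced by a divergence form operator acting on a product of a plane wave in
the direction `θ` with the quotient of a cutoff by the symbol: they are smooth in the point and the
direction. -/
theorem exists_symbol_coefficients {a : Fin n → Fin n → 𝔼 → ℝ} {c : 𝔼 → ℝ}
    (ha : ∀ i j, ContDiff ℝ ∞ (a i j)) (hc : ContDiff ℝ ∞ c)
    (hpos : ∀ x θ : 𝔼, θ ≠ 0 → 0 < ∑ i, ∑ j, a i j x * (θ i * θ j))
    {χ : 𝔼 → ℝ} (hχ : ContDiff ℝ ∞ χ) :
    ∃ p₀ p₁ m : 𝔼 × 𝔼 → ℝ, ContDiff ℝ ∞ p₀ ∧ ContDiff ℝ ∞ p₁ ∧ ContDiff ℝ ∞ m ∧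
      (∀ x ∉ tsupport χ, ∀ θ, p₀ (x, θ) = 0) ∧ (∀ x ∉ tsupport χ, ∀ θ, p₁ (x, θ) = 0) ∧
      (∀ x ∉ tsupport χ, ∀ θ, m (x, θ) = 0) ∧
      ∀ (θ : 𝔼) (t κ : ℝ) (φ φ' : 𝔼 → ℝ), ‖θ‖ = 1 → Differentiable ℝ φ → Differentiable ℝ φ' →
        (∀ i x, partialDeriv i φ x = t * θ i * φ' x) →
        (∀ i x, partialDeriv i φ' x = -κ * (t * θ i) * φ x) →
        ∀ x, divFormOp a c (fun y => m (y, θ) * φ y) x =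
          p₀ (x, θ) * φ x + t * p₁ (x, θ) * φ' x - κ * t ^ 2 * χ x * φ x := by
  -- The added square vanishes for unit `θ` and keeps `A` positive at `θ = 0`. So `m = χ / A` is
  -- smooth on the whole product, and multiplied by the symbol it gives `χ` on the unit sphere.
  let A : 𝔼 × 𝔼 → ℝ := fun q => ∑ i, ∑ j, a i j q.1 * (q.2 i * q.2 j) + (1 - ‖q.2‖ ^ 2) ^ 2
  have hcoord : ∀ i, ContDiff ℝ ∞ (fun q : 𝔼 × 𝔼 => q.2 i) := fun i =>
    (EuclideanSpace.proj (𝕜 := ℝ) i).contDiff.comp contDiff_snd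
  have haq : ∀ i j, ContDiff ℝ ∞ (fun q : 𝔼 × 𝔼 => a i j q.1) := fun i j =>
    (ha i j).comp contDiff_fst
  have hA : ContDiff ℝ ∞ A := by
    refine ContDiff.add (ContDiff.sum fun i _ => ContDiff.sum fun j _ =>
      (haq i j).mul ((hcoord i).mul (hcoord j))) ?_
    exact (contDiff_const.sub (contDiff_snd.norm_sq ℝ)).pow 2
  have hApos : ∀ q, 0 < A q := fun q => by
    by_cases h : q.2 = 0
    · simp [A, h]
    · exact add_pos_of_pos_of_nonneg (hpos q.1 q.2 h) (sq_nonneg _)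
  let m : 𝔼 × 𝔼 → ℝ := fun q => χ q.1 / A q
  have hm : ContDiff ℝ ∞ m := (hχ.comp contDiff_fst).div hA fun q => (hApos q).ne'
  have hm0 : ∀ x ∉ tsupport χ, ∀ θ, m (x, θ) = 0 := fun x hx θ => by
    simp [m, image_eq_zero_of_notMem_tsupport hx]
  have hcl : IsClosed (tsupport χ) := isClosed_tsupport χ
  let b : Fin n → 𝔼 × 𝔼 → ℝ := fun i q => ∑ j, a i j q.1 * partialFst j m q
  have hb : ∀ i, ContDiff ℝ ∞ (b i) := fun i =>
    ContDiff.sum fun j _ => (haq i j).mul (contDiff_partialFst j hm)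
  have hb0 : ∀ i, ∀ x ∉ tsupport χ, ∀ θ, b i (x, θ) = 0 := fun i x hx θ =>
    Finset.sum_eq_zero fun j _ => by rw [partialFst_eq_zero hcl hm0 j x hx θ, mul_zero]
  let d : Fin n → 𝔼 × 𝔼 → ℝ := fun i q => m q * ∑ j, a i j q.1 * q.2 j
  have hd : ∀ i, ContDiff ℝ ∞ (d i) := fun i =>
    hm.mul (ContDiff.sum fun j _ => (haq i j).mul (hcoord j))
  have hd0 : ∀ i, ∀ x ∉ tsupport χ, ∀ θ, d i (x, θ) = 0 := fun i x hx θ => by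
    simp [d, hm0 x hx θ]
  refine ⟨fun q => ∑ i, partialFst i (b i) q + c q.1 * m q,
    fun q => ∑ i, (b i q * q.2 i + partialFst i (d i) q), m, ?_, ?_, hm, ?_, ?_, hm0, ?_⟩
  · exact (ContDiff.sum fun i _ => contDiff_partialFst i (hb i)).add
      ((hc.comp contDiff_fst).mul hm)
  · exact ContDiff.sum fun i _ => ((hb i).mul (hcoord i)).add (contDiff_partialFst i (hd i))
  · intro x hx θ
    simp only [hm0 x hx θ, mul_zero, add_zero]
    exact Finset.sum_eq_zero fun i _ => partialFst_eq_zero hcl (hb0 i) i x hx θ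
  · intro x hx θ
    refine Finset.sum_eq_zero fun i _ => ?_
    rw [partialFst_eq_zero hcl (hd0 i) i x hx θ, hb0 i x hx θ]
    simp
  · intro θ t κ φ φ' hθ hφ hφ' h1 h2 x
    have hms : ContDiff ℝ ∞ (fun y => m (y, θ)) := hm.comp (contDiff_id.prodMk contDiff_const)
    rw [divFormOp_mul_wave ha hms hφ hφ' h1 h2]
    have e1 : ∀ i, (fun y => ∑ j, a i j y * partialDeriv j (fun z => m (z, θ)) y) =
        fun y => b i (y, θ) := fun i => by
      ext y
      exact Finset.sum_congr rfl fun j _ => by rw [partialDeriv_slice j hm]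
    have e1' : ∀ i, ∑ j, a i j x * partialDeriv j (fun z => m (z, θ)) x = b i (x, θ) := fun i =>
      congrFun (e1 i) x
    have e2 : ∀ i, partialDeriv i (fun y => m (y, θ) * ∑ j, a i j y * θ j) x =
        partialFst i (d i) (x, θ) := fun i => partialDeriv_slice i (hd i) x θ
    have e3 : m (x, θ) * ∑ i, ∑ j, a i j x * (θ i * θ j) = χ x := by
      have hA1 : A (x, θ) = ∑ i, ∑ j, a i j x * (θ i * θ j) := by simp [A, hθ]
      rw [← hA1]
      exact div_mul_cancel₀ _ (hApos _).ne'
    simp_rw [e1, e1', e2, e3, fun i => partialDeriv_slice i (hb i) x θ]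

end Regularity

end EigenmapRegistration

/-! ### Interior elliptic regularity -/

namespace EigenmapRegistration

section Regularity

open scoped FourierTransform

variable {n : ℕ}

local notation "𝔼" => EuclideanSpace ℝ (Fin n)

theorem integrable_mul_of_hasCompactSupport {f u : 𝔼 → ℝ} (hf : Continuous f)
    (hfc : HasCompactSupport f) (hu : Integrable u) : Integrable (fun x => f x * u x) := by
  obtain ⟨C, hC⟩ := hf.bounded_above_of_compact_support hfc
  exact hu.bdd_mul (c := C) hf.aestronglyMeasurable (Filter.Eventually.of_forall hC)

theorem partialDeriv_comp_inner (g : ℝ → ℝ) (hg : Differentiable ℝ g) (ξ : 𝔼) (i : Fin n) (x : 𝔼) :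
    partialDeriv i (fun y => g (2 * Real.pi * inner ℝ y ξ)) x =
      2 * Real.pi * ξ i * deriv g (2 * Real.pi * inner ℝ x ξ) := by
  have h1 : HasFDerivAt (fun y : 𝔼 => 2 * Real.pi * inner ℝ y ξ)
      ((2 * Real.pi) • (innerSL ℝ ξ : 𝔼 →L[ℝ] ℝ)) x := by
    have := ((innerSL ℝ ξ : 𝔼 →L[ℝ] ℝ).hasFDerivAt (x := x)).const_mul (2 * Real.pi)
    refine this.congr_of_eventuallyEq (Filter.Eventually.of_forall fun y => ?_)
    simp [real_inner_comm]
  have h2 := ((hg _).hasDerivAt (x := 2 * Real.pi * inner ℝ x ξ)).comp_hasFDerivAt x h1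
  unfold partialDeriv
  have h3 : fderiv ℝ (fun y => g (2 * Real.pi * inner ℝ y ξ)) x = _ := h2.fderiv
  rw [h3]
  simp [EuclideanSpace.inner_single_right]
  ring

/-- One step of the regularity bootstrap: cutoffs of a weak solution of a second order elliptic
equation gain one order of decay of the Fourier transform. -/
theorem fourier_decay_succ {a : Fin n → Fin n → 𝔼 → ℝ} {c : 𝔼 → ℝ}
    (ha : ∀ i j, ContDiff ℝ ∞ (a i j)) (hc : ContDiff ℝ ∞ c)
    (hpos : ∀ x θ : 𝔼, θ ≠ 0 → 0 < ∑ i, ∑ j, a i j x * (θ i * θ j))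
    {Ω : Set 𝔼} (hΩ : IsOpen Ω) {u : 𝔼 → ℝ} (hu : Integrable u)
    (hweak : ∀ ψ : 𝔼 → ℝ, ContDiff ℝ ∞ ψ → HasCompactSupport ψ → tsupport ψ ⊆ Ω →
      ∫ x, u x * divFormOp a c ψ x = 0) (s : ℕ)
    (hs : ∀ χ : 𝔼 → ℝ, ContDiff ℝ ∞ χ → HasCompactSupport χ → tsupport χ ⊆ Ω →
      ∃ C : ℝ, ∀ ξ, (1 + ‖ξ‖) ^ s * ‖𝓕 (fun x => ((χ x * u x : ℝ) : ℂ)) ξ‖ ≤ C)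
    {χ : 𝔼 → ℝ} (hχ : ContDiff ℝ ∞ χ) (hχc : HasCompactSupport χ) (hχΩ : tsupport χ ⊆ Ω) :
    ∃ C : ℝ, ∀ ξ, (1 + ‖ξ‖) ^ (s + 1) * ‖𝓕 (fun x => ((χ x * u x : ℝ) : ℂ)) ξ‖ ≤ C := by
  obtain ⟨p₀, p₁, m, hp₀, hp₁, hm, hp₀0, hp₁0, hm0, hsym⟩ := exists_symbol_coefficients ha hc hpos hχ
  -- A second cutoff, equal to one on the support of `χ`, gives `p u = p χ' u` for each coefficient
  -- `p`. The known decay for `χ' u` then passes to `p(·, θ) u`, uniformly over unit directions.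
  obtain ⟨χ', hχ', hχ'c, hχ'Ω, hχ'1, -⟩ := exists_cutoff hχc hΩ hχΩ
  have hχ'1 : ∀ x ∈ tsupport χ, χ' x = 1 := fun x hx => hχ'1.self_of_nhdsSet x hx
  obtain ⟨C, hC⟩ := hs χ' hχ' hχ'c hχ'Ω
  have hw : Integrable (fun x => ((χ' x * u x : ℝ) : ℂ)) :=
    (integrable_mul_of_hasCompactSupport hχ'.continuous hχ'c hu).ofReal
  have hdec : ∀ p : 𝔼 × 𝔼 → ℝ, ContDiff ℝ ∞ p → (∀ x ∉ tsupport χ, ∀ θ, p (x, θ) = 0) →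
      ∃ C' : ℝ, 0 ≤ C' ∧ ∀ θ ∈ Metric.sphere (0 : 𝔼) 1, ∀ ξ,
        (1 + ‖ξ‖) ^ s * ‖𝓕 (fun x => ((p (x, θ) * u x : ℝ) : ℂ)) ξ‖ ≤ C' := fun p hp hp0 => by
    obtain ⟨C', hC'⟩ := exists_fourier_decay_mul (p := fun q => (p q : ℂ))
      (Complex.ofRealCLM.contDiff.comp hp) hχc (isCompact_sphere (0 : 𝔼) 1)
      (fun x hx θ => by simp [hp0 x hx θ]) s hw hC
    refine ⟨max C' 0, le_max_right _ _, fun θ hθ ξ => le_trans (le_of_eq ?_)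
      ((hC' θ hθ ξ).trans (le_max_left _ _))⟩
    have e : (fun x => ((p (x, θ) * u x : ℝ) : ℂ)) =
        fun x => (p (x, θ) : ℂ) * ((χ' x * u x : ℝ) : ℂ) := by
      ext x
      by_cases hx : x ∈ tsupport χ
      · rw [hχ'1 x hx]; push_cast; ring
      · rw [hp0 x hx θ]; simp
    rw [e]
  obtain ⟨C₀, hC₀0, hC₀⟩ := hdec p₀ hp₀ hp₀0
  obtain ⟨C₁, hC₁0, hC₁⟩ := hdec p₁ hp₁ hp₁0
  have hint : ∀ p : 𝔼 × 𝔼 → ℝ, ContDiff ℝ ∞ p → (∀ x ∉ tsupport χ, ∀ θ, p (x, θ) = 0) →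
      ∀ θ, Integrable (fun x => p (x, θ) * u x) := fun p hp hp0 θ =>
    integrable_mul_of_hasCompactSupport (hp.comp (contDiff_id.prodMk contDiff_const)).continuous
      (HasCompactSupport.intro hχc fun x hx => hp0 x hx θ) hu
  have hχu : Integrable (fun x => χ x * u x) :=
    integrable_mul_of_hasCompactSupport hχ.continuous hχc hu
  -- Testing with `m(·, θ) φ` isolates `κ t² ∫ χ u φ`. What it equals grows at most linearly in `t`
  -- apart from the known decay, and this is the gain of one order.
  have hwave : ∀ (θ : 𝔼) (t κ : ℝ) (φ φ' : 𝔼 → ℝ) (B B' : ℝ), ‖θ‖ = 1 → ContDiff ℝ ∞ φ →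
      ContDiff ℝ ∞ φ' → (∀ x, |φ x| ≤ B) → (∀ x, |φ' x| ≤ B') →
      (∀ i x, partialDeriv i φ x = t * θ i * φ' x) →
      (∀ i x, partialDeriv i φ' x = -κ * (t * θ i) * φ x) →
      κ * t ^ 2 * ∫ x, (χ x * u x) * φ x =
        (∫ x, (p₀ (x, θ) * u x) * φ x) + t * ∫ x, (p₁ (x, θ) * u x) * φ' x := by
    intro θ t κ φ φ' B B' hθ hφ hφ' hB hB' h1 h2
    have hψc : HasCompactSupport (fun y => m (y, θ) * φ y) :=
      HasCompactSupport.intro hχc fun x hx => by rw [hm0 x hx θ, zero_mul]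
    have hψΩ : tsupport (fun y => m (y, θ) * φ y) ⊆ Ω := by
      refine (closure_minimal (fun x hx => ?_) (isClosed_tsupport χ)).trans hχΩ
      by_contra hxn
      exact hx (by simp [hm0 x hxn θ])
    have h0 := hweak _ ((hm.comp (contDiff_id.prodMk contDiff_const)).mul hφ) hψc hψΩ
    have e : ∀ x, u x * divFormOp a c (fun y => m (y, θ) * φ y) x =
        (p₀ (x, θ) * u x) * φ x + t * ((p₁ (x, θ) * u x) * φ' x) -
          κ * t ^ 2 * ((χ x * u x) * φ x) := fun x => by
      rw [hsym θ t κ φ φ' hθ (hφ.differentiable (by simp)) (hφ'.differentiable (by simp)) h1 h2 x]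
      ring
    have hI : ∀ (f : 𝔼 → ℝ) (g : 𝔼 → ℝ) (D : ℝ), Integrable f → ContDiff ℝ ∞ g → (∀ x, |g x| ≤ D) →
        Integrable (fun x => f x * g x) := fun f g D hf hg hD =>
      hf.mul_bdd (c := D) hg.continuous.aestronglyMeasurable (Filter.Eventually.of_forall hD)
    have i0 := hI _ φ B (hint p₀ hp₀ hp₀0 θ) hφ hB
    have i1 := (hI _ φ' B' (hint p₁ hp₁ hp₁0 θ) hφ' hB').const_mul t
    have i2 := (hI _ φ B hχu hφ hB).const_mul (κ * t ^ 2)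
    have h0' : ∫ x, ((p₀ (x, θ) * u x) * φ x + t * ((p₁ (x, θ) * u x) * φ' x) -
          κ * t ^ 2 * ((χ x * u x) * φ x)) = 0 := by
      rw [← h0]
      exact integral_congr_ae (Filter.Eventually.of_forall fun x => (e x).symm)
    have i01 : Integrable fun x => (p₀ (x, θ) * u x) * φ x + t * ((p₁ (x, θ) * u x) * φ' x) :=
      i0.add i1
    rw [integral_sub i01 i2, integral_add i0 i1, integral_const_mul, integral_const_mul] at h0'
    linarith
  obtain ⟨D, hD⟩ : ∃ D : ℝ, ∀ ξ, ‖𝓕 (fun x => ((χ x * u x : ℝ) : ℂ)) ξ‖ ≤ D :=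
    ⟨∫ x, ‖((χ x * u x : ℝ) : ℂ)‖, fun ξ =>
      VectorFourier.norm_fourierIntegral_le_integral_norm _ _ _ _ _⟩
  have hπ := Real.pi_pos
  refine ⟨max (2 ^ (s + 1) * D) (2 * C₀ + 4 * Real.pi * C₁), fun ξ => ?_⟩
  -- Low frequencies have no usable direction `ξ / ‖ξ‖`; the trivial `L¹` bound is enough there.
  rcases le_total ‖ξ‖ 1 with hξ | hξ
  · refine le_trans ?_ (le_max_left _ _)
    have : (1 + ‖ξ‖) ^ (s + 1) ≤ 2 ^ (s + 1) :=
      pow_le_pow_left₀ (by positivity) (by linarith) _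
    exact mul_le_mul this (hD ξ) (norm_nonneg _) (by positivity)
  refine le_trans ?_ (le_max_right _ _)
  set t := ‖ξ‖ with ht
  have ht0 : 0 < t := by linarith
  set θ : 𝔼 := t⁻¹ • ξ with hθdef
  have hθ : ‖θ‖ = 1 := by
    rw [hθdef, norm_smul, norm_inv, Real.norm_of_nonneg ht0.le, ← ht, inv_mul_cancel₀ ht0.ne']
  have hξθ : ∀ i, ξ i = t * θ i := fun i => by
    rw [hθdef]
    simp [ht0.ne']
  have hcd : ∀ g : ℝ → ℝ, ContDiff ℝ ∞ g →
      ContDiff ℝ ∞ (fun x : 𝔼 => g (2 * Real.pi * inner ℝ x ξ)) := fun g hg =>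
    hg.comp (contDiff_const.mul (contDiff_id.inner ℝ contDiff_const))
  set cosξ : 𝔼 → ℝ := fun x => Real.cos (2 * Real.pi * inner ℝ x ξ) with hcos
  set sinξ : 𝔼 → ℝ := fun x => Real.sin (2 * Real.pi * inner ℝ x ξ) with hsin
  have hcosd : ∀ i x, partialDeriv i cosξ x = -(2 * Real.pi) * ξ i * sinξ x := fun i x => by
    rw [hcos, partialDeriv_comp_inner Real.cos Real.differentiable_cos, Real.deriv_cos]
    simp only [hsin]; ring
  have hsind : ∀ i x, partialDeriv i sinξ x = 2 * Real.pi * ξ i * cosξ x := fun i x => by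
    rw [hsin, partialDeriv_comp_inner Real.sin Real.differentiable_sin, Real.deriv_sin]
  have hcm : ∀ (r : ℝ) (f : 𝔼 → ℝ) (i : Fin n) (x : 𝔼), Differentiable ℝ f →
      partialDeriv i (fun y => r * f y) x = r * partialDeriv i f x := fun r f i x hf => by
    unfold partialDeriv
    rw [fderiv_const_mul (hf x)]
    simp
  have hcosC : ContDiff ℝ ∞ cosξ := hcd _ Real.contDiff_cos
  have hsinC : ContDiff ℝ ∞ sinξ := hcd _ Real.contDiff_sin
  have hcosb : ∀ x, |cosξ x| ≤ 1 := fun x => Real.abs_cos_le_one _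
  have hsinb : ∀ x, |sinξ x| ≤ 1 := fun x => Real.abs_sin_le_one _
  have hmb : ∀ (r : ℝ) (f : 𝔼 → ℝ), (∀ x, |f x| ≤ 1) → ∀ x, |r * f x| ≤ |r| := fun r f hf x => by
    rw [abs_mul]
    exact mul_le_of_le_one_right (abs_nonneg r) (hf x)
  -- The factor `2π` of the phase is placed in `φ'`, so that `t • θ = ξ` and `κ = 4π²`.
  have hW1 := hwave θ t (4 * Real.pi ^ 2) cosξ (fun x => -(2 * Real.pi) * sinξ x) 1 _ hθ hcosC
    (contDiff_const.mul hsinC) hcosb (hmb _ _ hsinb)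
    (fun i x => by rw [hcosd, hξθ]; ring)
    (fun i x => by rw [hcm _ _ _ _ (hsinC.differentiable (by simp)), hsind, hξθ]; ring)
  have hW2 := hwave θ t (4 * Real.pi ^ 2) sinξ (fun x => (2 * Real.pi) * cosξ x) 1 _ hθ hsinC
    (contDiff_const.mul hcosC) hsinb (hmb _ _ hcosb)
    (fun i x => by rw [hsind, hξθ]; ring)
    (fun i x => by rw [hcm _ _ _ _ (hcosC.differentiable (by simp)), hcosd, hξθ]; ring)
  have hpull : ∀ (r : ℝ) (f g : 𝔼 → ℝ), ∫ x, f x * (r * g x) = r * ∫ x, f x * g x := fun r f g => by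
    rw [← integral_const_mul]
    exact integral_congr_ae (Filter.Eventually.of_forall fun x => by ring)
  rw [hpull] at hW1 hW2
  set F := ‖𝓕 (fun x => ((χ x * u x : ℝ) : ℂ)) ξ‖ with hF
  set F₀ := ‖𝓕 (fun x => ((p₀ (x, θ) * u x : ℝ) : ℂ)) ξ‖ with hF₀
  set F₁ := ‖𝓕 (fun x => ((p₁ (x, θ) * u x : ℝ) : ℂ)) ξ‖ with hF₁
  have k1 : 4 * Real.pi ^ 2 * t ^ 2 * |∫ x, (χ x * u x) * cosξ x| ≤
      F₀ + t * (2 * Real.pi * F₁) := by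
    have h1 := abs_integral_cos_le (hint p₀ hp₀ hp₀0 θ) ξ
    have h2 := abs_integral_sin_le (hint p₁ hp₁ hp₁0 θ) ξ
    calc _ = |4 * Real.pi ^ 2 * t ^ 2 * ∫ x, (χ x * u x) * cosξ x| := by
          rw [abs_mul, abs_of_nonneg (by positivity : 0 ≤ 4 * Real.pi ^ 2 * t ^ 2)]
      _ ≤ _ := by
          rw [hW1]
          refine (abs_add_le _ _).trans (add_le_add h1 ?_)
          rw [abs_mul, abs_mul, abs_neg, abs_of_pos ht0, abs_of_pos (by positivity : 0 < 2 * Real.pi)]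
          gcongr
  have k2 : 4 * Real.pi ^ 2 * t ^ 2 * |∫ x, (χ x * u x) * sinξ x| ≤
      F₀ + t * (2 * Real.pi * F₁) := by
    have h1 := abs_integral_sin_le (hint p₀ hp₀ hp₀0 θ) ξ
    have h2 := abs_integral_cos_le (hint p₁ hp₁ hp₁0 θ) ξ
    calc _ = |4 * Real.pi ^ 2 * t ^ 2 * ∫ x, (χ x * u x) * sinξ x| := by
          rw [abs_mul, abs_of_nonneg (by positivity : 0 ≤ 4 * Real.pi ^ 2 * t ^ 2)]
      _ ≤ _ := by
          rw [hW2]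
          refine (abs_add_le _ _).trans (add_le_add h1 ?_)
          rw [abs_mul, abs_mul, abs_of_pos ht0, abs_of_pos (by positivity : 0 < 2 * Real.pi)]
          gcongr
  have k3 : F ≤ |∫ x, (χ x * u x) * cosξ x| + |∫ x, (χ x * u x) * sinξ x| :=
    norm_fourier_ofReal_le hχu ξ
  have hθs : θ ∈ Metric.sphere (0 : 𝔼) 1 := by simpa using hθ
  have k4 := hC₀ θ hθs ξ
  have k5 := hC₁ θ hθs ξ
  rw [← ht] at k4 k5
  have hF0 : 0 ≤ F := norm_nonneg _
  have k6 : 4 * Real.pi ^ 2 * t ^ 2 * F ≤ 2 * F₀ + 4 * Real.pi * t * F₁ := by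
    have := mul_le_mul_of_nonneg_left k3 (by positivity : 0 ≤ 4 * Real.pi ^ 2 * t ^ 2)
    linarith
  have k7 : 2 * t ^ 2 * F ≤ 4 * Real.pi ^ 2 * t ^ 2 * F := by
    have : 2 ≤ 4 * Real.pi ^ 2 := by nlinarith [Real.pi_gt_three]
    gcongr
  -- One of the two powers of `t` gained becomes the extra weight, through `1 + t ≤ 2 t`; the other
  -- cancels the factor `t` in front of `F₁`.
  have k8 : t * ((1 + t) ^ (s + 1) * F) ≤ t * (2 * C₀ + 4 * Real.pi * C₁) := by
    calc t * ((1 + t) ^ (s + 1) * F) = (1 + t) * (t * (1 + t) ^ s * F) := by ring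
      _ ≤ (2 * t) * (t * (1 + t) ^ s * F) := by gcongr; linarith
      _ = (1 + t) ^ s * (2 * t ^ 2 * F) := by ring
      _ ≤ (1 + t) ^ s * (2 * F₀ + 4 * Real.pi * t * F₁) := by gcongr; exact k7.trans k6
      _ = 2 * ((1 + t) ^ s * F₀) + 4 * Real.pi * t * ((1 + t) ^ s * F₁) := by ring
      _ ≤ 2 * C₀ + 4 * Real.pi * t * C₁ := by gcongr
      _ ≤ t * (2 * C₀) + 4 * Real.pi * t * C₁ := by
          refine add_le_add_left ?_ _; exact le_mul_of_one_le_left (mul_nonneg zero_le_two hC₀0) hξ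
      _ = t * (2 * C₀ + 4 * Real.pi * C₁) := by ring
  exact le_of_mul_le_mul_left k8 ht0

/-- Interior regularity: a weak solution of a second order elliptic equation with smooth
coefficients is almost everywhere equal to a smooth function. -/
theorem exists_contDiff_of_weak_solution {a : Fin n → Fin n → 𝔼 → ℝ} {c : 𝔼 → ℝ}
    (ha : ∀ i j, ContDiff ℝ ∞ (a i j)) (hc : ContDiff ℝ ∞ c)
    (hpos : ∀ x θ : 𝔼, θ ≠ 0 → 0 < ∑ i, ∑ j, a i j x * (θ i * θ j))
    {Ω : Set 𝔼} (hΩ : IsOpen Ω) {u : 𝔼 → ℝ} (hu : Integrable u)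
    (hweak : ∀ ψ : 𝔼 → ℝ, ContDiff ℝ ∞ ψ → HasCompactSupport ψ → tsupport ψ ⊆ Ω →
      ∫ x, u x * divFormOp a c ψ x = 0)
    {χ : 𝔼 → ℝ} (hχ : ContDiff ℝ ∞ χ) (hχc : HasCompactSupport χ) (hχΩ : tsupport χ ⊆ Ω) :
    ∃ U : 𝔼 → ℝ, ContDiff ℝ ∞ U ∧ (fun x => χ x * u x) =ᵐ[volume] U := by
  -- The induction ranges over all cutoffs at once, because the step for one cutoff uses a wider
  -- one.
  have hdec : ∀ s : ℕ, ∀ χ : 𝔼 → ℝ, ContDiff ℝ ∞ χ → HasCompactSupport χ → tsupport χ ⊆ Ω →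
      ∃ C : ℝ, ∀ ξ, (1 + ‖ξ‖) ^ s * ‖𝓕 (fun x => ((χ x * u x : ℝ) : ℂ)) ξ‖ ≤ C := by
    intro s
    induction s with
    | zero =>
      intro χ hχ hχc hχΩ
      refine ⟨∫ x, ‖((χ x * u x : ℝ) : ℂ)‖, fun ξ => ?_⟩
      rw [pow_zero, one_mul]
      exact VectorFourier.norm_fourierIntegral_le_integral_norm _ _ _ _ _
    | succ s ih =>
      intro χ hχ hχc hχΩ
      exact fourier_decay_succ ha hc hpos hΩ hu hweak s ih hχ hχc hχΩ
  obtain ⟨U, hU, hUe⟩ := exists_contDiff_of_fourier_decay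
    (integrable_mul_of_hasCompactSupport hχ.continuous hχc hu).ofReal
    fun s => hdec s χ hχ hχc hχΩ
  refine ⟨fun x => (U x).re, Complex.reCLM.contDiff.comp hU, ?_⟩
  filter_upwards [hUe] with x hx
  rw [← hx]
  simp

end Regularity

end EigenmapRegistration

/-! ### A quantitative Rellich theorem in Euclidean space -/

namespace EigenmapRegistration

section Compactness

open scoped FourierTransform LineDeriv

variable {n : ℕ}

local notation "𝔼" => EuclideanSpace ℝ (Fin n)

theorem integral_norm_sq_fourier_ofReal {F : 𝔼 → ℝ} (hF : ContDiff ℝ ∞ F)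
    (hFc : HasCompactSupport F) :
    Integrable (fun ξ => ‖𝓕 (fun x => (F x : ℂ)) ξ‖ ^ 2) ∧
      ∫ ξ, ‖𝓕 (fun x => (F x : ℂ)) ξ‖ ^ 2 = ∫ x, F x ^ 2 := by
  have hf : ContDiff ℝ ∞ (fun x => (F x : ℂ)) := Complex.ofRealCLM.contDiff.comp hF
  have hfc : HasCompactSupport (fun x => (F x : ℂ)) :=
    hFc.comp_left (g := fun r : ℝ => (r : ℂ)) rfl
  let f := hfc.toSchwartzMap hf
  have h1 : ∀ ξ, 𝓕 f ξ = 𝓕 (fun x => (F x : ℂ)) ξ := fun ξ => by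
    rw [SchwartzMap.fourier_coe]; rfl
  have h2 := SchwartzMap.integral_norm_sq_fourier f
  have h3 : ∀ x, ‖f x‖ ^ 2 = F x ^ 2 := fun x => by
    change ‖(F x : ℂ)‖ ^ 2 = _
    rw [Complex.norm_real, Real.norm_eq_abs, sq_abs]
  simp_rw [h1, h3] at h2
  refine ⟨?_, h2⟩
  have h4 := ((𝓕 f).memLp 2 (volume : Measure 𝔼)).integrable_norm_pow (by simp)
  simpa [h1] using h4

theorem fourier_partialDeriv {F : 𝔼 → ℝ} (hF : ContDiff ℝ ∞ F) (hFc : HasCompactSupport F)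
    (i : Fin n) (ξ : 𝔼) :
    ‖𝓕 (fun x => (partialDeriv i F x : ℂ)) ξ‖ ^ 2 =
      4 * Real.pi ^ 2 * ξ i ^ 2 * ‖𝓕 (fun x => (F x : ℂ)) ξ‖ ^ 2 := by
  have hf : ContDiff ℝ ∞ (fun x => (F x : ℂ)) := Complex.ofRealCLM.contDiff.comp hF
  have hfc : HasCompactSupport (fun x => (F x : ℂ)) :=
    hFc.comp_left (g := fun r : ℝ => (r : ℂ)) rfl
  have hfd : ∀ x, fderiv ℝ (fun x => (F x : ℂ)) x = Complex.ofRealCLM.comp (fderiv ℝ F x) :=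
    fun x => (Complex.ofRealCLM.hasFDerivAt.comp x
      (hF.differentiable (by simp) x).hasFDerivAt).fderiv
  have hi : Integrable (fderiv ℝ (fun x => (F x : ℂ))) :=
    (hf.continuous_fderiv (by simp)).integrable_of_hasCompactSupport (hfc.fderiv ℝ)
  have h1 := congrFun (Real.fourier_fderiv (hf.continuous.integrable_of_hasCompactSupport hfc)
    (hf.differentiable (by simp)) hi) ξ
  have h2 := Real.fourier_continuousLinearMap_apply (F := 𝔼) hi (a := EuclideanSpace.single i (1 : ℝ))
    (v := ξ)
  have h3 : (fun x => (fderiv ℝ (fun x => (F x : ℂ)) x) (EuclideanSpace.single i (1 : ℝ))) =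
      fun x => (partialDeriv i F x : ℂ) := by
    ext x
    rw [hfd]
    rfl
  rw [h3, h1] at h2
  rw [← h2]
  simp [VectorFourier.fourierSMulRight_apply, innerSL_apply_apply ℝ, EuclideanSpace.inner_single_right,
    mul_pow]
  ring

/-- Cauchy-Schwarz against the indicator of `K`, read off from the discriminant of `r ↦ ∫ (|F| - r
1_K)²`. -/
theorem sq_integral_abs_le {K : Set 𝔼} (hK : IsCompact K) {F : 𝔼 → ℝ} (hF : Continuous F)
    (hFK : ∀ x ∉ K, F x = 0) : (∫ x, |F x|) ^ 2 ≤ volume.real K * ∫ x, F x ^ 2 := by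
  have hFc : HasCompactSupport F := HasCompactSupport.intro hK hFK
  have hF2 : Integrable (fun x => F x ^ 2) :=
    (hF.pow 2).integrable_of_hasCompactSupport (HasCompactSupport.intro hK fun x hx => by
      simp [hFK x hx])
  have hF1 : Integrable (fun x => |F x|) := (hF.integrable_of_hasCompactSupport hFc).abs
  have hI : Integrable (K.indicator fun _ : 𝔼 => (1 : ℝ)) :=
    (integrable_indicator_iff hK.measurableSet).2 (integrableOn_const hK.measure_lt_top.ne)
  have hIv : ∫ x, K.indicator (fun _ : 𝔼 => (1 : ℝ)) x = volume.real K := by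
    rw [integral_indicator hK.measurableSet]; simp
  set A := ∫ x, |F x| with hA
  set v := volume.real K with hv
  have hv0 : 0 ≤ v := measureReal_nonneg
  have key : ∀ r : ℝ, 0 ≤ (∫ x, F x ^ 2) - 2 * r * A + r ^ 2 * v := fun r => by
    have h1 : 0 ≤ ∫ x, (F x ^ 2 - 2 * r * |F x| + r ^ 2 * K.indicator (fun _ : 𝔼 => (1 : ℝ)) x) := by
      refine integral_nonneg fun x => ?_
      by_cases hx : x ∈ K
      · simp only [Set.indicator_of_mem hx, Pi.zero_apply]
        nlinarith [sq_nonneg (|F x| - r), sq_abs (F x)]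
      · simp [Set.indicator_of_notMem hx, hFK x hx]
    have h2 : Integrable (fun x => F x ^ 2 - 2 * r * |F x|) := hF2.sub (hF1.const_mul _)
    rwa [integral_add h2 (hI.const_mul _), integral_sub hF2 (hF1.const_mul _), integral_const_mul, integral_const_mul, hIv] at h1
  have hd := discrim_le_zero (a := v) (b := -2 * A) (c := ∫ x, F x ^ 2) fun r => by
    have := key r
    linarith
  unfold discrim at hd
  linarith

/-- The phases `x · ξ` are Lipschitz in `ξ` with constant at most `r` on `K`. This allows a finite
net of frequencies to control the transform on a ball. -/
theorem norm_fourier_sub_le {K : Set 𝔼} {r : ℝ} (hr : ∀ x ∈ K, ‖x‖ ≤ r)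
    {F : 𝔼 → ℝ} (hF : Integrable F) (hFK : ∀ x ∉ K, F x = 0) (ξ η : 𝔼) :
    ‖𝓕 (fun x => (F x : ℂ)) ξ - 𝓕 (fun x => (F x : ℂ)) η‖ ≤
      2 * Real.pi * r * ‖ξ - η‖ * ∫ x, |F x| := by
  have hI : ∀ ζ : 𝔼, Integrable fun x => Complex.exp (↑(-2 * Real.pi * inner ℝ x ζ) * Complex.I) •
      (F x : ℂ) := fun ζ => by
    refine Integrable.bdd_mul (c := 1) hF.ofReal (by fun_prop) ?_
    exact Filter.Eventually.of_forall fun x => (Complex.norm_exp_ofReal_mul_I _).le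
  rw [Real.fourier_eq', Real.fourier_eq', ← integral_sub (hI ξ) (hI η), ← integral_const_mul]
  refine norm_integral_le_of_norm_le (hF.abs.const_mul _) (Filter.Eventually.of_forall fun x => ?_)
  by_cases hx : x ∈ K
  · rw [← sub_smul, norm_smul, Complex.norm_real, Real.norm_eq_abs]
    gcongr
    have h1 : ‖Complex.exp (↑(-2 * Real.pi * inner ℝ x ξ) * Complex.I) -
        Complex.exp (↑(-2 * Real.pi * inner ℝ x η) * Complex.I)‖ ≤
        |(-2 * Real.pi * inner ℝ x ξ) - (-2 * Real.pi * inner ℝ x η)| := by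
      have h2 := Real.norm_exp_I_mul_ofReal_sub_one_le
        (x := (-2 * Real.pi * inner ℝ x ξ) - (-2 * Real.pi * inner ℝ x η))
      have h3 : Complex.exp (↑(-2 * Real.pi * inner ℝ x ξ) * Complex.I) =
          Complex.exp (↑(-2 * Real.pi * inner ℝ x η) * Complex.I) * Complex.exp (Complex.I *
            ↑((-2 * Real.pi * inner ℝ x ξ) - (-2 * Real.pi * inner ℝ x η))) := by
        rw [← Complex.exp_add]
        congr 1
        push_cast
        ring
      rw [h3, ← mul_sub_one, norm_mul, Complex.norm_exp_ofReal_mul_I, one_mul]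
      exact h2
    refine h1.trans ?_
    have h4 : (-2 * Real.pi * inner ℝ x ξ) - (-2 * Real.pi * inner ℝ x η) =
        -(2 * Real.pi) * inner ℝ x (ξ - η) := by rw [inner_sub_right]; ring
    rw [h4, abs_mul, abs_neg, abs_of_pos Real.two_pi_pos, mul_assoc, mul_assoc (2 * Real.pi)]
    have h5 : |inner ℝ x (ξ - η)| ≤ r * ‖ξ - η‖ :=
      (abs_real_inner_le_norm _ _).trans (by gcongr; exact hr x hx)
    nlinarith [mul_le_mul_of_nonneg_left h5 Real.pi_pos.le]
  · simp [hFK x hx]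

/-- The quantitative Rellich theorem: on functions supported in a fixed compact set the `L²` norm is
controlled by finitely many Fourier coefficients, up to a small multiple of the `H¹` norm. -/
theorem exists_frequencies_integral_sq_le {K : Set 𝔼} (hK : IsCompact K) {ε : ℝ} (hε : 0 < ε) :
    ∃ (S : Finset 𝔼) (C : ℝ), 0 ≤ C ∧ ∀ F : 𝔼 → ℝ, ContDiff ℝ ∞ F → (∀ x ∉ K, F x = 0) →
      ∫ x, F x ^ 2 ≤ C * ∑ ξ ∈ S, ((∫ x, F x * Real.cos (2 * Real.pi * inner ℝ x ξ)) ^ 2 +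
        (∫ x, F x * Real.sin (2 * Real.pi * inner ℝ x ξ)) ^ 2) +
        ε * ((∫ x, F x ^ 2) + ∑ i, ∫ x, partialDeriv i F x ^ 2) := by
  obtain ⟨r, hr⟩ := hK.isBounded.exists_norm_le
  have hr' : ∀ x ∈ K, ‖x‖ ≤ max r 0 := fun x hx => (hr x hx).trans (le_max_left _ _)
  set r' := max r 0 with hr'def
  have hr'0 : 0 ≤ r' := le_max_right _ _
  -- Beyond radius `R` the factor `ε 4π² ‖ξ‖²` exceeds one, so high frequencies are absorbed by the
  -- derivative term.
  obtain ⟨R, hR0, hR⟩ : ∃ R : ℝ, 0 < R ∧ 1 ≤ ε * R ^ 2 := by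
    refine ⟨1 + ε⁻¹, by positivity, ?_⟩
    have : ε * (1 + ε⁻¹) ^ 2 = ε + 2 + ε⁻¹ := by field_simp; ring
    rw [this]
    have := inv_pos.2 hε
    linarith
  set B := Metric.closedBall (0 : 𝔼) R with hB
  have hBc : IsCompact B := isCompact_closedBall _ _
  set b := volume.real B with hb
  set v := volume.real K with hv
  have hb0 : 0 ≤ b := measureReal_nonneg
  have hv0 : 0 ≤ v := measureReal_nonneg
  -- The spacing `δ` of the net is such that the Lipschitz error, squared and integrated over the
  -- ball, is at most `ε ∫ F²`.
  obtain ⟨δ, hδ0, hδ⟩ : ∃ δ : ℝ, 0 < δ ∧ b * (2 * (2 * Real.pi * r' * δ) ^ 2 * v) ≤ ε := by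
    have hcont : Filter.Tendsto (fun δ : ℝ => b * (2 * (2 * Real.pi * r' * δ) ^ 2 * v))
        (𝓝 0) (𝓝 (b * (2 * (2 * Real.pi * r' * 0) ^ 2 * v))) :=
      Continuous.tendsto (by fun_prop) 0
    have h0 : b * (2 * (2 * Real.pi * r' * 0) ^ 2 * v) = 0 := by ring
    rw [h0] at hcont
    have := (hcont.eventually (ge_mem_nhds hε)).filter_mono
      (nhdsWithin_le_nhds (s := Set.Ioi (0 : ℝ)))
    obtain ⟨δ, h1, h2⟩ := (this.and self_mem_nhdsWithin).exists
    exact ⟨δ, h2, h1⟩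
  obtain ⟨t, htB, htf, ht⟩ := hBc.finite_cover_balls hδ0
  refine ⟨htf.toFinset, 2 * b, by positivity, fun F hF hFK => ?_⟩
  have hFc : HasCompactSupport F := HasCompactSupport.intro hK hFK
  have hFi : Integrable F := hF.continuous.integrable_of_hasCompactSupport hFc
  obtain ⟨hint, hpl⟩ := integral_norm_sq_fourier_ofReal hF hFc
  have hpd : ∀ i, Integrable (fun ξ : 𝔼 => 4 * Real.pi ^ 2 * ξ i ^ 2 *
      ‖𝓕 (fun x => (F x : ℂ)) ξ‖ ^ 2) ∧ ∫ ξ : 𝔼, 4 * Real.pi ^ 2 * ξ i ^ 2 *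
      ‖𝓕 (fun x => (F x : ℂ)) ξ‖ ^ 2 = ∫ x, partialDeriv i F x ^ 2 := fun i => by
    have := integral_norm_sq_fourier_ofReal (contDiff_partialDeriv i hF)
      (hFc.of_isClosed_subset (isClosed_tsupport _) (tsupport_partialDeriv_subset F i))
    simp_rw [fourier_partialDeriv hF hFc i] at this
    exact this
  have hcs : ∀ ξ, ‖𝓕 (fun x => (F x : ℂ)) ξ‖ ^ 2 =
      (∫ x, F x * Real.cos (2 * Real.pi * inner ℝ x ξ)) ^ 2 +
        (∫ x, F x * Real.sin (2 * Real.pi * inner ℝ x ξ)) ^ 2 := fun ξ => by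
    rw [fourier_ofReal_eq hFi, Complex.sq_norm, Complex.normSq_apply]
    simp [sq]
  simp_rw [← hcs]
  set G : 𝔼 → ℝ := fun ξ => ‖𝓕 (fun x => (F x : ℂ)) ξ‖ ^ 2 with hG
  set I := ∫ x, F x ^ 2 with hI
  have hI0 : 0 ≤ I := integral_nonneg fun x => sq_nonneg _
  have hsq := sq_integral_abs_le hK hF.continuous hFK
  have hGB : ∀ ξ ∈ B, G ξ ≤ 2 * ∑ η ∈ htf.toFinset, G η + 2 * (2 * Real.pi * r' * δ) ^ 2 * v * I := by
    intro ξ hξ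
    obtain ⟨η, hηt, hη⟩ : ∃ η ∈ t, ξ ∈ Metric.ball η δ := by simpa using ht hξ
    have h1 := norm_fourier_sub_le hr' hFi hFK ξ η
    have h2 : ‖ξ - η‖ ≤ δ := by rw [← dist_eq_norm]; exact (Metric.mem_ball.1 hη).le
    have h3 : ‖𝓕 (fun x => (F x : ℂ)) ξ - 𝓕 (fun x => (F x : ℂ)) η‖ ≤
        2 * Real.pi * r' * δ * ∫ x, |F x| := by
      refine h1.trans ?_
      gcongr
    have h4 : ‖𝓕 (fun x => (F x : ℂ)) ξ‖ ≤ ‖𝓕 (fun x => (F x : ℂ)) η‖ +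
        2 * Real.pi * r' * δ * ∫ x, |F x| := by
      have := norm_le_norm_add_norm_sub' (𝓕 (fun x => (F x : ℂ)) ξ) (𝓕 (fun x => (F x : ℂ)) η)
      linarith
    have h5 : G η ≤ ∑ η ∈ htf.toFinset, G η :=
      Finset.single_le_sum (f := G) (fun _ _ => sq_nonneg _) (by simpa using hηt)
    have hJ0 : 0 ≤ ∫ x, |F x| := integral_nonneg fun x => abs_nonneg _
    calc G ξ ≤ (‖𝓕 (fun x => (F x : ℂ)) η‖ + 2 * Real.pi * r' * δ * ∫ x, |F x|) ^ 2 :=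
          pow_le_pow_left₀ (norm_nonneg _) h4 2
      _ ≤ 2 * G η + 2 * (2 * Real.pi * r' * δ * ∫ x, |F x|) ^ 2 := by
          have := add_sq_le (a := ‖𝓕 (fun x => (F x : ℂ)) η‖) (b := 2 * Real.pi * r' * δ * ∫ x, |F x|)
          simp only [hG]
          linarith
      _ = 2 * G η + 2 * (2 * Real.pi * r' * δ) ^ 2 * (∫ x, |F x|) ^ 2 := by ring
      _ ≤ 2 * ∑ η ∈ htf.toFinset, G η + 2 * (2 * Real.pi * r' * δ) ^ 2 * (v * I) := by gcongr
      _ = _ := by ring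
  set M := 2 * ∑ η ∈ htf.toFinset, G η + 2 * (2 * Real.pi * r' * δ) ^ 2 * v * I with hM
  -- This pointwise bound separates low and high frequencies; its integral, with Plancherel for `F`
  -- and its partial derivatives, is the claim.
  have hpt : ∀ ξ, G ξ ≤ B.indicator (fun _ => M) ξ +
      ε * ∑ i, 4 * Real.pi ^ 2 * ξ i ^ 2 * G ξ := fun ξ => by
    have hsum : ∑ i, 4 * Real.pi ^ 2 * ξ i ^ 2 * G ξ = 4 * Real.pi ^ 2 * ‖ξ‖ ^ 2 * G ξ := by
      rw [EuclideanSpace.real_norm_sq_eq, Finset.mul_sum, Finset.sum_mul]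
    rw [hsum]
    have hG0 : 0 ≤ G ξ := sq_nonneg _
    by_cases hξ : ξ ∈ B
    · rw [Set.indicator_of_mem hξ]
      have : 0 ≤ ε * (4 * Real.pi ^ 2 * ‖ξ‖ ^ 2 * G ξ) := by positivity
      linarith [hGB ξ hξ]
    · rw [Set.indicator_of_notMem hξ, zero_add]
      have hξR : R ≤ ‖ξ‖ := by
        rw [hB, mem_closedBall_zero_iff, not_le] at hξ
        exact hξ.le
      have h1 : 1 ≤ ε * (4 * Real.pi ^ 2 * ‖ξ‖ ^ 2) := by
        calc 1 ≤ ε * R ^ 2 := hR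
          _ ≤ ε * (4 * Real.pi ^ 2 * ‖ξ‖ ^ 2) := by
            gcongr
            have : R ^ 2 ≤ ‖ξ‖ ^ 2 := pow_le_pow_left₀ hR0.le hξR 2
            have h36 : 1 ≤ 4 * Real.pi ^ 2 := by nlinarith [Real.pi_gt_three]
            exact this.trans (le_mul_of_one_le_left (sq_nonneg _) h36)
      calc G ξ = 1 * G ξ := (one_mul _).symm
        _ ≤ ε * (4 * Real.pi ^ 2 * ‖ξ‖ ^ 2) * G ξ := by gcongr
        _ = _ := by ring
  have hInd : Integrable (B.indicator fun _ : 𝔼 => M) :=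
    (integrable_indicator_iff hBc.measurableSet).2 (integrableOn_const hBc.measure_lt_top.ne)
  have hsumI : Integrable fun ξ : 𝔼 => ε * ∑ i, 4 * Real.pi ^ 2 * ξ i ^ 2 * G ξ :=
    (integrable_finsetSum _ fun i _ => (hpd i).1).const_mul ε
  have hfin := integral_mono hint (hInd.add hsumI) hpt
  have hIv : ∫ ξ, B.indicator (fun _ : 𝔼 => M) ξ = b * M := by
    rw [integral_indicator hBc.measurableSet]; simp [hb]
  rw [hpl, integral_add' hInd hsumI, hIv, integral_const_mul,
    integral_finsetSum _ fun i _ => (hpd i).1] at hfin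
  simp_rw [fun i => (hpd i).2] at hfin
  have h6 : b * (2 * (2 * Real.pi * r' * δ) ^ 2 * v) * I ≤ ε * I := by gcongr
  rw [hM] at hfin
  linarith

end Compactness

end EigenmapRegistration

/-! ### The metric, its determinant and its inverse in charts -/

namespace EigenmapRegistration

section ChartGeometry

variable {n : ℕ} {M : Type*} [TopologicalSpace M] [ChartedSpace (EuclideanSpace ℝ (Fin n)) M]

local notation "𝔼" => EuclideanSpace ℝ (Fin n)

/-- The differential of the parametrization `e.symm`, with values in the model space. -/
noncomputable def frame (e : OpenPartialHomeomorph M 𝔼) (u : 𝔼) : 𝔼 →L[ℝ] 𝔼 :=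
  (mfderiv (𝓡 n) (𝓡 n) e.symm u : 𝔼 →L[ℝ] 𝔼)

variable [IsManifold (𝓡 n) ∞ M]

/-- The metric at a point as a bilinear form on the model space. -/
noncomputable def metricForm (g : SmoothMetric n M) (x : M) : 𝔼 →L[ℝ] 𝔼 →L[ℝ] ℝ :=
  (g.inner x : 𝔼 →L[ℝ] 𝔼 →L[ℝ] ℝ)

theorem gram_apply (g : SmoothMetric n M) (e : OpenPartialHomeomorph M 𝔼) (u : 𝔼) (i j : Fin n) :
    gram g e u i j = metricForm g (e.symm u) (frame e u (EuclideanSpace.single i 1))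
      (frame e u (EuclideanSpace.single j 1)) := rfl

theorem metricForm_symm (g : SmoothMetric n M) (x : M) (v w : 𝔼) :
    metricForm g x v w = metricForm g x w v := g.symm x v w

theorem metricForm_pos (g : SmoothMetric n M) (x : M) {v : 𝔼} (hv : v ≠ 0) :
    0 < metricForm g x v v := g.pos x v hv

omit [IsManifold (𝓡 n) ∞ M] in
theorem mdifferentiableAt_chart_symm {e : OpenPartialHomeomorph M 𝔼}
    (he : e ∈ IsManifold.maximalAtlas (𝓡 n) ∞ M) {u : 𝔼} (hu : u ∈ e.target) :
    MDifferentiableAt (𝓡 n) (𝓡 n) e.symm u :=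
  (contMDiffAt_symm_of_mem_maximalAtlas he hu).mdifferentiableAt (by simp)

omit [IsManifold (𝓡 n) ∞ M] in
theorem mdifferentiableAt_chart {e : OpenPartialHomeomorph M 𝔼}
    (he : e ∈ IsManifold.maximalAtlas (𝓡 n) ∞ M) {x : M} (hx : x ∈ e.source) :
    MDifferentiableAt (𝓡 n) (𝓡 n) e x :=
  (contMDiffAt_of_mem_maximalAtlas he hx).mdifferentiableAt (by simp)

/-- The field is the tangent map of `e.symm` applied to the constant section `v` of the tangent
bundle of the model space. -/
theorem contMDiffOn_frame {e : OpenPartialHomeomorph M 𝔼}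
    (he : e ∈ IsManifold.maximalAtlas (𝓡 n) ∞ M) (v : 𝔼) :
    ContMDiffOn (𝓡 n) (𝓡 n).tangent ∞
      (fun u => (⟨e.symm u, mfderiv (𝓡 n) (𝓡 n) e.symm u v⟩ : TangentBundle (𝓡 n) M)) e.target := by
  have h1 := (contMDiffOn_symm_of_mem_maximalAtlas he).contMDiffOn_tangentMapWithin
    (m := ∞) (by simp) e.open_target.uniqueMDiffOn
  have h2 : ContMDiff (𝓡 n) (𝓡 n).tangent ∞ (fun u : 𝔼 => (⟨u, v⟩ : TangentBundle (𝓡 n) 𝔼)) := by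
    exact (contMDiff_vectorSpace_iff_contDiff (V := fun _ : 𝔼 => v)).2 contDiff_const
  have h3 := h1.comp (t := (Bundle.TotalSpace.proj ⁻¹' e.target)) h2.contMDiffOn (s := e.target)
    (fun u hu => hu)
  refine h3.congr fun u hu => ?_
  simp only [Function.comp_apply, tangentMapWithin]
  rw [mfderivWithin_of_isOpen e.open_target hu]

theorem contDiffOn_metricForm_frame (g : SmoothMetric n M) {e : OpenPartialHomeomorph M 𝔼}
    (he : e ∈ IsManifold.maximalAtlas (𝓡 n) ∞ M) (v w : 𝔼) :
    ContDiffOn ℝ ∞ (fun u => metricForm g (e.symm u) (frame e u v) (frame e u w)) e.target := by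
  rw [← contMDiffOn_iff_contDiffOn]
  intro u hu
  have hg : ContMDiffWithinAt (𝓡 n) ((𝓡 n).prod 𝓘(ℝ, 𝔼 →L[ℝ] 𝔼 →L[ℝ] ℝ)) ∞
      (fun u => Bundle.TotalSpace.mk' (𝔼 →L[ℝ] 𝔼 →L[ℝ] ℝ)
        (E := fun x : M => TangentSpace (𝓡 n) x →L[ℝ] TangentSpace (𝓡 n) x →L[ℝ] ℝ)
        (e.symm u) (g.inner (e.symm u))) e.target u :=
    ContMDiffAt.comp_contMDiffWithinAt u g.contMDiff.contMDiffAt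
      (contMDiffOn_symm_of_mem_maximalAtlas he u hu)
  have h : ContMDiffWithinAt (𝓡 n) ((𝓡 n).prod 𝓘(ℝ, ℝ)) ∞
      (fun u => Bundle.TotalSpace.mk' ℝ (E := Bundle.Trivial M ℝ) (e.symm u)
        (g.inner (e.symm u) (mfderiv (𝓡 n) (𝓡 n) e.symm u v) (mfderiv (𝓡 n) (𝓡 n) e.symm u w)))
      e.target u := by
    apply ContMDiffWithinAt.clm_bundle_apply₂ (F₁ := 𝔼) (F₂ := 𝔼)
    · exact hg
    · exact contMDiffOn_frame he v u hu
    · exact contMDiffOn_frame he w u hu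
  simp only [Bundle.contMDiffWithinAt_totalSpace] at h
  exact h.2

theorem contDiffOn_gram (g : SmoothMetric n M) {e : OpenPartialHomeomorph M 𝔼}
    (he : e ∈ IsManifold.maximalAtlas (𝓡 n) ∞ M) (i j : Fin n) :
    ContDiffOn ℝ ∞ (fun u => gram g e u i j) e.target :=
  contDiffOn_metricForm_frame g he _ _

omit [IsManifold (𝓡 n) ∞ M] in
theorem contDiffAt_transition {e e' : OpenPartialHomeomorph M 𝔼}
    (he : e ∈ IsManifold.maximalAtlas (𝓡 n) ∞ M) (he' : e' ∈ IsManifold.maximalAtlas (𝓡 n) ∞ M)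
    {u : 𝔼} (hu : u ∈ e.target) (hu' : e.symm u ∈ e'.source) :
    ContDiffAt ℝ ∞ (fun w => e' (e.symm w)) u := by
  rw [← contMDiffAt_iff_contDiffAt]
  exact (contMDiffAt_of_mem_maximalAtlas he' hu').comp u
    (contMDiffAt_symm_of_mem_maximalAtlas he hu)

omit [IsManifold (𝓡 n) ∞ M] in
theorem frame_transition {e e' : OpenPartialHomeomorph M 𝔼}
    (he : e ∈ IsManifold.maximalAtlas (𝓡 n) ∞ M) (he' : e' ∈ IsManifold.maximalAtlas (𝓡 n) ∞ M)
    {u : 𝔼} (hu : u ∈ e.target) (hu' : e.symm u ∈ e'.source) (v : 𝔼) :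
    frame e u v = frame e' (e' (e.symm u)) (fderiv ℝ (fun w => e' (e.symm w)) u v) := by
  have h1 : e.symm =ᶠ[𝓝 u] fun w => e'.symm (e' (e.symm w)) := by
    have := (e.continuousAt_symm hu).eventually (e'.open_source.mem_nhds hu')
    filter_upwards [this] with w hw
    exact (e'.left_inv hw).symm
  have h2 : mfderiv (𝓡 n) (𝓡 n) (fun w => e'.symm (e' (e.symm w))) u =
      (mfderiv (𝓡 n) (𝓡 n) e'.symm (e' (e.symm u))).comp
        (mfderiv (𝓡 n) (𝓡 n) (fun w => e' (e.symm w)) u) :=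
    mfderiv_comp u (mdifferentiableAt_chart_symm he' (e'.map_source hu'))
      ((mdifferentiableAt_chart he' hu').comp u (mdifferentiableAt_chart_symm he hu))
  have h3 : mfderiv (𝓡 n) (𝓡 n) e.symm u = mfderiv (𝓡 n) (𝓡 n)
    (fun w => e'.symm (e' (e.symm w))) u := h1.mfderiv_eq
  have h4 : mfderiv (𝓡 n) (𝓡 n) (fun w => e' (e.symm w)) u = fderiv ℝ (fun w => e' (e.symm w)) u :=
    mfderiv_eq_fderiv
  have h5 : frame e u = (frame e' (e' (e.symm u))).comp (fderiv ℝ (fun w => e' (e.symm w)) u) := by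
    rw [← h4]
    exact h3.trans h2
  rw [h5]
  rfl

theorem fderiv_eq_sum_partialDeriv (h : 𝔼 → ℝ) (u v : 𝔼) :
    fderiv ℝ h u v = ∑ i, v i * partialDeriv i h u := by
  conv_lhs => rw [← (EuclideanSpace.basisFun (Fin n) ℝ).sum_repr v]
  simp [partialDeriv]

omit [IsManifold (𝓡 n) ∞ M] in
theorem frame_injective {e : OpenPartialHomeomorph M 𝔼}
    (he : e ∈ IsManifold.maximalAtlas (𝓡 n) ∞ M) {u : 𝔼} (hu : u ∈ e.target) {v : 𝔼}
    (hv : frame e u v = 0) : v = 0 := by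
  have h1 : (fun w => e (e.symm w)) =ᶠ[𝓝 u] id := by
    filter_upwards [e.open_target.mem_nhds hu] with w hw
    exact e.right_inv hw
  have h2 : mfderiv (𝓡 n) (𝓡 n) (fun w => e (e.symm w)) u =
      (mfderiv (𝓡 n) (𝓡 n) e (e.symm u)).comp (mfderiv (𝓡 n) (𝓡 n) e.symm u) :=
    mfderiv_comp u (mdifferentiableAt_chart he (e.map_target hu))
      (mdifferentiableAt_chart_symm he hu)
  have h3 : mfderiv (𝓡 n) (𝓡 n) (fun w => e (e.symm w)) u = fderiv ℝ (id : 𝔼 → 𝔼) u :=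
    h1.mfderiv_eq.trans mfderiv_eq_fderiv
  have h4 : (fderiv ℝ (id : 𝔼 → 𝔼) u) v = (mfderiv (𝓡 n) (𝓡 n) e (e.symm u)) (frame e u v) := by
    rw [← h3, h2]
    rfl
  rw [hv, fderiv_id] at h4
  exact h4.trans (map_zero (mfderiv (𝓡 n) (𝓡 n) e (e.symm u)))

theorem gram_quadratic (g : SmoothMetric n M) (e : OpenPartialHomeomorph M 𝔼) (u v w : 𝔼) :
    ∑ i, ∑ j, gram g e u i j * (v i * w j) =
      metricForm g (e.symm u) (frame e u v) (frame e u w) := by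
  conv_rhs => rw [← (EuclideanSpace.basisFun (Fin n) ℝ).sum_repr v,
    ← (EuclideanSpace.basisFun (Fin n) ℝ).sum_repr w]
  simp only [EuclideanSpace.basisFun_repr, EuclideanSpace.basisFun_apply, map_sum, map_smul,
    FunLike.coe_sum, Finset.sum_apply, FunLike.coe_smul, Pi.smul_apply, smul_eq_mul, ← gram_apply]
  simp only [Finset.mul_sum]
  rw [Finset.sum_comm]
  refine Finset.sum_congr rfl fun i _ => Finset.sum_congr rfl fun j _ => by ring

theorem gram_symm (g : SmoothMetric n M) (e : OpenPartialHomeomorph M 𝔼) (u : 𝔼) (i j : Fin n) :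
    gram g e u i j = gram g e u j i := metricForm_symm _ _ _ _

theorem gram_posDef (g : SmoothMetric n M) {e : OpenPartialHomeomorph M 𝔼}
    (he : e ∈ IsManifold.maximalAtlas (𝓡 n) ∞ M) {u : 𝔼} (hu : u ∈ e.target) :
    (gram g e u).PosDef := by
  refine Matrix.PosDef.of_dotProduct_mulVec_pos ?_ fun x hx => ?_
  · ext i j
    simpa using gram_symm g e u j i
  · have h := metricForm_pos g (e.symm u) (v := frame e u (WithLp.toLp 2 x)) (fun h => hx <| by
      have := frame_injective he hu h
      simpa using congrArg (WithLp.ofLp) this)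
    rw [← gram_quadratic] at h
    simp only [star_trivial, dotProduct, Matrix.mulVec, Finset.mul_sum]
    refine h.trans_eq (Finset.sum_congr rfl fun i _ => Finset.sum_congr rfl fun j _ => ?_)
    ring

theorem gram_det_pos (g : SmoothMetric n M) {e : OpenPartialHomeomorph M 𝔼}
    (he : e ∈ IsManifold.maximalAtlas (𝓡 n) ∞ M) {u : 𝔼} (hu : u ∈ e.target) :
    0 < (gram g e u).det := (gram_posDef g he hu).det_pos

theorem density_pos (g : SmoothMetric n M) {e : OpenPartialHomeomorph M 𝔼}
    (he : e ∈ IsManifold.maximalAtlas (𝓡 n) ∞ M) {u : 𝔼} (hu : u ∈ e.target) :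
    0 < density g e u := Real.sqrt_pos.2 (gram_det_pos g he hu)

theorem contDiffOn_matrix_det {S : Set 𝔼} {A : 𝔼 → Matrix (Fin n) (Fin n) ℝ}
    (hA : ∀ i j, ContDiffOn ℝ ∞ (fun u => A u i j) S) : ContDiffOn ℝ ∞ (fun u => (A u).det) S := by
  simp only [Matrix.det_apply']
  exact ContDiffOn.sum fun σ _ => contDiffOn_const.mul (contDiffOn_prod fun i _ => hA _ _)

/-- By Cramer's rule an entry of the inverse is a quotient of determinants, hence a rational
expression in the entries. -/
theorem contDiffOn_matrix_inv {S : Set 𝔼} {A : 𝔼 → Matrix (Fin n) (Fin n) ℝ}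
    (hA : ∀ i j, ContDiffOn ℝ ∞ (fun u => A u i j) S) (h0 : ∀ u ∈ S, (A u).det ≠ 0) (i j : Fin n) :
    ContDiffOn ℝ ∞ (fun u => (A u)⁻¹ i j) S := by
  simp only [Matrix.inv_def, Ring.inverse_eq_inv', Matrix.smul_apply, smul_eq_mul,
    Matrix.adjugate_apply]
  refine ((contDiffOn_matrix_det hA).inv h0).mul (contDiffOn_matrix_det fun k l => ?_)
  by_cases hk : k = j
  · subst hk
    simpa using contDiffOn_const
  · simpa [Matrix.updateRow_ne hk] using hA k l

theorem contDiffOn_gram_inv (g : SmoothMetric n M) {e : OpenPartialHomeomorph M 𝔼}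
    (he : e ∈ IsManifold.maximalAtlas (𝓡 n) ∞ M) (i j : Fin n) :
    ContDiffOn ℝ ∞ (fun u => (gram g e u)⁻¹ i j) e.target :=
  contDiffOn_matrix_inv (contDiffOn_gram g he) (fun _ hu => (gram_det_pos g he hu).ne') i j

theorem contDiffOn_density (g : SmoothMetric n M) {e : OpenPartialHomeomorph M 𝔼}
    (he : e ∈ IsManifold.maximalAtlas (𝓡 n) ∞ M) : ContDiffOn ℝ ∞ (density g e) e.target :=
  (contDiffOn_matrix_det (contDiffOn_gram g he)).sqrt fun _ hu => (gram_det_pos g he hu).ne'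

/-- The Jacobian matrix of the transition map from `e` to `e'`. -/
noncomputable def transitionJacobian (e e' : OpenPartialHomeomorph M 𝔼) (u : 𝔼) :
    Matrix (Fin n) (Fin n) ℝ :=
  Matrix.of fun k i => fderiv ℝ (fun w => e' (e.symm w)) u (EuclideanSpace.single i 1) k

theorem gram_transition (g : SmoothMetric n M) {e e' : OpenPartialHomeomorph M 𝔼}
    (he : e ∈ IsManifold.maximalAtlas (𝓡 n) ∞ M) (he' : e' ∈ IsManifold.maximalAtlas (𝓡 n) ∞ M)
    {u : 𝔼} (hu : u ∈ e.target) (hu' : e.symm u ∈ e'.source) :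
    gram g e u = (transitionJacobian e e' u).transpose * gram g e' (e' (e.symm u)) *
      transitionJacobian e e' u := by
  ext i j
  rw [gram_apply, frame_transition he he' hu hu', frame_transition he he' hu hu']
  have := gram_quadratic g e' (e' (e.symm u))
    (fderiv ℝ (fun w => e' (e.symm w)) u (EuclideanSpace.single i 1))
    (fderiv ℝ (fun w => e' (e.symm w)) u (EuclideanSpace.single j 1))
  rw [e'.left_inv hu'] at this
  rw [← this]
  simp only [Matrix.mul_apply, Matrix.transpose_apply, transitionJacobian, Matrix.of_apply,
    Finset.sum_mul]
  rw [Finset.sum_comm]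
  refine Finset.sum_congr rfl fun i _ => Finset.sum_congr rfl fun j _ => by ring

/-- A degenerate Jacobian would, by the transformation law of the Gram matrix, contradict
`gram_det_pos` in the chart `e`. -/
theorem det_transitionJacobian_ne_zero (g : SmoothMetric n M) {e e' : OpenPartialHomeomorph M 𝔼}
    (he : e ∈ IsManifold.maximalAtlas (𝓡 n) ∞ M) (he' : e' ∈ IsManifold.maximalAtlas (𝓡 n) ∞ M)
    {u : 𝔼} (hu : u ∈ e.target) (hu' : e.symm u ∈ e'.source) :
    (transitionJacobian e e' u).det ≠ 0 := by
  intro h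
  have := (gram_det_pos g he hu).ne'
  rw [gram_transition g he he' hu hu', Matrix.det_mul, h, mul_zero] at this
  exact this rfl

theorem density_transition (g : SmoothMetric n M) {e e' : OpenPartialHomeomorph M 𝔼}
    (he : e ∈ IsManifold.maximalAtlas (𝓡 n) ∞ M) (he' : e' ∈ IsManifold.maximalAtlas (𝓡 n) ∞ M)
    {u : 𝔼} (hu : u ∈ e.target) (hu' : e.symm u ∈ e'.source) :
    density g e u = |(transitionJacobian e e' u).det| * density g e' (e' (e.symm u)) := by
  rw [density, gram_transition g he he' hu hu', Matrix.det_mul, Matrix.det_mul,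
    Matrix.det_transpose, mul_comm, ← mul_assoc, Real.sqrt_mul (mul_self_nonneg _),
    Real.sqrt_mul_self_eq_abs, density]

omit [ChartedSpace (EuclideanSpace ℝ (Fin n)) M] [IsManifold (𝓡 n) ∞ M] in
theorem det_transitionJacobian_eq (e e' : OpenPartialHomeomorph M 𝔼) (u : 𝔼) :
    (transitionJacobian e e' u).det = (fderiv ℝ (fun w => e' (e.symm w)) u).det := by
  have : transitionJacobian e e' u = LinearMap.toMatrix (EuclideanSpace.basisFun (Fin n) ℝ).toBasis
      (EuclideanSpace.basisFun (Fin n) ℝ).toBasis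
      (fderiv ℝ (fun w => e' (e.symm w)) u : 𝔼 →ₗ[ℝ] 𝔼) := by
    ext k i
    simp [LinearMap.toMatrix_apply, transitionJacobian]
  rw [this, LinearMap.det_toMatrix]

end ChartGeometry

end EigenmapRegistration

/-! ### The Riemannian measure in charts -/

namespace EigenmapRegistration

/-- An inverse chart is continuous only on its target, so its preimages are measurable only relative
to that set. -/
theorem measurableSet_inter_preimage_of_continuousOn {α β : Type*} [TopologicalSpace α]
    [MeasurableSpace α] [OpensMeasurableSpace α] [TopologicalSpace β] [MeasurableSpace β]
    [BorelSpace β] {f : α → β} {s : Set α} (hf : ContinuousOn f s) (hs : MeasurableSet s)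
    {A : Set β} (hA : MeasurableSet A) : MeasurableSet (s ∩ f ⁻¹' A) := by
  have h := hs.subtype_image ((continuousOn_iff_continuous_domRestrict.1 hf).measurable hA)
  convert h using 1
  ext x
  simp [and_comm]

section Volume

variable {n : ℕ} {M : Type*} [TopologicalSpace M] [ChartedSpace (EuclideanSpace ℝ (Fin n)) M]
  [IsManifold (𝓡 n) ∞ M] [MeasurableSpace M] [BorelSpace M]

local notation "𝔼" => EuclideanSpace ℝ (Fin n)

omit [IsManifold (𝓡 n) ∞ M] [ChartedSpace (EuclideanSpace ℝ (Fin n)) M] in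
theorem aemeasurable_chart_symm (e : OpenPartialHomeomorph M 𝔼) :
    AEMeasurable e.symm (volume.restrict e.target) :=
  e.continuousOn_symm.aemeasurable e.open_target.measurableSet

omit [MeasurableSpace M] [BorelSpace M] in
theorem aemeasurable_density (g : SmoothMetric n M) {e : OpenPartialHomeomorph M 𝔼}
    (he : e ∈ IsManifold.maximalAtlas (𝓡 n) ∞ M) :
    AEMeasurable (fun u => ENNReal.ofReal (density g e u)) (volume.restrict e.target) :=
  ((contDiffOn_density g he).continuousOn.aemeasurable e.open_target.measurableSet).ennreal_ofReal

theorem chartVolume_apply (g : SmoothMetric n M) (e : OpenPartialHomeomorph M 𝔼) {A : Set M}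
    (hA : MeasurableSet A) :
    chartVolume g e A = ∫⁻ u in e.target ∩ e.symm ⁻¹' A, ENNReal.ofReal (density g e u) := by
  rw [chartVolume, Measure.map_apply_of_aemeasurable
    ((aemeasurable_chart_symm e).mono_ac (withDensity_absolutelyContinuous _ _)) hA,
    withDensity_apply', Measure.restrict_restrict' e.open_target.measurableSet, Set.inter_comm]

theorem chartVolume_inter_source (g : SmoothMetric n M) (e : OpenPartialHomeomorph M 𝔼) {A : Set M}
    (hA : MeasurableSet A) : chartVolume g e (A ∩ e.source) = chartVolume g e A := by
  rw [chartVolume_apply g e hA, chartVolume_apply g e (hA.inter e.open_source.measurableSet)]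
  congr 2
  ext u
  simp only [Set.mem_inter_iff, Set.mem_preimage]
  exact ⟨fun h => ⟨h.1, h.2.1⟩, fun h => ⟨h.1, h.2, e.map_target h.1⟩⟩

/-- Change of variables along the transition map: its Jacobian determinant is the factor in
`density_transition`. -/
theorem chartVolume_eq_of_subset (g : SmoothMetric n M) {e e' : OpenPartialHomeomorph M 𝔼}
    (he : e ∈ IsManifold.maximalAtlas (𝓡 n) ∞ M) (he' : e' ∈ IsManifold.maximalAtlas (𝓡 n) ∞ M)
    {A : Set M} (hA : MeasurableSet A) (h : A ⊆ e.source) (h' : A ⊆ e'.source) :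
    chartVolume g e A = chartVolume g e' A := by
  rw [chartVolume_apply g e hA, chartVolume_apply g e' hA]
  have him : (fun w => e' (e.symm w)) '' (e.target ∩ e.symm ⁻¹' A) = e'.target ∩ e'.symm ⁻¹' A := by
    ext v
    constructor
    · rintro ⟨u, ⟨hu, huA⟩, rfl⟩
      refine ⟨e'.map_source (h' huA), ?_⟩
      simpa [e'.left_inv (h' huA)] using huA
    · rintro ⟨hv, hvA⟩
      refine ⟨e (e'.symm v), ⟨e.map_source (h hvA), ?_⟩, ?_⟩
      · simpa [e.left_inv (h hvA)] using hvA
      · simp [e.left_inv (h hvA), e'.right_inv hv]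
  have hS : MeasurableSet (e.target ∩ e.symm ⁻¹' A) :=
    measurableSet_inter_preimage_of_continuousOn e.continuousOn_symm e.open_target.measurableSet hA
  rw [← him, lintegral_image_eq_lintegral_abs_det_fderiv_mul volume hS
    (f' := fun u => fderiv ℝ (fun w => e' (e.symm w)) u)]
  · refine setLIntegral_congr_fun hS fun u hu => ?_
    rw [density_transition g he he' hu.1 (h' hu.2), ENNReal.ofReal_mul (abs_nonneg _),
      det_transitionJacobian_eq]
  · intro u hu
    exact (((contDiffAt_transition he he' hu.1 (h' hu.2)).differentiableAt
      (by simp)).hasFDerivAt).hasFDerivWithinAt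
  · intro u hu v hv huv
    have := e'.injOn (h' hu.2) (h' hv.2) huv
    exact e.symm.injOn hu.1 hv.1 this

theorem exists_seq_chart_cover (M : Type*) [TopologicalSpace M]
    [ChartedSpace (EuclideanSpace ℝ (Fin n)) M] [CompactSpace M] [Nonempty M] :
    ∃ c : ℕ → M, ⋃ i, (chartAt (EuclideanSpace ℝ (Fin n)) (c i)).source = Set.univ := by
  obtain ⟨s, hs, hsu⟩ := countable_cover_nhds_of_sigmaCompact (X := M)
    (f := fun x => (chartAt (EuclideanSpace ℝ (Fin n)) x).source)
    (fun x => (chartAt _ x).open_source.mem_nhds (mem_chart_source _ x))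
  have hne : s.Nonempty := by
    by_contra h
    rw [Set.not_nonempty_iff_eq_empty] at h
    subst h
    simp only [Set.mem_empty_iff_false, Set.iUnion_of_empty, Set.iUnion_empty] at hsu
    exact Set.empty_ne_univ hsu
  obtain ⟨c, rfl⟩ := hs.exists_eq_range hne
  exact ⟨c, by simpa using hsu⟩

/-- A supremum of measures is not computed set by set. It is identified with a measure `ν` patched
from the chart volumes on a countable measurable partition subordinate to charts: compatibility
makes every chart volume at most `ν`, and on each piece `ν` is one of the chart volumes. -/
theorem riemannianVolume_eq_sum (g : SmoothMetric n M) (c : ℕ → M)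
    (hc : ⋃ i, (chartAt 𝔼 (c i)).source = Set.univ) :
    (∀ e ∈ IsManifold.maximalAtlas (𝓡 n) ∞ M, ∀ A, MeasurableSet A → A ⊆ e.source →
      riemannianVolume g A = chartVolume g e A) := by
  set D : ℕ → Set M := disjointed fun i => (chartAt 𝔼 (c i)).source with hD
  have hDm : ∀ i, MeasurableSet (D i) :=
    MeasurableSet.disjointed fun i => (chartAt 𝔼 (c i)).open_source.measurableSet
  have hDs : ∀ i, D i ⊆ (chartAt 𝔼 (c i)).source := fun i => disjointed_subset _ _
  have hDd : Pairwise (Function.onFun Disjoint D) := disjoint_disjointed _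
  have hDu : ⋃ i, D i = Set.univ := by rw [hD, iUnion_disjointed, hc]
  have hmem : ∀ i, chartAt 𝔼 (c i) ∈ IsManifold.maximalAtlas (𝓡 n) ∞ M :=
    fun i => IsManifold.chart_mem_maximalAtlas _
  have hsplit : ∀ (μ : Measure M) (A : Set M), MeasurableSet A → μ A = ∑' i, μ (A ∩ D i) := by
    intro μ A hA
    rw [← measure_iUnion (fun i j hij => ((hDd hij).mono Set.inter_subset_right
      Set.inter_subset_right)) fun i => hA.inter (hDm i), ← Set.inter_iUnion, hDu, Set.inter_univ]
  set ν : Measure M := Measure.sum fun i => (chartVolume g (chartAt 𝔼 (c i))).restrict (D i)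
  have hν : ∀ A, MeasurableSet A → ν A = ∑' i, chartVolume g (chartAt 𝔼 (c i)) (A ∩ D i) := by
    intro A hA
    rw [Measure.sum_apply _ hA]
    exact tsum_congr fun i => Measure.restrict_apply hA
  have hνe : ∀ e ∈ IsManifold.maximalAtlas (𝓡 n) ∞ M, ∀ A, MeasurableSet A → A ⊆ e.source →
      ν A = chartVolume g e A := by
    intro e he A hA hAe
    rw [hν A hA, hsplit (chartVolume g e) A hA]
    exact tsum_congr fun i => chartVolume_eq_of_subset g (hmem i) he (hA.inter (hDm i))
      (Set.inter_subset_right.trans (hDs i)) (Set.inter_subset_left.trans hAe)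
  have hle : riemannianVolume g ≤ ν := by
    refine iSup₂_le fun e he => Measure.le_iff.2 fun A hA => ?_
    rw [← chartVolume_inter_source g e hA,
      ← hνe e he _ (hA.inter e.open_source.measurableSet) Set.inter_subset_right]
    exact measure_mono Set.inter_subset_left
  have hge : ν ≤ riemannianVolume g := by
    refine Measure.le_iff.2 fun A hA => ?_
    rw [hν A hA, hsplit (riemannianVolume g) A hA]
    refine ENNReal.tsum_le_tsum fun i => ?_
    have : chartVolume g (chartAt 𝔼 (c i)) ≤ riemannianVolume g :=
      le_iSup₂_of_le (chartAt 𝔼 (c i)) (hmem i) le_rfl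
    exact this _
  rw [le_antisymm hle hge]
  exact hνe

variable [CompactSpace M] [Nonempty M]

theorem riemannianVolume_apply_of_subset (g : SmoothMetric n M) {e : OpenPartialHomeomorph M 𝔼}
    (he : e ∈ IsManifold.maximalAtlas (𝓡 n) ∞ M) {A : Set M} (hA : MeasurableSet A)
    (h : A ⊆ e.source) : riemannianVolume g A = chartVolume g e A := by
  obtain ⟨c, hc⟩ := exists_seq_chart_cover (n := n) M
  exact riemannianVolume_eq_sum g c hc e he A hA h

theorem riemannianVolume_restrict (g : SmoothMetric n M) {e : OpenPartialHomeomorph M 𝔼}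
    (he : e ∈ IsManifold.maximalAtlas (𝓡 n) ∞ M) :
    (riemannianVolume g).restrict e.source = chartVolume g e := by
  ext A hA
  rw [Measure.restrict_apply hA, riemannianVolume_apply_of_subset g he
    (hA.inter e.open_source.measurableSet) Set.inter_subset_right, chartVolume_inter_source g e hA]

instance isFiniteMeasure_riemannianVolume (g : SmoothMetric n M) :
    IsFiniteMeasure (riemannianVolume g) := by
  have : IsLocallyFiniteMeasure (riemannianVolume g) := by
    refine ⟨fun x => ?_⟩
    set e := chartAt 𝔼 x
    have he : e ∈ IsManifold.maximalAtlas (𝓡 n) ∞ M := IsManifold.chart_mem_maximalAtlas x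
    have hx : x ∈ e.source := mem_chart_source 𝔼 x
    obtain ⟨K, hK, hxK, hKt⟩ := exists_compact_subset e.open_target (e.map_source hx)
    refine ⟨e.source ∩ e ⁻¹' interior K, (e.isOpen_inter_preimage isOpen_interior).mem_nhds
      ⟨hx, hxK⟩, ?_⟩
    have hm : MeasurableSet (e.source ∩ e ⁻¹' interior K) :=
      (e.isOpen_inter_preimage isOpen_interior).measurableSet
    rw [riemannianVolume_apply_of_subset g he hm Set.inter_subset_left, chartVolume_apply g e hm]
    have hsub : e.target ∩ e.symm ⁻¹' (e.source ∩ e ⁻¹' interior K) ⊆ K := by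
      rintro u ⟨hu, -, hu2⟩
      rw [Set.mem_preimage, e.right_inv hu] at hu2
      exact interior_subset hu2
    have hi : IntegrableOn (density g e) K :=
      ((contDiffOn_density g he).continuousOn.mono hKt).integrableOn_compact hK
    calc _ ≤ ∫⁻ u in K, ENNReal.ofReal (density g e u) := lintegral_mono_set hsub
      _ < ⊤ := hi.lintegral_lt_top
  exact CompactSpace.isFiniteMeasure

instance isOpenPosMeasure_riemannianVolume (g : SmoothMetric n M) :
    (riemannianVolume g).IsOpenPosMeasure := by
  refine ⟨fun U hU ⟨x, hxU⟩ h0 => ?_⟩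
  set e := chartAt 𝔼 x
  have he : e ∈ IsManifold.maximalAtlas (𝓡 n) ∞ M := IsManifold.chart_mem_maximalAtlas x
  have hx : x ∈ e.source := mem_chart_source 𝔼 x
  have hm : IsOpen (U ∩ e.source) := hU.inter e.open_source
  have h1 : riemannianVolume g (U ∩ e.source) = 0 :=
    measure_mono_null Set.inter_subset_left h0
  rw [riemannianVolume_apply_of_subset g he hm.measurableSet Set.inter_subset_right,
    chartVolume_apply g e hm.measurableSet] at h1
  have hW : IsOpen (e.target ∩ e.symm ⁻¹' (U ∩ e.source)) := e.symm.isOpen_inter_preimage hm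
  have hWne : (e.target ∩ e.symm ⁻¹' (U ∩ e.source)).Nonempty :=
    ⟨e x, e.map_source hx, by simpa [e.left_inv hx] using ⟨hxU, hx⟩⟩
  rw [lintegral_eq_zero_iff' ((aemeasurable_density g he).mono_measure
    (Measure.restrict_mono Set.inter_subset_left le_rfl)), Filter.EventuallyEq,
    ae_restrict_iff' hW.measurableSet] at h1
  have h2 : volume (e.target ∩ e.symm ⁻¹' (U ∩ e.source)) = 0 := by
    refine measure_mono_null (fun u hu => ?_) (ae_iff.1 h1)
    simp only [Set.mem_ofPred_eq, Pi.zero_apply, ENNReal.ofReal_eq_zero, not_forall, not_le]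
    exact ⟨hu, density_pos g he hu.1⟩
  exact (hW.measure_pos volume hWne).ne' h2

/-- The density is positive on the target, so the chart measure and Lebesgue measure have the same
null sets there, and `e` and `e.symm` carry them back and forth. -/
theorem ae_chart_iff (g : SmoothMetric n M) {e : OpenPartialHomeomorph M 𝔼}
    (he : e ∈ IsManifold.maximalAtlas (𝓡 n) ∞ M) {p : M → Prop} :
    (∀ᵐ x ∂riemannianVolume g, x ∈ e.source → p x) ↔ ∀ᵐ u : 𝔼, u ∈ e.target → p (e.symm u) := by
  set μ := (volume.restrict e.target).withDensity (fun u => ENNReal.ofReal (density g e u)) with hμ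
  have hac : μ ≪ volume.restrict e.target := withDensity_absolutelyContinuous _ _
  have hac' : volume.restrict e.target ≪ μ := by
    refine withDensity_absolutelyContinuous' (aemeasurable_density g he) ?_
    filter_upwards [ae_restrict_mem e.open_target.measurableSet] with u hu
    simpa using density_pos g he hu
  have hs : AEMeasurable e.symm μ := (aemeasurable_chart_symm e).mono_ac hac
  rw [← ae_restrict_iff' e.open_source.measurableSet, ← ae_restrict_iff' e.open_target.measurableSet,
    riemannianVolume_restrict g he]
  have hmap : chartVolume g e = μ.map e.symm := rfl
  have he' : AEMeasurable e (chartVolume g e) := by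
    rw [← riemannianVolume_restrict g he]
    exact e.continuousOn.aemeasurable e.open_source.measurableSet
  have hmem : ∀ᵐ x ∂chartVolume g e, x ∈ e.source := by
    rw [← riemannianVolume_restrict g he]
    exact ae_restrict_mem e.open_source.measurableSet
  have hmap' : (chartVolume g e).map e = μ := by
    rw [hmap, AEMeasurable.map_map_of_aemeasurable (hmap ▸ he') hs]
    conv_rhs => rw [← Measure.map_id (μ := μ)]
    refine Measure.map_congr (hac.ae_le ?_)
    filter_upwards [ae_restrict_mem e.open_target.measurableSet] with u hu
    exact e.right_inv hu
  constructor
  · intro h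
    exact hac'.ae_le (ae_of_ae_map hs h)
  · intro h
    have h1 : ∀ᵐ u ∂(chartVolume g e).map e, p (e.symm u) := by
      rw [hmap']
      exact hac.ae_le h
    filter_upwards [ae_of_ae_map he' h1, hmem] with x hx hxs
    rwa [e.left_inv hxs] at hx

theorem setIntegral_chart (g : SmoothMetric n M) {e : OpenPartialHomeomorph M 𝔼}
    (he : e ∈ IsManifold.maximalAtlas (𝓡 n) ∞ M) {h : M → ℝ}
    (hh : AEStronglyMeasurable h (riemannianVolume g)) :
    ∫ x in e.source, h x ∂riemannianVolume g = ∫ u in e.target, density g e u * h (e.symm u) := by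
  have hac : (volume.restrict e.target).withDensity (fun u => ENNReal.ofReal (density g e u)) ≪
    volume.restrict e.target := withDensity_absolutelyContinuous _ _
  have hh' : AEStronglyMeasurable h (chartVolume g e) := by
    rw [← riemannianVolume_restrict g he]
    exact hh.restrict
  rw [riemannianVolume_restrict g he]
  rw [chartVolume] at hh' ⊢
  rw [integral_map ((aemeasurable_chart_symm e).mono_ac hac) hh',
    integral_withDensity_eq_integral_toReal_smul₀ (aemeasurable_density g he) (by simp)]
  refine setIntegral_congr_fun e.open_target.measurableSet fun u hu => ?_
  simp [ENNReal.toReal_ofReal (density_pos g he hu).le]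

theorem integrableOn_chart_iff (g : SmoothMetric n M) {e : OpenPartialHomeomorph M 𝔼}
    (he : e ∈ IsManifold.maximalAtlas (𝓡 n) ∞ M) {h : M → ℝ}
    (hh : AEStronglyMeasurable h (riemannianVolume g)) :
    IntegrableOn h e.source (riemannianVolume g) ↔
      IntegrableOn (fun u => density g e u * h (e.symm u)) e.target := by
  have hac : (volume.restrict e.target).withDensity (fun u => ENNReal.ofReal (density g e u)) ≪
    volume.restrict e.target := withDensity_absolutelyContinuous _ _
  have hh' : AEStronglyMeasurable h (chartVolume g e) := by
    rw [← riemannianVolume_restrict g he]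
    exact hh.restrict
  rw [IntegrableOn, riemannianVolume_restrict g he]
  rw [chartVolume] at hh' ⊢
  rw [integrable_map_measure hh' ((aemeasurable_chart_symm e).mono_ac hac),
    integrable_withDensity_iff_integrable_smul₀' (aemeasurable_density g he) (by simp)]
  refine integrable_congr ?_
  filter_upwards [ae_restrict_mem e.open_target.measurableSet] with u hu
  simp [ENNReal.toReal_ofReal (density_pos g he hu).le]

end Volume

end EigenmapRegistration

/-! ### The scalar product of gradients -/

namespace EigenmapRegistration

section EnergyDensity

variable {n : ℕ} {M : Type*} [TopologicalSpace M] [ChartedSpace (EuclideanSpace ℝ (Fin n)) M]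

local notation "𝔼" => EuclideanSpace ℝ (Fin n)

/-- The components of the differential of `f` in the chart `e`. -/
noncomputable def differentialInChart (e : OpenPartialHomeomorph M 𝔼) (f : M → ℝ) (u : 𝔼) :
    Fin n → ℝ :=
  fun i => partialDeriv i (f ∘ e.symm) u

theorem contDiffOn_comp_chart_symm {e : OpenPartialHomeomorph M 𝔼}
    (he : e ∈ IsManifold.maximalAtlas (𝓡 n) ∞ M) {f : M → ℝ}
    (hf : ContMDiffOn (𝓡 n) 𝓘(ℝ, ℝ) ∞ f e.source) : ContDiffOn ℝ ∞ (f ∘ e.symm) e.target := by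
  rw [← contMDiffOn_iff_contDiffOn]
  exact hf.comp (contMDiffOn_symm_of_mem_maximalAtlas he) fun u hu => e.map_target hu

theorem contDiffOn_partialDeriv {Ω : Set 𝔼} (hΩ : IsOpen Ω) {h : 𝔼 → ℝ} (hh : ContDiffOn ℝ ∞ h Ω)
    (i : Fin n) : ContDiffOn ℝ ∞ (partialDeriv i h) Ω :=
  (hh.fderiv_of_isOpen (m := ∞) hΩ (by simp)).clm_apply contDiffOn_const

theorem differentialInChart_transition {e e' : OpenPartialHomeomorph M 𝔼}
    (he : e ∈ IsManifold.maximalAtlas (𝓡 n) ∞ M) (he' : e' ∈ IsManifold.maximalAtlas (𝓡 n) ∞ M)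
    {f : M → ℝ} (hf : ContMDiff (𝓡 n) 𝓘(ℝ, ℝ) ∞ f) {u : 𝔼} (hu : u ∈ e.target)
    (hu' : e.symm u ∈ e'.source) :
    differentialInChart e f u =
      (transitionJacobian e e' u).transpose.mulVec (differentialInChart e' f (e' (e.symm u))) := by
  have h1 : f ∘ e.symm =ᶠ[𝓝 u] fun w => (f ∘ e'.symm) (e' (e.symm w)) := by
    have := (e.continuousAt_symm hu).eventually (e'.open_source.mem_nhds hu')
    filter_upwards [this] with w hw
    simp [e'.left_inv hw]
  have hd : DifferentiableAt ℝ (f ∘ e'.symm) (e' (e.symm u)) :=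
    ((contDiffOn_comp_chart_symm he' hf.contMDiffOn).contDiffAt
      (e'.open_target.mem_nhds (e'.map_source hu'))).differentiableAt (by simp)
  have hτ := (contDiffAt_transition he he' hu hu').differentiableAt (by simp)
  ext i
  rw [differentialInChart, partialDeriv, h1.fderiv_eq,
    fderiv_fun_comp u hd hτ, ContinuousLinearMap.comp_apply, fderiv_eq_sum_partialDeriv]
  rfl

variable [IsManifold (𝓡 n) ∞ M]

/-- The scalar product of the gradients of `f` and `h`, in the chart `e`. -/
noncomputable def gradProductInChart (g : SmoothMetric n M) (e : OpenPartialHomeomorph M 𝔼)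
    (f h : M → ℝ) (u : 𝔼) : ℝ :=
  differentialInChart e f u ⬝ᵥ (gram g e u)⁻¹.mulVec (differentialInChart e h u)

/-- The scalar product of the gradients of `f` and `h`. -/
noncomputable def gradProduct (g : SmoothMetric n M) (f h : M → ℝ) (x : M) : ℝ :=
  gradProductInChart g (chartAt 𝔼 x) f h (chartAt 𝔼 x x)

/-- The differentials acquire the transposed Jacobian and the inverse Gram matrix the inverse
Jacobians, which cancel. So `gradProduct`, defined through the preferred chart at each point, may be
computed in any chart. -/
theorem gradProductInChart_transition (g : SmoothMetric n M) {e e' : OpenPartialHomeomorph M 𝔼}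
    (he : e ∈ IsManifold.maximalAtlas (𝓡 n) ∞ M) (he' : e' ∈ IsManifold.maximalAtlas (𝓡 n) ∞ M)
    {f h : M → ℝ} (hf : ContMDiff (𝓡 n) 𝓘(ℝ, ℝ) ∞ f) (hh : ContMDiff (𝓡 n) 𝓘(ℝ, ℝ) ∞ h)
    {u : 𝔼} (hu : u ∈ e.target) (hu' : e.symm u ∈ e'.source) :
    gradProductInChart g e f h u = gradProductInChart g e' f h (e' (e.symm u)) := by
  have hJ : IsUnit (transitionJacobian e e' u).det :=
    (det_transitionJacobian_ne_zero g he he' hu hu').isUnit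
  have hJt : IsUnit (transitionJacobian e e' u).transpose.det := by rwa [Matrix.det_transpose]
  rw [gradProductInChart, gradProductInChart, differentialInChart_transition he he' hf hu hu',
    differentialInChart_transition he he' hh hu hu', gram_transition g he he' hu hu',
    Matrix.mul_inv_rev, Matrix.mul_inv_rev, Matrix.mulVec_mulVec, Matrix.mulVec_transpose,
    ← Matrix.dotProduct_mulVec, Matrix.mulVec_mulVec, Matrix.mul_assoc, Matrix.mul_assoc,
    Matrix.nonsing_inv_mul _ hJt, Matrix.mul_one, Matrix.mul_nonsing_inv_cancel_left _ _ hJ]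

theorem gradProduct_chart (g : SmoothMetric n M) {e : OpenPartialHomeomorph M 𝔼}
    (he : e ∈ IsManifold.maximalAtlas (𝓡 n) ∞ M)
    {f h : M → ℝ} (hf : ContMDiff (𝓡 n) 𝓘(ℝ, ℝ) ∞ f) (hh : ContMDiff (𝓡 n) 𝓘(ℝ, ℝ) ∞ h)
    {u : 𝔼} (hu : u ∈ e.target) :
    gradProduct g f h (e.symm u) = gradProductInChart g e f h u := by
  rw [gradProductInChart_transition g he (IsManifold.chart_mem_maximalAtlas (e.symm u)) hf hh hu
    (mem_chart_source 𝔼 _)]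
  rfl

theorem gradProductInChart_comm (g : SmoothMetric n M) (e : OpenPartialHomeomorph M 𝔼)
    (f h : M → ℝ) (u : 𝔼) : gradProductInChart g e f h u = gradProductInChart g e h f u := by
  have hs : (gram g e u)⁻¹.transpose = (gram g e u)⁻¹ := by
    rw [Matrix.transpose_nonsing_inv]
    congr 1
    ext i j
    exact gram_symm g e u j i
  rw [gradProductInChart, gradProductInChart, Matrix.dotProduct_mulVec, dotProduct_comm,
    ← Matrix.mulVec_transpose, hs]

theorem gradProduct_comm (g : SmoothMetric n M) (f h : M → ℝ) (x : M) :
    gradProduct g f h x = gradProduct g h f x := gradProductInChart_comm _ _ _ _ _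

theorem gradProductInChart_self_nonneg (g : SmoothMetric n M) {e : OpenPartialHomeomorph M 𝔼}
    (he : e ∈ IsManifold.maximalAtlas (𝓡 n) ∞ M) (f : M → ℝ) {u : 𝔼} (hu : u ∈ e.target) :
    0 ≤ gradProductInChart g e f f u := by
  have h := (gram_posDef g he hu).inv.posSemidef.dotProduct_mulVec_nonneg (differentialInChart e f u)
  rw [star_trivial] at h
  exact h

theorem gradProduct_self_nonneg (g : SmoothMetric n M) (f : M → ℝ) (x : M) :
    0 ≤ gradProduct g f f x :=
  gradProductInChart_self_nonneg g (IsManifold.chart_mem_maximalAtlas x) f (mem_chart_target 𝔼 x)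

/-- Cauchy-Schwarz for the Gram form, applied to a coordinate vector and the gradient `q`. It bounds
Euclidean derivatives by the Riemannian energy. -/
theorem sq_partialDeriv_le (g : SmoothMetric n M) {e : OpenPartialHomeomorph M 𝔼}
    (he : e ∈ IsManifold.maximalAtlas (𝓡 n) ∞ M) (f : M → ℝ) {u : 𝔼} (hu : u ∈ e.target)
    (i : Fin n) :
    partialDeriv i (f ∘ e.symm) u ^ 2 ≤ gram g e u i i * gradProductInChart g e f f u := by
  have hG := gram_posDef g he hu
  set q := (gram g e u)⁻¹.mulVec (differentialInChart e f u)
  have hq : (gram g e u).mulVec q = differentialInChart e f u := by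
    rw [Matrix.mulVec_mulVec, Matrix.mul_nonsing_inv _ (gram_det_pos g he hu).ne'.isUnit,
      Matrix.one_mulVec]
  have hB : ∀ v w, Matrix.toBilin' (gram g e u) v w = v ⬝ᵥ (gram g e u).mulVec w :=
    fun v w => Matrix.toBilin'_apply' _ _ _
  have h := LinearMap.BilinForm.apply_sq_le_of_symm (Matrix.toBilin' (gram g e u))
    (fun x => by
      rw [hB]
      simpa using hG.posSemidef.dotProduct_mulVec_nonneg x)
    ⟨fun x y => by
      rw [RingHom.id_apply, hB, hB, Matrix.dotProduct_mulVec, dotProduct_comm,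
        ← Matrix.mulVec_transpose]
      congr 2
      ext i j
      exact gram_symm g e u j i⟩ (Pi.single i 1) q
  rw [hB, hB, hB, hq] at h
  have h1 : gradProductInChart g e f f u = q ⬝ᵥ differentialInChart e f u := by
    rw [gradProductInChart, dotProduct_comm]
  rw [h1]
  simpa [differentialInChart] using h

theorem contDiffOn_gradProductInChart (g : SmoothMetric n M) {e : OpenPartialHomeomorph M 𝔼}
    (he : e ∈ IsManifold.maximalAtlas (𝓡 n) ∞ M)
    {f h : M → ℝ} (hf : ContMDiff (𝓡 n) 𝓘(ℝ, ℝ) ∞ f) (hh : ContMDiff (𝓡 n) 𝓘(ℝ, ℝ) ∞ h) :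
    ContDiffOn ℝ ∞ (gradProductInChart g e f h) e.target := by
  have hd : ∀ {f : M → ℝ}, ContMDiff (𝓡 n) 𝓘(ℝ, ℝ) ∞ f → ∀ i,
      ContDiffOn ℝ ∞ (fun u => differentialInChart e f u i) e.target := fun hf i =>
    contDiffOn_partialDeriv e.open_target (contDiffOn_comp_chart_symm he hf.contMDiffOn) i
  unfold gradProductInChart dotProduct Matrix.mulVec dotProduct
  exact ContDiffOn.sum fun i _ => (hd hf i).mul
    (ContDiffOn.sum fun j _ => (contDiffOn_gram_inv g he i j).mul (hd hh j))

theorem continuous_gradProduct (g : SmoothMetric n M)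
    {f h : M → ℝ} (hf : ContMDiff (𝓡 n) 𝓘(ℝ, ℝ) ∞ f) (hh : ContMDiff (𝓡 n) 𝓘(ℝ, ℝ) ∞ h) :
    Continuous (gradProduct g f h) := by
  rw [continuous_iff_continuousAt]
  intro x
  set e := chartAt 𝔼 x
  have he : e ∈ IsManifold.maximalAtlas (𝓡 n) ∞ M := IsManifold.chart_mem_maximalAtlas x
  have h1 : gradProduct g f h =ᶠ[𝓝 x] gradProductInChart g e f h ∘ e := by
    filter_upwards [e.open_source.mem_nhds (mem_chart_source 𝔼 x)] with y hy
    conv_lhs => rw [← e.left_inv hy]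
    exact gradProduct_chart g he hf hh (e.map_source hy)
  refine ContinuousAt.congr ?_ h1.symm
  exact ((contDiffOn_gradProductInChart g he hf hh).continuousOn.continuousAt
    (e.open_target.mem_nhds (mem_chart_target 𝔼 x))).comp (e.continuousAt (mem_chart_source 𝔼 x))

omit [IsManifold (𝓡 n) ∞ M] in
theorem differentialInChart_add {e : OpenPartialHomeomorph M 𝔼}
    (he : e ∈ IsManifold.maximalAtlas (𝓡 n) ∞ M)
    {f h : M → ℝ} (hf : ContMDiff (𝓡 n) 𝓘(ℝ, ℝ) ∞ f) (hh : ContMDiff (𝓡 n) 𝓘(ℝ, ℝ) ∞ h)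
    {u : 𝔼} (hu : u ∈ e.target) :
    differentialInChart e (f + h) u = differentialInChart e f u + differentialInChart e h u := by
  have hd : ∀ {f : M → ℝ}, ContMDiff (𝓡 n) 𝓘(ℝ, ℝ) ∞ f → DifferentiableAt ℝ (f ∘ e.symm) u :=
    fun hf => ((contDiffOn_comp_chart_symm he hf.contMDiffOn).contDiffAt
      (e.open_target.mem_nhds hu)).differentiableAt (by simp)
  ext i
  simp only [differentialInChart, partialDeriv, Pi.add_apply]
  rw [show (f + h) ∘ e.symm = (f ∘ e.symm) + (h ∘ e.symm) from rfl, fderiv_add (hd hf) (hd hh)]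
  rfl

omit [IsManifold (𝓡 n) ∞ M] [ChartedSpace (EuclideanSpace ℝ (Fin n)) M] in
theorem differentialInChart_smul (e : OpenPartialHomeomorph M 𝔼) (c : ℝ) (f : M → ℝ) (u : 𝔼) :
    differentialInChart e (c • f) u = c • differentialInChart e f u := by
  ext i
  simp only [differentialInChart, partialDeriv, Pi.smul_apply]
  rw [show (c • f) ∘ e.symm = c • (f ∘ e.symm) from rfl, fderiv_const_smul_field]
  rfl

theorem gradProduct_add_left (g : SmoothMetric n M) {f₁ f₂ h : M → ℝ}
    (hf₁ : ContMDiff (𝓡 n) 𝓘(ℝ, ℝ) ∞ f₁) (hf₂ : ContMDiff (𝓡 n) 𝓘(ℝ, ℝ) ∞ f₂) (x : M) :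
    gradProduct g (f₁ + f₂) h x = gradProduct g f₁ h x + gradProduct g f₂ h x := by
  rw [gradProduct, gradProductInChart, differentialInChart_add
    (IsManifold.chart_mem_maximalAtlas x) hf₁ hf₂ (mem_chart_target 𝔼 x), add_dotProduct]
  rfl

theorem gradProduct_smul_left (g : SmoothMetric n M) (c : ℝ) (f h : M → ℝ) (x : M) :
    gradProduct g (c • f) h x = c * gradProduct g f h x := by
  rw [gradProduct, gradProductInChart, differentialInChart_smul, smul_dotProduct]
  rfl

theorem gradProduct_const_left (g : SmoothMetric n M) (c : ℝ) (h : M → ℝ) (x : M) :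
    gradProduct g (fun _ => c) h x = 0 := by
  have : differentialInChart (chartAt 𝔼 x) (fun _ => c) (chartAt 𝔼 x x) = 0 := by
    ext i
    simp [differentialInChart, partialDeriv, Function.comp_def]
  rw [gradProduct, gradProductInChart, this, zero_dotProduct]

end EnergyDensity

end EigenmapRegistration

/-! ### Extension by zero from charts, and the energy space of smooth functions -/

namespace EigenmapRegistration

section ZeroExtension

variable {n : ℕ} {M : Type*} [TopologicalSpace M]

local notation "𝔼" => EuclideanSpace ℝ (Fin n)

/-- The function on `M` with coordinate expression `ψ` in the chart `e`, zero outside the chart. -/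
noncomputable def chartExtend (e : OpenPartialHomeomorph M 𝔼) (ψ : 𝔼 → ℝ) : M → ℝ :=
  e.source.indicator (ψ ∘ e)

theorem chartExtend_symm (e : OpenPartialHomeomorph M 𝔼) (ψ : 𝔼 → ℝ) {u : 𝔼} (hu : u ∈ e.target) :
    chartExtend e ψ (e.symm u) = ψ u := by
  rw [chartExtend, Set.indicator_of_mem (e.map_target hu), Function.comp_apply, e.right_inv hu]

theorem chartExtend_of_notMem (e : OpenPartialHomeomorph M 𝔼) (ψ : 𝔼 → ℝ) {x : M}
    (hx : x ∉ e.source) : chartExtend e ψ x = 0 := Set.indicator_of_notMem hx _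

/-- In a Hausdorff space the image of the compact support is closed. Hence the extension vanishes
near every point outside the chart, boundary points included, and is smooth there. -/
theorem chartExtend_eventuallyEq_zero [T2Space M] (e : OpenPartialHomeomorph M 𝔼) {ψ : 𝔼 → ℝ}
    (hc : HasCompactSupport ψ) (ht : tsupport ψ ⊆ e.target) {x : M} (hx : x ∉ e.source) :
    chartExtend e ψ =ᶠ[𝓝 x] fun _ => 0 := by
  have hK : IsClosed (e.symm '' tsupport ψ) :=
    (hc.isCompact.image_of_continuousOn (e.continuousOn_symm.mono ht)).isClosed
  have hxK : x ∉ e.symm '' tsupport ψ := by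
    rintro ⟨u, hu, rfl⟩
    exact hx (e.map_target (ht hu))
  filter_upwards [hK.isOpen_compl.mem_nhds hxK] with y hy
  by_cases hys : y ∈ e.source
  · rw [chartExtend, Set.indicator_of_mem hys]
    by_contra h0
    exact hy ⟨e y, subset_tsupport _ h0, e.left_inv hys⟩
  · exact chartExtend_of_notMem e ψ hys

theorem contMDiff_chartExtend [T2Space M] [ChartedSpace (EuclideanSpace ℝ (Fin n)) M]
    {e : OpenPartialHomeomorph M 𝔼}
    (he : e ∈ IsManifold.maximalAtlas (𝓡 n) ∞ M) {ψ : 𝔼 → ℝ} (hψ : ContDiff ℝ ∞ ψ)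
    (hc : HasCompactSupport ψ) (ht : tsupport ψ ⊆ e.target) :
    ContMDiff (𝓡 n) 𝓘(ℝ, ℝ) ∞ (chartExtend e ψ) := by
  intro x
  by_cases hx : x ∈ e.source
  · have h1 : chartExtend e ψ =ᶠ[𝓝 x] ψ ∘ e := by
      filter_upwards [e.open_source.mem_nhds hx] with y hy
      exact Set.indicator_of_mem hy _
    refine ContMDiffAt.congr_of_eventuallyEq ?_ h1
    exact (contMDiff_iff_contDiff.2 hψ).contMDiffAt.comp x (contMDiffAt_of_mem_maximalAtlas he hx)
  · exact contMDiffAt_const.congr_of_eventuallyEq (chartExtend_eventuallyEq_zero e hc ht hx)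

/-- Chart coefficients are controlled only on the target of the chart; this is how they enter
globally smooth functions. -/
theorem contDiff_mul_of_tsupport_subset {Ω : Set 𝔼} (hΩ : IsOpen Ω) {χ w : 𝔼 → ℝ}
    (hχ : ContDiff ℝ ∞ χ) (ht : tsupport χ ⊆ Ω) (hw : ContDiffOn ℝ ∞ w Ω) :
    ContDiff ℝ ∞ (fun x => χ x * w x) := by
  rw [contDiff_iff_contDiffAt]
  intro x
  by_cases hx : x ∈ Ω
  · exact hχ.contDiffAt.mul (hw.contDiffAt (hΩ.mem_nhds hx))
  · have h1 : (fun x => χ x * w x) =ᶠ[𝓝 x] fun _ => 0 := by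
      filter_upwards [(isClosed_tsupport χ).isOpen_compl.mem_nhds fun h => hx (ht h)] with y hy
      rw [image_eq_zero_of_notMem_tsupport hy, zero_mul]
    exact contDiffAt_const.congr_of_eventuallyEq h1

end ZeroExtension

section Energy

variable {n : ℕ} {M : Type*} [TopologicalSpace M] [ChartedSpace (EuclideanSpace ℝ (Fin n)) M]
  [IsManifold (𝓡 n) ∞ M]

local notation "𝔼" => EuclideanSpace ℝ (Fin n)

/-- The smooth functions on `M`, to be equipped with the Sobolev scalar product
`∫ f h + ⟨∇f, ∇h⟩`. -/
structure EnergySpace (g : SmoothMetric n M) where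
  toFun : C^∞⟮𝓡 n, M; 𝓘(ℝ, ℝ), ℝ⟯

namespace EnergySpace

variable {g : SmoothMetric n M}

noncomputable instance : CoeFun (EnergySpace g) (fun _ => M → ℝ) := ⟨fun f => f.toFun⟩

/-- Smooth functions as elements of the energy space. -/
noncomputable def equiv (g : SmoothMetric n M) : EnergySpace g ≃ C^∞⟮𝓡 n, M; 𝓘(ℝ, ℝ), ℝ⟯ :=
  ⟨toFun, mk, fun _ => rfl, fun _ => rfl⟩

noncomputable instance : AddCommGroup (EnergySpace g) := (equiv g).addCommGroup

noncomputable instance : Module ℝ (EnergySpace g) := (equiv g).module ℝ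

theorem contMDiff (f : EnergySpace g) : ContMDiff (𝓡 n) 𝓘(ℝ, ℝ) ∞ f := f.toFun.contMDiff

theorem continuous (f : EnergySpace g) : Continuous f := f.contMDiff.continuous

theorem coe_add (f h : EnergySpace g) : ⇑(f + h).toFun = f + h := rfl

theorem coe_smul (c : ℝ) (f : EnergySpace g) : ⇑(c • f).toFun = c • ⇑f.toFun := rfl

theorem ext' {f h : EnergySpace g} (hfh : ∀ x, f x = h x) : f = h :=
  (equiv g).injective (ContMDiffMap.ext hfh)

variable [MeasurableSpace M] [BorelSpace M] [CompactSpace M] [Nonempty M]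

theorem integrable_mul (f h : EnergySpace g) :
    Integrable (fun x => f x * h x) (riemannianVolume g) :=
  (f.continuous.mul h.continuous).integrable_of_hasCompactSupport (.of_compactSpace _)

theorem integrable_gradProduct (f h : EnergySpace g) :
    Integrable (gradProduct g f h) (riemannianVolume g) :=
  (continuous_gradProduct g f.contMDiff h.contMDiff).integrable_of_hasCompactSupport
    (.of_compactSpace _)

noncomputable instance : InnerProductSpace.Core ℝ (EnergySpace g) where
  inner f h := ∫ x, (f x * h x + gradProduct g f h x) ∂riemannianVolume g
  conj_inner_symm f h := by
    simp only [conj_trivial]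
    congr 1 with x
    rw [gradProduct_comm, mul_comm]
  re_inner_nonneg f := integral_nonneg fun x =>
    add_nonneg (mul_self_nonneg _) (gradProduct_self_nonneg g f x)
  add_left f₁ f₂ h := by
    refine Eq.trans ?_ (integral_add ((integrable_mul f₁ h).add (integrable_gradProduct f₁ h))
      ((integrable_mul f₂ h).add (integrable_gradProduct f₂ h)))
    congr 1 with x
    rw [coe_add, gradProduct_add_left g f₁.contMDiff f₂.contMDiff, Pi.add_apply]
    ring
  smul_left f h c := by
    simp only [conj_trivial]
    rw [← integral_const_mul]
    congr 1 with x
    rw [coe_smul, gradProduct_smul_left, Pi.smul_apply, smul_eq_mul]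
    ring
  definite f hf := by
    have h0 : ∀ x, 0 ≤ f x * f x + gradProduct g f f x := fun x =>
      add_nonneg (mul_self_nonneg _) (gradProduct_self_nonneg g f x)
    have h1 := (integral_eq_zero_iff_of_nonneg h0
      ((integrable_mul f f).add (integrable_gradProduct f f))).1 hf
    have h2 : (f : M → ℝ) =ᵐ[riemannianVolume g] 0 := by
      filter_upwards [h1] with x hx
      have := gradProduct_self_nonneg g f x
      simp only [Pi.zero_apply] at hx ⊢
      nlinarith [mul_self_nonneg (f x)]
    have h3 := (Continuous.ae_eq_iff_eq _ f.continuous continuous_zero).1 h2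
    exact ext' fun x => congrFun h3 x

noncomputable instance : NormedAddCommGroup (EnergySpace g) :=
  InnerProductSpace.Core.toNormedAddCommGroup (𝕜 := ℝ)

noncomputable instance : InnerProductSpace ℝ (EnergySpace g) := InnerProductSpace.ofCore _

theorem inner_eq (f h : EnergySpace g) :
    inner ℝ f h = ∫ x, (f x * h x + gradProduct g f h x) ∂riemannianVolume g := rfl

theorem norm_sq_eq (f : EnergySpace g) :
    ‖f‖ ^ 2 = ∫ x, (f x * f x + gradProduct g f f x) ∂riemannianVolume g := by
  rw [← real_inner_self_eq_norm_sq, inner_eq]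

/-- The class in `L²` of a continuous function. -/
noncomputable def toL2 (g : SmoothMetric n M) {h : M → ℝ} (hh : Continuous h) :
    Lp ℝ 2 (riemannianVolume g) :=
  ContinuousMap.toLp 2 (riemannianVolume g) ℝ ⟨h, hh⟩

theorem coeFn_toL2 {h : M → ℝ} (hh : Continuous h) : toL2 g hh =ᵐ[riemannianVolume g] h :=
  ContinuousMap.coeFn_toLp (riemannianVolume g) (𝕜 := ℝ) ⟨h, hh⟩

theorem inner_toL2 (B : Lp ℝ 2 (riemannianVolume g)) {h : M → ℝ} (hh : Continuous h) :
    inner ℝ B (toL2 g hh) = ∫ x, B x * h x ∂riemannianVolume g := by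
  rw [L2.inner_def]
  refine integral_congr_ae ?_
  filter_upwards [coeFn_toL2 (g := g) hh] with x hx
  rw [hx, real_inner_eq_re_inner]
  simp [mul_comm]

theorem inner_toL2_toL2 {f h : M → ℝ} (hf : Continuous f) (hh : Continuous h) :
    inner ℝ (toL2 g hf) (toL2 g hh) = ∫ x, f x * h x ∂riemannianVolume g := by
  rw [inner_toL2]
  refine integral_congr_ae ?_
  filter_upwards [coeFn_toL2 (g := g) hf] with x hx
  rw [hx]

theorem norm_toL2_le (f : EnergySpace g) : ‖toL2 g f.continuous‖ ≤ ‖f‖ := by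
  refine le_of_sq_le_sq ?_ (norm_nonneg _)
  rw [← real_inner_self_eq_norm_sq, inner_toL2_toL2, norm_sq_eq]
  refine integral_mono (integrable_mul f f) ((integrable_mul f f).add (integrable_gradProduct f f))
    fun x => ?_
  have := gradProduct_self_nonneg g f x
  simpa using this

/-- The inclusion of the energy space in `L²`. -/
noncomputable def inclusion (g : SmoothMetric n M) :
    EnergySpace g →L[ℝ] Lp ℝ 2 (riemannianVolume g) :=
  LinearMap.mkContinuous
    { toFun := fun f => toL2 g f.continuous
      map_add' := fun f h => by
        rw [toL2, toL2, toL2, ← map_add]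
        rfl
      map_smul' := fun c f => by
        rw [toL2, toL2, RingHom.id_apply, ← map_smul]
        rfl } 1 fun f => by
    rw [one_mul]
    exact norm_toL2_le f

theorem inclusion_apply (f : EnergySpace g) : inclusion g f = toL2 g f.continuous := rfl

/-- A constant function. -/
noncomputable def const (g : SmoothMetric n M) (c : ℝ) : EnergySpace g := ⟨ContMDiffMap.const c⟩

omit [MeasurableSpace M] [BorelSpace M] [CompactSpace M] [Nonempty M] in
theorem const_apply (c : ℝ) (x : M) : const g c x = c := rfl

/-- Constants have zero gradient. In the abstract setting this identity makes the constant function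
an eigenvector for the extreme eigenvalue, so it can be put first in the list. -/
theorem inner_const (c : ℝ) (f : EnergySpace g) :
    inner ℝ (const g c) f = inner ℝ (inclusion g (const g c)) (inclusion g f) := by
  rw [inclusion_apply, inclusion_apply, inner_toL2_toL2, inner_eq]
  congr 1 with x
  have : gradProduct g (const g c) f x = 0 := gradProduct_const_left g c f x
  rw [this, add_zero]

/-- An element of `L²` orthogonal to all smooth functions vanishes by the fundamental lemma of the
calculus of variations. -/
theorem denseRange_inclusion [T2Space M] (g : SmoothMetric n M) : DenseRange (inclusion g) := by
  have h : (LinearMap.range (inclusion g).toLinearMap).topologicalClosure = ⊤ := by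
    rw [Submodule.topologicalClosure_eq_top_iff, Submodule.eq_bot_iff]
    intro B hB
    rw [Submodule.mem_orthogonal] at hB
    have hint : Integrable B (riemannianVolume g) := (Lp.memLp B).integrable (by norm_num)
    have h0 := ae_eq_zero_of_integral_contMDiff_smul_eq_zero (𝓡 n)
      (μ := riemannianVolume g) hint.locallyIntegrable fun f hf _ => by
        have := hB (inclusion g ⟨⟨f, hf⟩⟩) ⟨_, rfl⟩
        rw [real_inner_comm, inclusion_apply, inner_toL2] at this
        rw [← this]
        congr 1 with x
        rw [smul_eq_mul, mul_comm]
        rfl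
    exact (Lp.eq_zero_iff_ae_eq_zero).2 h0
  have := Submodule.dense_iff_topologicalClosure_eq_top.2 h
  rw [DenseRange]
  convert this
  ext; simp

end EnergySpace

theorem infinite_of_pos_dimension (hn : 0 < n) (M : Type*) [TopologicalSpace M]
    [ChartedSpace (EuclideanSpace ℝ (Fin n)) M] [Nonempty M] : Infinite M := by
  obtain ⟨x⟩ := ‹Nonempty M›
  set e := chartAt 𝔼 x
  have : Nontrivial 𝔼 := by
    have : Nonempty (Fin n) := ⟨⟨0, hn⟩⟩
    infer_instance
  have h1 : (e.target).Infinite := infinite_of_mem_nhds (e x)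
    (e.open_target.mem_nhds (mem_chart_target 𝔼 x))
  have h2 : (e.symm '' e.target).Infinite := h1.image e.symm.injOn
  exact Set.infinite_univ_iff.1 (h2.mono (Set.subset_univ _))

/-- In positive dimension `M` is infinite and contains infinitely many disjoint nonempty open sets,
whose indicators are orthogonal and nonzero. A basis indexed by `ℕ` requires this. -/
theorem not_finiteDimensional_L2 (hn : 0 < n) [MeasurableSpace M] [BorelSpace M] [CompactSpace M]
    [Nonempty M] [T2Space M] (g : SmoothMetric n M) :
    ¬ FiniteDimensional ℝ (Lp ℝ 2 (riemannianVolume g)) := by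
  intro hfin
  have : Infinite M := infinite_of_pos_dimension hn M
  obtain ⟨U, hUi, hUo, hUd⟩ := exists_seq_infinite_isOpen_pairwise_disjoint M
  set v : ℕ → Lp ℝ 2 (riemannianVolume g) := fun k =>
    indicatorConstLp 2 (hUo k).measurableSet (measure_ne_top _ _) (1 : ℝ) with hv
  have hne : ∀ k, v k ≠ 0 := by
    intro k h
    have h1 : ‖v k‖ = 0 := by rw [h, norm_zero]
    rw [hv, norm_indicatorConstLp (by norm_num) (by norm_num), norm_one, one_mul] at h1
    have h2 : 0 < (riemannianVolume g).real (U k) :=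
      ENNReal.toReal_pos ((hUo k).measure_pos _ (hUi k).nonempty).ne' (measure_ne_top _ _)
    exact (Real.rpow_pos_of_pos h2 _).ne' h1
  have horth : Pairwise fun i j => inner ℝ (v i) (v j) = 0 := by
    intro i j hij
    rw [hv]
    simp only
    rw [L2.inner_indicatorConstLp_indicatorConstLp]
    simp [(hUd hij).inter_eq]
  have hli := linearIndependent_of_ne_zero_of_inner_eq_zero hne horth
  exact not_finite_iff_infinite.2 (inferInstance : Infinite ℕ) hli.finite

end Energy

end EigenmapRegistration

/-! ### Compactness of the inclusion of the energy space, and weak eigenfunctions -/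

namespace EigenmapRegistration

section Compactness

variable {n : ℕ} {M : Type*} [TopologicalSpace M] [ChartedSpace (EuclideanSpace ℝ (Fin n)) M]
  [IsManifold (𝓡 n) ∞ M] [MeasurableSpace M] [BorelSpace M] [CompactSpace M] [Nonempty M]

local notation "𝔼" => EuclideanSpace ℝ (Fin n)

omit [TopologicalSpace M] [ChartedSpace (EuclideanSpace ℝ (Fin n)) M] [IsManifold (𝓡 n) ∞ M]
  [MeasurableSpace M] [BorelSpace M] [CompactSpace M] [Nonempty M] in
theorem integrable_sq_of_hasCompactSupport {F : 𝔼 → ℝ} (hF : Continuous F)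
    (hFc : HasCompactSupport F) : Integrable fun u => F u ^ 2 := by
  simp only [sq]
  exact (hF.mul hF).integrable_of_hasCompactSupport hFc.mul_left

theorem integral_mul_chartExtend (g : SmoothMetric n M) {e : OpenPartialHomeomorph M 𝔼}
    (he : e ∈ IsManifold.maximalAtlas (𝓡 n) ∞ M) {f : M → ℝ} {ψ : 𝔼 → ℝ}
    (hf : AEStronglyMeasurable f (riemannianVolume g)) (hψ : Continuous (chartExtend e ψ)) :
    ∫ x, f x * chartExtend e ψ x ∂riemannianVolume g =
      ∫ u in e.target, density g e u * (f (e.symm u) * ψ u) := by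
  rw [← setIntegral_eq_integral_of_forall_compl_eq_zero (s := e.source),
    setIntegral_chart (h := fun x => f x * chartExtend e ψ x) g he
      (hf.mul hψ.aestronglyMeasurable)]
  · refine setIntegral_congr_fun e.open_target.measurableSet fun u hu => ?_
    simp only [chartExtend_symm e ψ hu]
  · intro x hx
    rw [chartExtend_of_notMem e ψ hx, mul_zero]

/-- Dividing by the density turns a Lebesgue integral in a chart into an `L²` pairing on `M`, with a
weight independent of `f`. Localized Fourier coefficients thus become continuous functionals, and
integrals in charts pass to `L²` limits. -/
theorem integral_mul_chartExtend_div_density [T2Space M] (g : SmoothMetric n M)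
    {e : OpenPartialHomeomorph M 𝔼}
    (he : e ∈ IsManifold.maximalAtlas (𝓡 n) ∞ M) {χ : 𝔼 → ℝ} (hχ : ContDiff ℝ ∞ χ)
    (hχc : HasCompactSupport χ) (hχt : tsupport χ ⊆ e.target) :
    ∃ h : M → ℝ, ContMDiff (𝓡 n) 𝓘(ℝ, ℝ) ∞ h ∧
      ∀ f : M → ℝ, AEStronglyMeasurable f (riemannianVolume g) →
        ∫ x, f x * h x ∂riemannianVolume g = ∫ u, χ u * f (e.symm u) := by
  have hw : ContDiff ℝ ∞ (fun u => χ u * (density g e u)⁻¹) :=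
    contDiff_mul_of_tsupport_subset e.open_target hχ hχt
      ((contDiffOn_density g he).inv fun u hu => (density_pos g he hu).ne')
  have hsub : tsupport (fun u => χ u * (density g e u)⁻¹) ⊆ tsupport χ :=
    tsupport_mul_subset_left
  have hh := contMDiff_chartExtend he hw hχc.mul_right (hsub.trans hχt)
  refine ⟨_, hh, fun f hf => ?_⟩
  have hzero : ∀ u ∉ e.target, χ u * f (e.symm u) = 0 := fun u hu => by
    rw [image_eq_zero_of_notMem_tsupport fun h => hu (hχt h), zero_mul]
  rw [integral_mul_chartExtend g he hf hh.continuous,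
    ← setIntegral_eq_integral_of_forall_compl_eq_zero hzero]
  refine setIntegral_congr_fun e.open_target.measurableSet fun u hu => ?_
  have := (density_pos g he hu).ne'
  field_simp

omit [MeasurableSpace M] [BorelSpace M] [CompactSpace M] [Nonempty M] in
-- Product rule and `sq_partialDeriv_le`. The factor is continuous on the target, hence bounded on
-- the support of `χ`, which makes localization bounded from the energy norm to the Euclidean `H¹`
-- norm.
theorem sq_add_sum_sq_partialDeriv_le (g : SmoothMetric n M) {e : OpenPartialHomeomorph M 𝔼}
    (he : e ∈ IsManifold.maximalAtlas (𝓡 n) ∞ M) {χ : 𝔼 → ℝ} (hχ : ContDiff ℝ ∞ χ)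
    (hχ1 : ∀ x, χ x ∈ Set.Icc (0 : ℝ) 1) {f : M → ℝ} (hf : ContMDiff (𝓡 n) 𝓘(ℝ, ℝ) ∞ f)
    {u : 𝔼} (hu : u ∈ e.target) :
    (χ u * f (e.symm u)) ^ 2 +
        ∑ i, partialDeriv i (fun v => χ v * f (e.symm v)) u ^ 2 ≤
      (1 + 2 * ∑ i, (partialDeriv i χ u ^ 2 + gram g e u i i)) *
        (f (e.symm u) ^ 2 + gradProductInChart g e f f u) := by
  have hγ := gradProductInChart_self_nonneg g he f hu
  have hd : DifferentiableAt ℝ (f ∘ e.symm) u :=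
    ((contDiffOn_comp_chart_symm he hf.contMDiffOn).contDiffAt
      (e.open_target.mem_nhds hu)).differentiableAt (by simp)
  have hG : ∀ i, 0 ≤ gram g e u i i := fun i => (gram_posDef g he hu).posSemidef.diag_nonneg
  have h1 : (χ u * f (e.symm u)) ^ 2 ≤ f (e.symm u) ^ 2 + gradProductInChart g e f f u := by
    have h2 : χ u ^ 2 ≤ 1 := pow_le_one₀ (hχ1 u).1 (hχ1 u).2
    rw [mul_pow]
    nlinarith [sq_nonneg (f (e.symm u))]
  have h2 : ∀ i, partialDeriv i (fun v => χ v * f (e.symm v)) u ^ 2 ≤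
      2 * (partialDeriv i χ u ^ 2 + gram g e u i i) *
        (f (e.symm u) ^ 2 + gradProductInChart g e f f u) := by
    intro i
    have h3 : partialDeriv i (fun v => χ v * f (e.symm v)) u =
        χ u * partialDeriv i (f ∘ e.symm) u + partialDeriv i χ u * f (e.symm u) :=
      partialDeriv_mul i (hχ.differentiable (by simp) u) hd
    have h4 := sq_partialDeriv_le g he f hu i
    have h5 : χ u ^ 2 ≤ 1 := pow_le_one₀ (hχ1 u).1 (hχ1 u).2
    have h6 : χ u ^ 2 * partialDeriv i (f ∘ e.symm) u ^ 2 ≤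
        gram g e u i i * gradProductInChart g e f f u :=
      (mul_le_of_le_one_left (sq_nonneg _) h5).trans h4
    rw [h3]
    have h7 := mul_nonneg (sq_nonneg (partialDeriv i χ u)) hγ
    have h8 := mul_nonneg (hG i) (sq_nonneg (f (e.symm u)))
    nlinarith [sq_nonneg (χ u * partialDeriv i (f ∘ e.symm) u - partialDeriv i χ u * f (e.symm u))]
  calc _ ≤ (f (e.symm u) ^ 2 + gradProductInChart g e f f u) +
        ∑ i, 2 * (partialDeriv i χ u ^ 2 + gram g e u i i) *
          (f (e.symm u) ^ 2 + gradProductInChart g e f f u) :=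
        add_le_add h1 (Finset.sum_le_sum fun i _ => h2 i)
    _ = _ := by
        rw [← Finset.sum_mul, ← Finset.mul_sum]
        ring

theorem integral_sq_add_sum_sq_partialDeriv_le (g : SmoothMetric n M)
    {e : OpenPartialHomeomorph M 𝔼}
    (he : e ∈ IsManifold.maximalAtlas (𝓡 n) ∞ M) {χ : 𝔼 → ℝ} (hχ : ContDiff ℝ ∞ χ)
    (hχc : HasCompactSupport χ) (hχt : tsupport χ ⊆ e.target)
    (hχ1 : ∀ x, χ x ∈ Set.Icc (0 : ℝ) 1) :
    ∃ A : ℝ, 0 ≤ A ∧ ∀ f : EnergySpace g,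
      (∫ u, (χ u * f (e.symm u)) ^ 2) +
        ∑ i, ∫ u, partialDeriv i (fun v => χ v * f (e.symm v)) u ^ 2 ≤ A * ‖f‖ ^ 2 := by
  set q : 𝔼 → ℝ := fun u => (1 + 2 * ∑ i, (partialDeriv i χ u ^ 2 + gram g e u i i)) *
    (density g e u)⁻¹
  have hq : ContinuousOn q (tsupport χ) := by
    refine ContinuousOn.mono ?_ hχt
    refine ContinuousOn.mul (continuousOn_const.add (continuousOn_const.mul
      (continuousOn_finsetSum _ fun i _ => ?_)))
      ((contDiffOn_density g he).continuousOn.inv₀ fun u hu => (density_pos g he hu).ne')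
    exact ((contDiff_partialDeriv i hχ).continuous.pow 2).continuousOn.add
      (contDiffOn_gram g he i i).continuousOn
  obtain ⟨A, hA⟩ := hχc.isCompact.bddAbove_image hq
  refine ⟨max A 0, le_max_right _ _, fun f => ?_⟩
  have hF : ContDiff ℝ ∞ (fun v => χ v * f (e.symm v)) :=
    contDiff_mul_of_tsupport_subset e.open_target hχ hχt
      (contDiffOn_comp_chart_symm he f.contMDiff.contMDiffOn)
  have hFc : HasCompactSupport (fun v => χ v * f (e.symm v)) := hχc.mul_right
  have hFt : tsupport (fun v => χ v * f (e.symm v)) ⊆ tsupport χ := tsupport_mul_subset_left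
  have hpi : ∀ i, Integrable fun u => partialDeriv i (fun v => χ v * f (e.symm v)) u ^ 2 := by
    intro i
    exact integrable_sq_of_hasCompactSupport (contDiff_partialDeriv i hF).continuous
      (IsCompact.of_isClosed_subset hFc isClosed_closure (tsupport_partialDeriv_subset _ i))
  have hF2 : Integrable fun u => (χ u * f (e.symm u)) ^ 2 :=
    integrable_sq_of_hasCompactSupport hF.continuous hFc
  have hm : AEStronglyMeasurable (fun x => f x * f x + gradProduct g f f x) (riemannianVolume g) :=
    ((EnergySpace.integrable_mul f f).add
      (EnergySpace.integrable_gradProduct f f)).aestronglyMeasurable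
  have hint : Integrable (fun x => f x * f x + gradProduct g f f x) (riemannianVolume g) :=
    (EnergySpace.integrable_mul f f).add (EnergySpace.integrable_gradProduct f f)
  have hnn : ∀ x, 0 ≤ f x * f x + gradProduct g f f x := fun x =>
    add_nonneg (mul_self_nonneg _) (gradProduct_self_nonneg g f x)
  rw [← integral_finsetSum _ fun i _ => hpi i,
    ← integral_add hF2 (integrable_finsetSum _ fun i _ => hpi i)]
  have hzero : ∀ u ∉ e.target, (χ u * f (e.symm u)) ^ 2 +
      ∑ i, partialDeriv i (fun v => χ v * f (e.symm v)) u ^ 2 = 0 := by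
    intro u hu
    have h1 : χ u = 0 := image_eq_zero_of_notMem_tsupport fun h => hu (hχt h)
    have h2 : ∀ i, partialDeriv i (fun v => χ v * f (e.symm v)) u = 0 := fun i =>
      image_eq_zero_of_notMem_tsupport fun h =>
        hu (hχt (hFt (tsupport_partialDeriv_subset _ i h)))
    simp [h1, h2]
  rw [← setIntegral_eq_integral_of_forall_compl_eq_zero hzero]
  calc _ ≤ ∫ u in e.target, max A 0 * (density g e u *
        (f (e.symm u) * f (e.symm u) + gradProduct g f f (e.symm u))) := by
        refine setIntegral_mono_on (hF2.add (integrable_finsetSum _ fun i _ => hpi i)).integrableOn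
          (((integrableOn_chart_iff g he hm).1 hint.integrableOn).const_mul _)
          e.open_target.measurableSet fun u hu => ?_
        have hρ := density_pos g he hu
        have hE : 0 ≤ density g e u *
          (f (e.symm u) * f (e.symm u) + gradProduct g f f (e.symm u)) :=
          mul_nonneg hρ.le (hnn _)
        by_cases hus : u ∈ tsupport χ
        · refine (sq_add_sum_sq_partialDeriv_le g he hχ hχ1 f.contMDiff hu).trans ?_
          have h1 : q u ≤ max A 0 := (hA ⟨u, hus, rfl⟩).trans (le_max_left _ _)
          refine le_trans (le_of_eq ?_) (mul_le_mul_of_nonneg_right h1 hE)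
          rw [gradProduct_chart g he f.contMDiff f.contMDiff hu]
          simp only [q]
          field_simp
        · have h1 : χ u = 0 := image_eq_zero_of_notMem_tsupport hus
          have h2 : ∀ i, partialDeriv i (fun v => χ v * f (e.symm v)) u = 0 := fun i =>
            image_eq_zero_of_notMem_tsupport fun h =>
              hus (hFt (tsupport_partialDeriv_subset _ i h))
          simp only [h1, h2]
          simpa using mul_nonneg (le_max_right A 0) hE
    _ = max A 0 * ∫ x in e.source, (f x * f x + gradProduct g f f x) ∂riemannianVolume g := by
        rw [integral_const_mul, setIntegral_chart g he hm]
    _ ≤ max A 0 * ‖f‖ ^ 2 := by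
        refine mul_le_mul_of_nonneg_left ?_ (le_max_right _ _)
        rw [EnergySpace.norm_sq_eq]
        exact setIntegral_le_integral hint (Filter.Eventually.of_forall hnn)

theorem exists_functionals_setIntegral_sq_le [T2Space M] (g : SmoothMetric n M)
    {e : OpenPartialHomeomorph M 𝔼} (he : e ∈ IsManifold.maximalAtlas (𝓡 n) ∞ M) {K : Set 𝔼}
    (hK : IsCompact K) (hKt : K ⊆ e.target) {ε : ℝ} (hε : 0 < ε) :
    ∃ (κ : Type) (_ : Fintype κ) (l : κ → EnergySpace g →L[ℝ] ℝ), ∀ f : EnergySpace g,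
      ∫ u in K, density g e u * f (e.symm u) ^ 2 ≤ ∑ k, l k f ^ 2 + ε * ‖f‖ ^ 2 := by
  obtain ⟨χ, hχ, hχc, hχt, hχK, hχ1⟩ := exists_cutoff hK e.open_target hKt
  obtain ⟨A, hA0, hA⟩ := integral_sq_add_sum_sq_partialDeriv_le g he hχ hχc hχt hχ1
  obtain ⟨R, hR⟩ := hK.bddAbove_image ((contDiffOn_density g he).continuousOn.mono hKt)
  set R' := max R 1
  have hR' : 0 < R' := lt_of_lt_of_le one_pos (le_max_right _ _)
  -- The constant `A` is the cost of localization and `R'` bounds the density on `K`; `A + 1` avoids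
  -- division by zero.
  obtain ⟨S, C, hC, hS⟩ := exists_frequencies_integral_sq_le hχc.isCompact
    (ε := ε / (R' * (A + 1))) (by positivity)
  -- The factor `√(R' * C)` is absorbed in the functionals, so that their squares carry the constant
  -- of the Euclidean estimate.
  have hfun : ∀ w : 𝔼 → ℝ, ContDiff ℝ ∞ w → ∃ l : EnergySpace g →L[ℝ] ℝ, ∀ f : EnergySpace g,
      l f = √(R' * C) * ∫ u, χ u * f (e.symm u) * w u := by
    intro w hw
    obtain ⟨h, hh, hhi⟩ := integral_mul_chartExtend_div_density g he (χ := fun u => χ u * w u)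
      (hχ.mul hw) hχc.mul_right (tsupport_mul_subset_left.trans hχt)
    refine ⟨√(R' * C) • (innerSL ℝ (EnergySpace.toL2 g hh.continuous) ∘L EnergySpace.inclusion g),
      fun f => ?_⟩
    have h1 : inner ℝ (EnergySpace.toL2 g hh.continuous) (EnergySpace.inclusion g f) =
        ∫ u, χ u * f (e.symm u) * w u := by
      rw [real_inner_comm, EnergySpace.inclusion_apply, EnergySpace.inner_toL2_toL2,
        hhi f f.continuous.aestronglyMeasurable]
      congr 1 with u
      ring
    rw [← h1]
    rfl
  have hcos : ∀ ξ : 𝔼, ContDiff ℝ ∞ fun x : 𝔼 => Real.cos (2 * Real.pi * inner ℝ x ξ) := fun ξ =>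
    Real.contDiff_cos.comp (contDiff_const.mul (contDiff_id.inner ℝ contDiff_const))
  have hsin : ∀ ξ : 𝔼, ContDiff ℝ ∞ fun x : 𝔼 => Real.sin (2 * Real.pi * inner ℝ x ξ) := fun ξ =>
    Real.contDiff_sin.comp (contDiff_const.mul (contDiff_id.inner ℝ contDiff_const))
  choose lc hlc using fun ξ => hfun _ (hcos ξ)
  choose ls hls using fun ξ => hfun _ (hsin ξ)
  refine ⟨S ⊕ S, inferInstance, Sum.elim (fun ξ => lc ξ) (fun ξ => ls ξ), fun f => ?_⟩
  have hF : ContDiff ℝ ∞ (fun v => χ v * f (e.symm v)) :=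
    contDiff_mul_of_tsupport_subset e.open_target hχ hχt
      (contDiffOn_comp_chart_symm he f.contMDiff.contMDiffOn)
  have hFc : HasCompactSupport (fun v => χ v * f (e.symm v)) := hχc.mul_right
  have hF2 : Integrable fun u => (χ u * f (e.symm u)) ^ 2 :=
    integrable_sq_of_hasCompactSupport hF.continuous hFc
  have h1 : ∫ u in K, density g e u * f (e.symm u) ^ 2 ≤ R' * ∫ u, (χ u * f (e.symm u)) ^ 2 := by
    have hcont : ContinuousOn (fun u => density g e u * f (e.symm u) ^ 2) K :=
      ((contDiffOn_density g he).continuousOn.mono hKt).mul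
        (((contDiffOn_comp_chart_symm he f.contMDiff.contMDiffOn).continuousOn.mono hKt).pow 2)
    calc _ ≤ ∫ u in K, R' * (χ u * f (e.symm u)) ^ 2 := by
          refine setIntegral_mono_on (hcont.integrableOn_compact hK) (hF2.const_mul _).integrableOn
            hK.measurableSet fun u hu => ?_
          rw [hχK.self_of_nhdsSet u hu, one_mul]
          exact mul_le_mul_of_nonneg_right ((hR ⟨u, hu, rfl⟩).trans (le_max_left _ _)) (sq_nonneg _)
      _ ≤ ∫ u, R' * (χ u * f (e.symm u)) ^ 2 :=
          setIntegral_le_integral (hF2.const_mul _)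
            (Filter.Eventually.of_forall fun u => by positivity)
      _ = _ := integral_const_mul _ _
  have h2 := hS _ hF fun x hx => by rw [image_eq_zero_of_notMem_tsupport hx, zero_mul]
  have h3 := hA f
  have h4 : R' * (ε / (R' * (A + 1)) * (A * ‖f‖ ^ 2)) ≤ ε * ‖f‖ ^ 2 := by
    have h5 : R' * (ε / (R' * (A + 1)) * (A * ‖f‖ ^ 2)) = (A / (A + 1)) * (ε * ‖f‖ ^ 2) := by
      field_simp
    rw [h5]
    exact mul_le_of_le_one_left (by positivity) ((div_le_one (by positivity)).2 (by linarith))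
  have hsum : ∑ k, (Sum.elim (fun ξ : S => lc ξ) (fun ξ : S => ls ξ) k) f ^ 2 =
      R' * (C * ∑ ξ ∈ S, ((∫ x, χ x * f (e.symm x) * Real.cos (2 * Real.pi * inner ℝ x ξ)) ^ 2 +
        (∫ x, χ x * f (e.symm x) * Real.sin (2 * Real.pi * inner ℝ x ξ)) ^ 2)) := by
    rw [Fintype.sum_sum_type]
    simp only [Sum.elim_inl, Sum.elim_inr, hlc, hls, mul_pow, Real.sq_sqrt (mul_nonneg hR'.le hC)]
    rw [Finset.sum_coe_sort S (fun ξ => R' * C *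
      (∫ x, χ x * f (e.symm x) * Real.cos (2 * Real.pi * inner ℝ x ξ)) ^ 2),
      Finset.sum_coe_sort S (fun ξ => R' * C *
      (∫ x, χ x * f (e.symm x) * Real.sin (2 * Real.pi * inner ℝ x ξ)) ^ 2),
      ← Finset.sum_add_distrib, ← mul_assoc, Finset.mul_sum]
    exact Finset.sum_congr rfl fun ξ _ => by ring
  rw [hsum]
  refine h1.trans ((mul_le_mul_of_nonneg_left (h2.trans (add_le_add_right
    (mul_le_mul_of_nonneg_left h3 (by positivity)) _)) hR'.le).trans ?_)
  rw [mul_add]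
  exact add_le_add_right h4 _

theorem exists_functionals_norm_sq_inclusion_le [T2Space M] (g : SmoothMetric n M) {ε : ℝ}
    (hε : 0 < ε) :
    ∃ (κ : Type) (_ : Fintype κ) (l : κ → EnergySpace g →L[ℝ] ℝ), ∀ f : EnergySpace g,
      ‖EnergySpace.inclusion g f‖ ^ 2 ≤ ∑ k, l k f ^ 2 + ε * ‖f‖ ^ 2 := by
  have hK : ∀ x : M, ∃ K, IsCompact K ∧ chartAt 𝔼 x x ∈ interior K ∧ K ⊆ (chartAt 𝔼 x).target :=
    fun x => exists_compact_subset (chartAt 𝔼 x).open_target (mem_chart_target 𝔼 x)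
  choose K hKc hxK hKt using hK
  set O : M → Set M := fun x => (chartAt 𝔼 x).source ∩ (chartAt 𝔼 x) ⁻¹' interior (K x)
  have hO : ∀ x, IsOpen (O x) := fun x => (chartAt 𝔼 x).isOpen_inter_preimage isOpen_interior
  obtain ⟨t, ht⟩ := CompactSpace.elim_nhds_subcover O
    fun x => (hO x).mem_nhds ⟨mem_chart_source 𝔼 x, hxK x⟩
  have hδ : 0 < ε / (t.card + 1) := by positivity
  choose κ hκ l hl using fun x => exists_functionals_setIntegral_sq_le g
    (IsManifold.chart_mem_maximalAtlas x) (hKc x) (hKt x) hδ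
  -- The charts are numbered by `Fin t.card` because the index type must lie in `Type`, while `M`
  -- may live in a higher universe.
  refine ⟨(k : Fin t.card) × κ (t.equivFin.symm k), inferInstance,
    fun p => l (t.equivFin.symm p.1) p.2, fun f => ?_⟩
  have h1 : ∀ c : M, ∫ x, (O c).indicator (fun x => f x * f x) x ∂riemannianVolume g ≤
      ∫ u in K c, density g (chartAt 𝔼 c) u * f ((chartAt 𝔼 c).symm u) ^ 2 := by
    intro c
    set e := chartAt 𝔼 c
    have he : e ∈ IsManifold.maximalAtlas (𝓡 n) ∞ M := IsManifold.chart_mem_maximalAtlas c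
    have hcont : ContinuousOn (fun u => density g e u * f (e.symm u) ^ 2) (K c) :=
      ((contDiffOn_density g he).continuousOn.mono (hKt c)).mul
        (((contDiffOn_comp_chart_symm he f.contMDiff.contMDiffOn).continuousOn.mono (hKt c)).pow 2)
    have hi : Integrable ((O c).indicator fun x => f x * f x) (riemannianVolume g) :=
      (EnergySpace.integrable_mul f f).indicator (hO c).measurableSet
    rw [← setIntegral_eq_integral_of_forall_compl_eq_zero (s := e.source), setIntegral_chart g he
      hi.aestronglyMeasurable]
    · have hKi : ∫ u in K c, density g e u * f (e.symm u) ^ 2 =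
          ∫ u in e.target, (K c).indicator (fun u => density g e u * f (e.symm u) ^ 2) u := by
        rw [setIntegral_indicator (hKc c).measurableSet, Set.inter_eq_right.2 (hKt c)]
      rw [hKi]
      refine setIntegral_mono_on ((integrableOn_chart_iff g he hi.aestronglyMeasurable).1
        hi.integrableOn) (((hcont.integrableOn_compact (hKc c)).integrable_indicator
        (hKc c).measurableSet).integrableOn) e.open_target.measurableSet fun u hu => ?_
      by_cases hO' : e.symm u ∈ O c
      · have huK : u ∈ K c := by
          have := hO'.2
          rw [Set.mem_preimage, e.right_inv hu] at this
          exact interior_subset this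
        rw [Set.indicator_of_mem hO', Set.indicator_of_mem huK, sq]
      · rw [Set.indicator_of_notMem hO', mul_zero]
        exact Set.indicator_nonneg (fun v hv =>
          mul_nonneg (density_pos g he (hKt c hv)).le (sq_nonneg _)) u
    · intro x hx
      exact Set.indicator_of_notMem (fun h => hx h.1) _
  have h2 : ‖EnergySpace.inclusion g f‖ ^ 2 ≤
      ∑ c ∈ t, ∫ u in K c, density g (chartAt 𝔼 c) u * f ((chartAt 𝔼 c).symm u) ^ 2 := by
    rw [← real_inner_self_eq_norm_sq, EnergySpace.inclusion_apply, EnergySpace.inner_toL2_toL2]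
    refine le_trans ?_ (Finset.sum_le_sum fun c _ => h1 c)
    rw [← integral_finsetSum _ fun c _ =>
      (EnergySpace.integrable_mul f f).indicator (hO c).measurableSet]
    refine integral_mono (EnergySpace.integrable_mul f f) (integrable_finsetSum _ fun c _ =>
      (EnergySpace.integrable_mul f f).indicator (hO c).measurableSet) fun x => ?_
    have hx : x ∈ ⋃ c ∈ t, O c := by rw [ht]; trivial
    simp only [Set.mem_iUnion] at hx
    obtain ⟨c, hct, hxc⟩ := hx
    have := Finset.single_le_sum (f := fun c => (O c).indicator (fun x => f x * f x) x)
      (fun c _ => Set.indicator_nonneg (fun y _ => mul_self_nonneg _) x) hct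
    simp only [Set.indicator_of_mem hxc] at this
    exact this
  refine h2.trans ?_
  rw [Fintype.sum_sigma]
  have h3 : ∑ c ∈ t, ∫ u in K c, density g (chartAt 𝔼 c) u * f ((chartAt 𝔼 c).symm u) ^ 2 ≤
      ∑ c ∈ t, (∑ k, l c k f ^ 2 + ε / (t.card + 1) * ‖f‖ ^ 2) :=
    Finset.sum_le_sum fun c _ => hl c f
  refine h3.trans ?_
  rw [Finset.sum_add_distrib, Finset.sum_const, nsmul_eq_mul]
  refine add_le_add (le_of_eq ?_) ?_
  · rw [← Finset.sum_coe_sort]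
    exact (Equiv.sum_comp t.equivFin.symm fun c : t => ∑ k, l c k f ^ 2).symm
  · have : (t.card : ℝ) * (ε / (t.card + 1) * ‖f‖ ^ 2) =
        ((t.card : ℝ) / (t.card + 1)) * (ε * ‖f‖ ^ 2) := by
      field_simp
    rw [this]
    exact mul_le_of_le_one_left (by positivity) ((div_le_one (by positivity)).2 (by linarith))

theorem exists_weak_eigenfunctions (hn : 0 < n) [T2Space M] (g : SmoothMetric n M) :
    ∃ (B : HilbertBasis ℕ ℝ (Lp ℝ 2 (riemannianVolume g))) (ν : ℕ → ℝ), Monotone ν ∧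
      (B 0 =ᵐ[riemannianVolume g] fun _ => 1 / √((riemannianVolume g).real Set.univ)) ∧
      ∀ j, ∃ w : ℕ → EnergySpace g,
        Filter.Tendsto (fun k => EnergySpace.inclusion g (w k)) Filter.atTop (𝓝 (B j)) ∧
        ∀ f : EnergySpace g, Filter.Tendsto (fun k => inner ℝ (w k) f) Filter.atTop
          (𝓝 (ν j * ∫ x, B j x * f x ∂riemannianVolume g)) := by
  set c := 1 / √((riemannianVolume g).real Set.univ) with hc
  have hV : 0 < (riemannianVolume g).real Set.univ :=
    ENNReal.toReal_pos (isOpen_univ.measure_pos _ Set.univ_nonempty).ne' (measure_ne_top _ _)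
  have ho1 : ‖EnergySpace.inclusion g (EnergySpace.const g c)‖ = 1 := by
    have h1 : ‖EnergySpace.inclusion g (EnergySpace.const g c)‖ ^ 2 = 1 := by
      rw [← real_inner_self_eq_norm_sq, EnergySpace.inclusion_apply, EnergySpace.inner_toL2_toL2]
      simp only [EnergySpace.const_apply]
      rw [integral_const, smul_eq_mul, hc, div_mul_div_comm, one_mul, Real.mul_self_sqrt hV.le]
      field_simp
    nlinarith [norm_nonneg (EnergySpace.inclusion g (EnergySpace.const g c))]
  obtain ⟨B, ν, hν, hB0, hB⟩ := exists_weak_eigenbasis (not_finiteDimensional_L2 hn g)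
    (EnergySpace.inclusion g) EnergySpace.norm_toL2_le (EnergySpace.denseRange_inclusion g)
    (fun ε hε => exists_functionals_norm_sq_inclusion_le g hε) (EnergySpace.const g c)
    (EnergySpace.inner_const c) ho1
  refine ⟨B, ν, hν, ?_, fun j => ?_⟩
  · rw [hB0]
    exact EnergySpace.coeFn_toL2 _
  · obtain ⟨w, hw, hwf⟩ := hB j
    refine ⟨w, hw, fun f => ?_⟩
    have := hwf f
    rwa [EnergySpace.inclusion_apply, EnergySpace.inner_toL2] at this

end Compactness

end EigenmapRegistration

/-! ### Integration by parts and the weak equation in a chart -/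

namespace EigenmapRegistration

section IntegrationByParts

variable {n : ℕ}

local notation "𝔼" => EuclideanSpace ℝ (Fin n)

theorem partialDeriv_eq_zero_of_notMem_tsupport {ψ : 𝔼 → ℝ} {u : 𝔼} (hu : u ∉ tsupport ψ)
    (i : Fin n) : partialDeriv i ψ u = 0 :=
  image_eq_zero_of_notMem_tsupport fun h => hu (tsupport_partialDeriv_subset ψ i h)

theorem integral_mul_partialDeriv {Ω : Set 𝔼} (hΩ : IsOpen Ω) {P ψ : 𝔼 → ℝ}
    (hP : ContDiffOn ℝ ∞ P Ω) (hψ : ContDiff ℝ ∞ ψ) (hψc : HasCompactSupport ψ)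
    (hψΩ : tsupport ψ ⊆ Ω) (i : Fin n) :
    ∫ u, P u * partialDeriv i ψ u = -∫ u, partialDeriv i P u * ψ u := by
  -- `P` is smooth only on `Ω`. It is replaced by `ζ P`, which equals `P` near the support of `ψ`
  -- and has compact support.
  obtain ⟨ζ, hζ, hζc, hζΩ, hζ1, -⟩ := exists_cutoff hψc.isCompact hΩ hψΩ
  have hW : ContDiff ℝ ∞ fun u => ζ u * P u := contDiff_mul_of_tsupport_subset hΩ hζ hζΩ hP
  have hWc : HasCompactSupport fun u => ζ u * P u := hζc.mul_right
  have hev : ∀ u ∈ tsupport ψ, (fun u => ζ u * P u) =ᶠ[𝓝 u] P := fun u hu => by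
    filter_upwards [(eventually_nhdsSet_iff_forall.1 hζ1) u hu] with v hv
    rw [hv, one_mul]
  have h1 : ∀ u, P u * partialDeriv i ψ u = (ζ u * P u) * partialDeriv i ψ u := fun u => by
    by_cases hu : u ∈ tsupport ψ
    · rw [show ζ u * P u = P u from (hev u hu).self_of_nhds]
    · rw [partialDeriv_eq_zero_of_notMem_tsupport hu, mul_zero, mul_zero]
  have h2 : ∀ u, partialDeriv i P u * ψ u = partialDeriv i (fun u => ζ u * P u) u * ψ u := fun u => by
    by_cases hu : u ∈ tsupport ψ
    · rw [partialDeriv_congr i (hev u hu)]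
    · rw [image_eq_zero_of_notMem_tsupport hu, mul_zero, mul_zero]
  simp only [h1, h2]
  refine integral_mul_fderiv_eq_neg_fderiv_mul_of_integrable ?_ ?_ ?_
    (fun u _ => hW.differentiable (by simp) u) (fun u _ => hψ.differentiable (by simp) u)
  · exact ((contDiff_partialDeriv i hW).continuous.mul
      hψ.continuous).integrable_of_hasCompactSupport hψc.mul_left
  · exact (hW.continuous.mul
      (contDiff_partialDeriv i hψ).continuous).integrable_of_hasCompactSupport hWc.mul_right
  · exact (hW.continuous.mul hψ.continuous).integrable_of_hasCompactSupport hψc.mul_left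

theorem contDiff_sum_mul_partialDeriv {Ω : Set 𝔼} (hΩ : IsOpen Ω) {a : Fin n → 𝔼 → ℝ}
    (ha : ∀ j, ContDiffOn ℝ ∞ (a j) Ω) {ψ : 𝔼 → ℝ} (hψ : ContDiff ℝ ∞ ψ) (hψΩ : tsupport ψ ⊆ Ω) :
    ContDiff ℝ ∞ fun u => ∑ j, a j u * partialDeriv j ψ u := by
  refine ContDiff.sum fun j _ => ?_
  simp only [mul_comm (a j _)]
  exact contDiff_mul_of_tsupport_subset hΩ (contDiff_partialDeriv j hψ)
    ((tsupport_partialDeriv_subset ψ j).trans hψΩ) (ha j)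

theorem tsupport_sum_mul_partialDeriv_subset (a : Fin n → 𝔼 → ℝ) (ψ : 𝔼 → ℝ) :
    tsupport (fun u => ∑ j, a j u * partialDeriv j ψ u) ⊆ tsupport ψ := by
  refine closure_minimal (fun u hu => ?_) isClosed_closure
  by_contra h
  exact hu (Finset.sum_eq_zero fun j _ => by
    rw [partialDeriv_eq_zero_of_notMem_tsupport h, mul_zero])

theorem contDiff_divFormOp {Ω : Set 𝔼} (hΩ : IsOpen Ω) {a : Fin n → Fin n → 𝔼 → ℝ} {c : 𝔼 → ℝ}
    (ha : ∀ i j, ContDiffOn ℝ ∞ (a i j) Ω) (hc : ContDiffOn ℝ ∞ c Ω) {ψ : 𝔼 → ℝ}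
    (hψ : ContDiff ℝ ∞ ψ) (hψΩ : tsupport ψ ⊆ Ω) : ContDiff ℝ ∞ (divFormOp a c ψ) := by
  unfold divFormOp
  refine (ContDiff.sum fun i _ => contDiff_partialDeriv i
    (contDiff_sum_mul_partialDeriv hΩ (ha i) hψ hψΩ)).add ?_
  simp only [mul_comm (c _)]
  exact contDiff_mul_of_tsupport_subset hΩ hψ hψΩ hc

theorem tsupport_divFormOp_subset (a : Fin n → Fin n → 𝔼 → ℝ) (c ψ : 𝔼 → ℝ) :
    tsupport (divFormOp a c ψ) ⊆ tsupport ψ := by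
  refine closure_minimal (fun u hu => ?_) isClosed_closure
  by_contra h
  refine hu ?_
  rw [divFormOp, image_eq_zero_of_notMem_tsupport h, mul_zero, add_zero]
  exact Finset.sum_eq_zero fun i _ => partialDeriv_eq_zero_of_notMem_tsupport
    (fun h' => h (tsupport_sum_mul_partialDeriv_subset _ _ h')) i

end IntegrationByParts

section WeakEquation

variable {n : ℕ} {M : Type*} [TopologicalSpace M] [ChartedSpace (EuclideanSpace ℝ (Fin n)) M]
  [IsManifold (𝓡 n) ∞ M]

local notation "𝔼" => EuclideanSpace ℝ (Fin n)

/-- The coefficients `√(det g) gⁱʲ` of the Laplacian in divergence form. -/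
noncomputable def laplaceCoeff (g : SmoothMetric n M) (e : OpenPartialHomeomorph M 𝔼)
    (i j : Fin n) (u : 𝔼) : ℝ :=
  density g e u * (gram g e u)⁻¹ i j

theorem contDiffOn_laplaceCoeff (g : SmoothMetric n M) {e : OpenPartialHomeomorph M 𝔼}
    (he : e ∈ IsManifold.maximalAtlas (𝓡 n) ∞ M) (i j : Fin n) :
    ContDiffOn ℝ ∞ (laplaceCoeff g e i j) e.target :=
  (contDiffOn_density g he).mul (contDiffOn_gram_inv g he i j)

theorem laplaceCoeff_pos (g : SmoothMetric n M) {e : OpenPartialHomeomorph M 𝔼}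
    (he : e ∈ IsManifold.maximalAtlas (𝓡 n) ∞ M) {u : 𝔼} (hu : u ∈ e.target) {θ : 𝔼}
    (hθ : θ ≠ 0) : 0 < ∑ i, ∑ j, laplaceCoeff g e i j u * (θ i * θ j) := by
  have h := (gram_posDef g he hu).inv.dotProduct_mulVec_pos (x := θ.ofLp) (by simpa using hθ)
  have h2 := mul_pos (density_pos g he hu) h
  simp only [star_trivial, dotProduct, Matrix.mulVec, Finset.mul_sum] at h2
  refine h2.trans_eq (Finset.sum_congr rfl fun i _ => Finset.sum_congr rfl fun j _ => ?_)
  rw [laplaceCoeff]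
  ring

theorem density_mul_gradProductInChart (g : SmoothMetric n M) (e : OpenPartialHomeomorph M 𝔼)
    (f h : M → ℝ) (u : 𝔼) : density g e u * gradProductInChart g e f h u =
      ∑ i, partialDeriv i (f ∘ e.symm) u *
        ∑ j, laplaceCoeff g e i j u * partialDeriv j (h ∘ e.symm) u := by
  simp only [gradProductInChart, dotProduct, Matrix.mulVec, differentialInChart, laplaceCoeff,
    Finset.mul_sum]
  refine Finset.sum_congr rfl fun i _ => Finset.sum_congr rfl fun j _ => by ring

theorem gradProduct_eq_zero_of_eventuallyEq (g : SmoothMetric n M) (w : M → ℝ) {f : M → ℝ} {x : M}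
    (hf : f =ᶠ[𝓝 x] fun _ => 0) : gradProduct g w f x = 0 := by
  rw [gradProduct_comm]
  have h1 : f ∘ (chartAt 𝔼 x).symm =ᶠ[𝓝 (chartAt 𝔼 x x)] fun _ => 0 := by
    have h2 := (chartAt 𝔼 x).continuousAt_symm (mem_chart_target 𝔼 x)
    rw [ContinuousAt, (chartAt 𝔼 x).left_inv (mem_chart_source 𝔼 x)] at h2
    exact h2.eventually hf
  have : differentialInChart (chartAt 𝔼 x) f (chartAt 𝔼 x x) = 0 := by
    ext i
    rw [differentialInChart, partialDeriv_congr i h1]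
    simp [partialDeriv]
  rw [gradProduct, gradProductInChart, this, zero_dotProduct]

variable [MeasurableSpace M] [BorelSpace M] [CompactSpace M] [Nonempty M] [T2Space M]

/-- A compactly supported test function in a chart, as an element of the energy space. -/
noncomputable def EnergySpace.ofChart (g : SmoothMetric n M) {e : OpenPartialHomeomorph M 𝔼}
    (he : e ∈ IsManifold.maximalAtlas (𝓡 n) ∞ M) {ψ : 𝔼 → ℝ} (hψ : ContDiff ℝ ∞ ψ)
    (hc : HasCompactSupport ψ) (ht : tsupport ψ ⊆ e.target) : EnergySpace g :=
  ⟨⟨chartExtend e ψ, contMDiff_chartExtend he hψ hc ht⟩⟩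

theorem integral_mul_ofChart (g : SmoothMetric n M) {e : OpenPartialHomeomorph M 𝔼}
    (he : e ∈ IsManifold.maximalAtlas (𝓡 n) ∞ M) {ψ : 𝔼 → ℝ} (hψ : ContDiff ℝ ∞ ψ)
    (hc : HasCompactSupport ψ) (ht : tsupport ψ ⊆ e.target) {f : M → ℝ}
    (hf : AEStronglyMeasurable f (riemannianVolume g)) :
    ∫ x, f x * EnergySpace.ofChart g he hψ hc ht x ∂riemannianVolume g =
      ∫ u, f (e.symm u) * (density g e u * ψ u) := by
  have hzero : ∀ u ∉ e.target, f (e.symm u) * (density g e u * ψ u) = 0 := fun u hu => by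
    rw [image_eq_zero_of_notMem_tsupport fun h => hu (ht h), mul_zero, mul_zero]
  rw [← setIntegral_eq_integral_of_forall_compl_eq_zero hzero]
  refine (integral_mul_chartExtend g he hf (EnergySpace.ofChart g he hψ hc ht).continuous).trans ?_
  congr 1 with u
  ring

theorem inner_ofChart (g : SmoothMetric n M) {e : OpenPartialHomeomorph M 𝔼}
    (he : e ∈ IsManifold.maximalAtlas (𝓡 n) ∞ M) {ψ : 𝔼 → ℝ} (hψ : ContDiff ℝ ∞ ψ)
    (hc : HasCompactSupport ψ) (ht : tsupport ψ ⊆ e.target) (w : EnergySpace g) :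
    inner ℝ w (EnergySpace.ofChart g he hψ hc ht) =
      (∫ x, w x * EnergySpace.ofChart g he hψ hc ht x ∂riemannianVolume g) +
        ∫ u, ∑ i, partialDeriv i (w ∘ e.symm) u *
          ∑ j, laplaceCoeff g e i j u * partialDeriv j ψ u := by
  set F := EnergySpace.ofChart g he hψ hc ht
  rw [EnergySpace.inner_eq, integral_add (EnergySpace.integrable_mul w F)
    (EnergySpace.integrable_gradProduct w F)]
  congr 1
  have hz : ∀ x ∉ e.source, gradProduct g w F x = 0 := fun x hx =>
    gradProduct_eq_zero_of_eventuallyEq g w (chartExtend_eventuallyEq_zero e hc ht hx)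
  have hz' : ∀ u ∉ e.target, ∑ i, partialDeriv i (w ∘ e.symm) u *
      ∑ j, laplaceCoeff g e i j u * partialDeriv j ψ u = 0 := fun u hu =>
    Finset.sum_eq_zero fun i _ => by
      rw [Finset.sum_eq_zero fun j _ => by
        rw [partialDeriv_eq_zero_of_notMem_tsupport fun h => hu (ht h), mul_zero], mul_zero]
  rw [← setIntegral_eq_integral_of_forall_compl_eq_zero hz,
    ← setIntegral_eq_integral_of_forall_compl_eq_zero hz',
    setIntegral_chart g he (EnergySpace.integrable_gradProduct w F).aestronglyMeasurable]
  refine setIntegral_congr_fun e.open_target.measurableSet fun u hu => ?_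
  rw [gradProduct_chart g he w.contMDiff F.contMDiff hu, density_mul_gradProductInChart]
  have hev : F ∘ e.symm =ᶠ[𝓝 u] ψ := by
    filter_upwards [e.open_target.mem_nhds hu] with v hv
    exact chartExtend_symm e ψ hv
  refine Finset.sum_congr rfl fun i _ => ?_
  congr 1
  exact Finset.sum_congr rfl fun j _ => by rw [partialDeriv_congr j hev]

/-- All derivatives are moved to the test function, so the right side depends on `w` only through
`L²` pairings and passes to limits. -/
theorem inner_ofChart_eq_neg_integral_divFormOp (g : SmoothMetric n M)
    {e : OpenPartialHomeomorph M 𝔼}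
    (he : e ∈ IsManifold.maximalAtlas (𝓡 n) ∞ M) {ψ : 𝔼 → ℝ} (hψ : ContDiff ℝ ∞ ψ)
    (hc : HasCompactSupport ψ) (ht : tsupport ψ ⊆ e.target) (w : EnergySpace g) :
    inner ℝ w (EnergySpace.ofChart g he hψ hc ht) =
      (∫ x, w x * EnergySpace.ofChart g he hψ hc ht x ∂riemannianVolume g) -
        ∫ u, w (e.symm u) * divFormOp (laplaceCoeff g e) (fun _ => 0) ψ u := by
  rw [inner_ofChart, sub_eq_add_neg]
  congr 1
  have hw := contDiffOn_comp_chart_symm he w.contMDiff.contMDiffOn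
  set X : Fin n → 𝔼 → ℝ := fun i u => ∑ j, laplaceCoeff g e i j u * partialDeriv j ψ u
  have hX : ∀ i, ContDiff ℝ ∞ (X i) := fun i =>
    contDiff_sum_mul_partialDeriv e.open_target (contDiffOn_laplaceCoeff g he i) hψ ht
  have hXs : ∀ i, tsupport (X i) ⊆ tsupport ψ := fun i => tsupport_sum_mul_partialDeriv_subset _ _
  have hXc : ∀ i, HasCompactSupport (X i) := fun i =>
    IsCompact.of_isClosed_subset hc isClosed_closure (hXs i)
  have h1 : ∀ i, Integrable fun u => partialDeriv i (w ∘ e.symm) u * X i u := fun i => by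
    simp only [mul_comm _ (X i _)]
    exact (contDiff_mul_of_tsupport_subset e.open_target (hX i) ((hXs i).trans ht)
      (contDiffOn_partialDeriv e.open_target hw i)).continuous.integrable_of_hasCompactSupport
      (hXc i).mul_right
  have h2 : ∀ i, Integrable fun u => (w ∘ e.symm) u * partialDeriv i (X i) u := fun i => by
    simp only [mul_comm _ (partialDeriv i _ _)]
    have hs := tsupport_partialDeriv_subset (X i) i
    exact (contDiff_mul_of_tsupport_subset e.open_target (contDiff_partialDeriv i (hX i))
      ((hs.trans (hXs i)).trans ht) hw).continuous.integrable_of_hasCompactSupport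
      (HasCompactSupport.mul_right (IsCompact.of_isClosed_subset (hXc i) isClosed_closure hs))
  have h3 : ∀ u, w (e.symm u) * divFormOp (laplaceCoeff g e) (fun _ => 0) ψ u =
      ∑ i, (w ∘ e.symm) u * partialDeriv i (X i) u := fun u => by
    rw [divFormOp, zero_mul, add_zero, Finset.mul_sum]
    rfl
  simp only [h3]
  rw [integral_finsetSum _ fun i _ => h1 i, integral_finsetSum _ fun i _ => h2 i,
    ← Finset.sum_neg_distrib]
  refine Finset.sum_congr rfl fun i _ => ?_
  rw [integral_mul_partialDeriv e.open_target hw (hX i) (hXc i) ((hXs i).trans ht), neg_neg]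

/-- The opposite integration by parts, with all derivatives on `w`. Comparison with the preceding
formula recovers the classical equation for smooth `w`. -/
theorem inner_ofChart_eq_integral_laplacian (g : SmoothMetric n M)
    {e : OpenPartialHomeomorph M 𝔼}
    (he : e ∈ IsManifold.maximalAtlas (𝓡 n) ∞ M) {ψ : 𝔼 → ℝ} (hψ : ContDiff ℝ ∞ ψ)
    (hc : HasCompactSupport ψ) (ht : tsupport ψ ⊆ e.target) (w : EnergySpace g) :
    inner ℝ w (EnergySpace.ofChart g he hψ hc ht) =
      (∫ x, w x * EnergySpace.ofChart g he hψ hc ht x ∂riemannianVolume g) +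
        ∫ u, (density g e u * laplacianInChart g e w u) * ψ u := by
  rw [inner_ofChart]
  congr 1
  have hw := contDiffOn_comp_chart_symm he w.contMDiff.contMDiffOn
  set Y : Fin n → 𝔼 → ℝ := fun i u => density g e u * gradInChart g e w u i
  have hY : ∀ i, ContDiffOn ℝ ∞ (Y i) e.target := fun i =>
    (contDiffOn_density g he).mul (ContDiffOn.sum fun j _ => (contDiffOn_gram_inv g he i j).mul
      (contDiffOn_partialDeriv e.open_target hw j))
  have h1 : ∀ u, ∑ i, partialDeriv i (w ∘ e.symm) u *
      ∑ j, laplaceCoeff g e i j u * partialDeriv j ψ u = ∑ i, Y i u * partialDeriv i ψ u := by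
    intro u
    simp only [Y, gradInChart, laplaceCoeff, Finset.mul_sum, Finset.sum_mul]
    rw [Finset.sum_comm]
    refine Finset.sum_congr rfl fun i _ => Finset.sum_congr rfl fun j _ => ?_
    have hs : (gram g e u)⁻¹ j i = (gram g e u)⁻¹ i j := by
      have : (gram g e u)⁻¹.transpose = (gram g e u)⁻¹ := by
        rw [Matrix.transpose_nonsing_inv]
        congr 1
        ext i j
        exact gram_symm g e u j i
      exact congrFun (congrFun this i) j
    rw [hs]
    ring
  have h2 : ∀ u, (density g e u * laplacianInChart g e w u) * ψ u =
      -∑ i, partialDeriv i (Y i) u * ψ u := by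
    intro u
    by_cases hu : u ∈ e.target
    · have hρ := (density_pos g he hu).ne'
      rw [laplacianInChart, divInChart, ← Finset.sum_mul]
      field_simp
      rw [mul_comm (ψ u)]
    · have h0 : ψ u = 0 := image_eq_zero_of_notMem_tsupport fun h => hu (ht h)
      simp [h0]
  have h3 : ∀ i, Integrable fun u => Y i u * partialDeriv i ψ u := fun i => by
    simp only [mul_comm (Y i _)]
    have hs := tsupport_partialDeriv_subset ψ i
    exact (contDiff_mul_of_tsupport_subset e.open_target (contDiff_partialDeriv i hψ)
      (hs.trans ht) (hY i)).continuous.integrable_of_hasCompactSupport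
      (HasCompactSupport.mul_right (IsCompact.of_isClosed_subset hc isClosed_closure hs))
  have h4 : ∀ i, Integrable fun u => partialDeriv i (Y i) u * ψ u := fun i => by
    simp only [mul_comm _ (ψ _)]
    exact (contDiff_mul_of_tsupport_subset e.open_target hψ ht
      (contDiffOn_partialDeriv e.open_target (hY i) i)).continuous.integrable_of_hasCompactSupport
      hc.mul_right
  simp only [h1, h2]
  rw [integral_neg, integral_finsetSum _ fun i _ => h3 i, integral_finsetSum _ fun i _ => h4 i,
    ← Finset.sum_neg_distrib]
  exact Finset.sum_congr rfl fun i _ => integral_mul_partialDeriv e.open_target (hY i) hψ hc ht i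

end WeakEquation

end EigenmapRegistration

/-! ### Smoothness of weak eigenfunctions and existence of an eigenbasis -/

namespace EigenmapRegistration

section Regularity

variable {n : ℕ} {M : Type*} [TopologicalSpace M] [ChartedSpace (EuclideanSpace ℝ (Fin n)) M]
  [IsManifold (𝓡 n) ∞ M] [MeasurableSpace M] [BorelSpace M] [CompactSpace M]

local notation "𝔼" => EuclideanSpace ℝ (Fin n)

omit [IsManifold (𝓡 n) ∞ M] in
-- Two local representatives are continuous and almost everywhere equal on an open overlap, hence
-- equal there, so `y ↦ v y y` is locally one of them. By compactness only finitely many null sets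
-- have to be discarded.
theorem exists_contMDiff_ae_eq {μ : Measure M} [μ.IsOpenPosMeasure] {B : M → ℝ}
    (h : ∀ x, ∃ O : Set M, IsOpen O ∧ x ∈ O ∧ ∃ v : M → ℝ, ContMDiffOn (𝓡 n) 𝓘(ℝ, ℝ) ∞ v O ∧
      ∀ᵐ y ∂μ, y ∈ O → B y = v y) :
    ∃ φ : M → ℝ, ContMDiff (𝓡 n) 𝓘(ℝ, ℝ) ∞ φ ∧ B =ᵐ[μ] φ := by
  choose O hO hxO v hv hvB using h
  have heq : ∀ x, ∀ y ∈ O x, v y y = v x y := by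
    intro x y hy
    have hae : v y =ᵐ[μ.restrict (O x ∩ O y)] v x := by
      refine (ae_restrict_iff' ((hO x).inter (hO y)).measurableSet).2 ?_
      filter_upwards [hvB x, hvB y] with z h1 h2 hz
      rw [← h1 hz.1, ← h2 hz.2]
    exact Measure.eqOn_open_of_ae_eq hae ((hO x).inter (hO y))
      ((hv y).continuousOn.mono Set.inter_subset_right)
      ((hv x).continuousOn.mono Set.inter_subset_left) ⟨hy, hxO y⟩
  refine ⟨fun y => v y y, fun x => ?_, ?_⟩
  · refine ((hv x).contMDiffAt ((hO x).mem_nhds (hxO x))).congr_of_eventuallyEq ?_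
    filter_upwards [(hO x).mem_nhds (hxO x)] with y hy
    exact heq x y hy
  · obtain ⟨t, ht⟩ := CompactSpace.elim_nhds_subcover O fun x => (hO x).mem_nhds (hxO x)
    have hall : ∀ᵐ y ∂μ, ∀ x ∈ t, y ∈ O x → B y = v x y :=
      (Finset.eventually_all t).2 fun x _ => hvB x
    filter_upwards [hall] with y hy
    have hyu : y ∈ ⋃ x ∈ t, O x := by rw [ht]; trivial
    simp only [Set.mem_iUnion] at hyu
    obtain ⟨x, hxt, hyx⟩ := hyu
    rw [hy x hxt hyx, heq x y hyx]

variable [Nonempty M] [T2Space M]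

theorem integral_mul_divFormOp_eq_zero (g : SmoothMetric n M)
    {B : Lp ℝ 2 (riemannianVolume g)} {ν : ℝ} {w : ℕ → EnergySpace g}
    (hw : Filter.Tendsto (fun k => EnergySpace.inclusion g (w k)) Filter.atTop (𝓝 B))
    (hwf : ∀ f : EnergySpace g, Filter.Tendsto (fun k => inner ℝ (w k) f) Filter.atTop
      (𝓝 (ν * ∫ x, B x * f x ∂riemannianVolume g)))
    {e : OpenPartialHomeomorph M 𝔼} (he : e ∈ IsManifold.maximalAtlas (𝓡 n) ∞ M)
    {ψ : 𝔼 → ℝ} (hψ : ContDiff ℝ ∞ ψ) (hc : HasCompactSupport ψ) (ht : tsupport ψ ⊆ e.target) :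
    ∫ u, B (e.symm u) *
      divFormOp (laplaceCoeff g e) (fun u => (ν - 1) * density g e u) ψ u = 0 := by
  have hlim : ∀ h : M → ℝ, ∀ hh : Continuous h,
      Filter.Tendsto (fun k => ∫ x, w k x * h x ∂riemannianVolume g) Filter.atTop
        (𝓝 (∫ x, B x * h x ∂riemannianVolume g)) := by
    intro h hh
    have := hw.inner (𝕜 := ℝ) (tendsto_const_nhds (x := EnergySpace.toL2 g hh))
    rw [EnergySpace.inner_toL2] at this
    refine this.congr fun k => ?_
    rw [EnergySpace.inclusion_apply, EnergySpace.inner_toL2_toL2]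
  set F := EnergySpace.ofChart g he hψ hc ht with hF
  have hD : ∀ c : 𝔼 → ℝ, ContDiffOn ℝ ∞ c e.target →
      ContDiff ℝ ∞ (divFormOp (laplaceCoeff g e) c ψ) := fun c hcc =>
    contDiff_divFormOp e.open_target (contDiffOn_laplaceCoeff g he) hcc hψ ht
  have hDs : ∀ c : 𝔼 → ℝ, tsupport (divFormOp (laplaceCoeff g e) c ψ) ⊆ tsupport ψ := fun c =>
    tsupport_divFormOp_subset _ _ _
  have hDc : ∀ c : 𝔼 → ℝ, HasCompactSupport (divFormOp (laplaceCoeff g e) c ψ) := fun c =>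
    IsCompact.of_isClosed_subset hc isClosed_closure (hDs c)
  have hcν : ContDiffOn ℝ ∞ (fun u => (ν - 1) * density g e u) e.target :=
    contDiffOn_const.mul (contDiffOn_density g he)
  -- Pairing with `h` is integration against the operator applied to `ψ`. For each `w k` it equals
  -- `ν ∫ w k F - ⟨w k, F⟩`, and the two terms have the same limit.
  obtain ⟨h, hh, hhi⟩ := integral_mul_chartExtend_div_density g he (hD _ hcν) (hDc _)
    ((hDs _).trans ht)
  have hk : ∀ k, ∫ x, w k x * h x ∂riemannianVolume g =
      ν * (∫ x, w k x * F x ∂riemannianVolume g) - inner ℝ (w k) F := by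
    intro k
    have hwk := contDiffOn_comp_chart_symm he (w k).contMDiff.contMDiffOn
    have h1 : Integrable fun u =>
        w k (e.symm u) * divFormOp (laplaceCoeff g e) (fun _ => 0) ψ u := by
      simp only [mul_comm (w k _)]
      exact (contDiff_mul_of_tsupport_subset e.open_target (hD _ contDiffOn_const)
        ((hDs _).trans ht) hwk).continuous.integrable_of_hasCompactSupport (hDc _).mul_right
    have h2 : Integrable fun u => w k (e.symm u) * (density g e u * ψ u) := by
      have h3 := (contDiff_mul_of_tsupport_subset e.open_target hψ ht
        ((contDiffOn_density g he).mul hwk)).continuous.integrable_of_hasCompactSupport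
        (μ := volume) hc.mul_right
      refine h3.congr (Filter.Eventually.of_forall fun u => ?_)
      simp only [Function.comp_apply]
      ring
    rw [hF, inner_ofChart_eq_neg_integral_divFormOp, integral_mul_ofChart g he hψ hc ht
      (w k).continuous.aestronglyMeasurable, hhi _ (w k).continuous.aestronglyMeasurable]
    have h4 : ∀ u, divFormOp (laplaceCoeff g e) (fun u => (ν - 1) * density g e u) ψ u *
        w k (e.symm u) = w k (e.symm u) * divFormOp (laplaceCoeff g e) (fun _ => 0) ψ u +
          (ν - 1) * (w k (e.symm u) * (density g e u * ψ u)) := by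
      intro u
      simp only [divFormOp]
      ring
    simp only [h4]
    rw [integral_add h1 (h2.const_mul _), integral_const_mul]
    ring
  have hl1 := hlim h hh.continuous
  simp only [hk] at hl1
  have hl2 := ((hlim F F.continuous).const_mul ν).sub (hwf F)
  rw [sub_self] at hl2
  have h0 := tendsto_nhds_unique hl1 hl2
  rw [hhi _ (Lp.memLp B).aestronglyMeasurable] at h0
  simpa only [mul_comm] using h0

omit [T2Space M] in
theorem exists_smooth_local_representative (g : SmoothMetric n M)
    {B : Lp ℝ 2 (riemannianVolume g)} {ν : ℝ} {e : OpenPartialHomeomorph M 𝔼}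
    (he : e ∈ IsManifold.maximalAtlas (𝓡 n) ∞ M)
    (hB : ∀ ψ : 𝔼 → ℝ, ContDiff ℝ ∞ ψ → HasCompactSupport ψ → tsupport ψ ⊆ e.target →
      ∫ u, B (e.symm u) *
        divFormOp (laplaceCoeff g e) (fun u => (ν - 1) * density g e u) ψ u = 0)
    {x : M} (hx : x ∈ e.source) :
    ∃ O : Set M, IsOpen O ∧ x ∈ O ∧ ∃ v : M → ℝ, ContMDiffOn (𝓡 n) 𝓘(ℝ, ℝ) ∞ v O ∧
      ∀ᵐ y ∂riemannianVolume g, y ∈ O → B y = v y := by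
  obtain ⟨K, hK, hxK, hKt⟩ := exists_compact_subset e.open_target (e.map_source hx)
  obtain ⟨ζ, hζ, hζc, hζt, hζK, hζ1⟩ := exists_cutoff hK e.open_target hKt
  obtain ⟨χ, hχ, hχc, hχt, hχx, -⟩ := exists_cutoff (isCompact_singleton (x := e x))
    isOpen_interior (Set.singleton_subset_iff.2 hxK)
  -- The Euclidean regularity theorem needs coefficients that are smooth and elliptic on the whole
  -- space. The convex combination with the identity matrix provides them and changes nothing near
  -- `K`, where the test functions live.
  set a : Fin n → Fin n → 𝔼 → ℝ := fun i j u =>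
    ζ u * laplaceCoeff g e i j u + (1 - ζ u) * if i = j then 1 else 0
  set c : 𝔼 → ℝ := fun u => ζ u * ((ν - 1) * density g e u)
  have ha : ∀ i j, ContDiff ℝ ∞ (a i j) := fun i j =>
    (contDiff_mul_of_tsupport_subset e.open_target hζ hζt (contDiffOn_laplaceCoeff g he i j)).add
      ((contDiff_const.sub hζ).mul contDiff_const)
  have hc : ContDiff ℝ ∞ c := contDiff_mul_of_tsupport_subset e.open_target hζ hζt
    (contDiffOn_const.mul (contDiffOn_density g he))
  have hpos : ∀ u θ : 𝔼, θ ≠ 0 → 0 < ∑ i, ∑ j, a i j u * (θ i * θ j) := by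
    intro u θ hθ
    have h1 : ∑ i, ∑ j, a i j u * (θ i * θ j) =
        ζ u * (∑ i, ∑ j, laplaceCoeff g e i j u * (θ i * θ j)) + (1 - ζ u) * ∑ i, θ i ^ 2 := by
      simp only [a, Finset.mul_sum, add_mul, Finset.sum_add_distrib]
      congr 1
      · refine Finset.sum_congr rfl fun i _ => Finset.sum_congr rfl fun j _ => by ring
      · refine Finset.sum_congr rfl fun i _ => ?_
        simp [sq]
    have h2 : 0 < ∑ i, θ i ^ 2 := by
      rw [← EuclideanSpace.real_norm_sq_eq]
      positivity
    rw [h1]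
    have h01 := hζ1 u
    by_cases h0 : ζ u = 0
    · rw [h0]
      simpa using h2
    · have hu : u ∈ e.target := hζt (subset_tsupport _ h0)
      have h3 := laplaceCoeff_pos g he hu hθ
      have h4 : 0 < ζ u := lt_of_le_of_ne h01.1 (Ne.symm h0)
      have h5 := mul_pos h4 h3
      have h6 := mul_nonneg (sub_nonneg.2 h01.2) h2.le
      linarith
  have hBm : AEStronglyMeasurable B (riemannianVolume g) := (Lp.memLp B).aestronglyMeasurable
  have hBi : Integrable B (riemannianVolume g) := (Lp.memLp B).integrable (by norm_num)
  have hu : Integrable (K.indicator fun u => B (e.symm u)) := by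
    rw [integrable_indicator_iff hK.measurableSet]
    have h1 : IntegrableOn (fun u => density g e u * B (e.symm u)) K :=
      ((integrableOn_chart_iff g he hBm).1 hBi.integrableOn).mono_set hKt
    have h2 := h1.continuousOn_mul (((contDiffOn_density g he).continuousOn.mono hKt).inv₀
      fun u hu => (density_pos g he (hKt hu)).ne') hK
    refine h2.congr_fun (fun u hu => ?_) hK.measurableSet
    exact inv_mul_cancel_left₀ (density_pos g he (hKt hu)).ne' _
  have hweak : ∀ ψ : 𝔼 → ℝ, ContDiff ℝ ∞ ψ → HasCompactSupport ψ → tsupport ψ ⊆ interior K →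
      ∫ u, (K.indicator fun u => B (e.symm u)) u * divFormOp a c ψ u = 0 := by
    intro ψ hψ hψc hψt
    rw [← hB ψ hψ hψc ((hψt.trans interior_subset).trans hKt)]
    congr 1 with u
    by_cases hu : u ∈ tsupport ψ
    · have huK : u ∈ K := interior_subset (hψt hu)
      rw [Set.indicator_of_mem huK]
      congr 1
      have hev : ∀ᶠ v in 𝓝 u, ζ v = 1 := eventually_nhdsSet_iff_forall.1 hζK u huK
      rw [divFormOp, divFormOp]
      congr 1
      · refine Finset.sum_congr rfl fun i _ => partialDeriv_congr i ?_
        filter_upwards [hev] with v hv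
        simp [a, hv]
      · simp [c, hev.self_of_nhds]
    · rw [image_eq_zero_of_notMem_tsupport fun h => hu (tsupport_divFormOp_subset _ _ _ h),
        image_eq_zero_of_notMem_tsupport fun h => hu (tsupport_divFormOp_subset _ _ _ h),
        mul_zero, mul_zero]
  obtain ⟨U, hU, hUae⟩ := exists_contDiff_of_weak_solution ha hc hpos isOpen_interior hu hweak
    hχ hχc hχt
  rw [nhdsSet_singleton] at hχx
  obtain ⟨N, hN1, hN, hxN⟩ := eventually_nhds_iff.1 hχx
  refine ⟨e.source ∩ e ⁻¹' N, e.isOpen_inter_preimage hN, ⟨hx, hxN⟩, U ∘ e, ?_, ?_⟩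
  · exact (contMDiff_iff_contDiff.2 hU).comp_contMDiffOn
      ((contMDiffOn_of_mem_maximalAtlas he).mono Set.inter_subset_left)
  · have h1 : ∀ᵐ u : 𝔼, u ∈ e.target → (e (e.symm u) ∈ N → B (e.symm u) = U (e (e.symm u))) := by
      filter_upwards [hUae] with u hu hut huN
      rw [e.right_inv hut] at huN ⊢
      have h2 := hN1 u huN
      have h3 : u ∈ K := interior_subset (hχt (subset_tsupport _ (by
        rw [Function.mem_support, h2]; exact one_ne_zero)))
      rw [← hu, h2, one_mul, Set.indicator_of_mem h3]
    filter_upwards [(ae_chart_iff g he (p := fun y => e y ∈ N → B y = U (e y))).2 h1] with y hy hyO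
    exact hy hyO.1 hyO.2

/-- The two integrations by parts make the residual `R` orthogonal to every test function, hence
zero almost everywhere, and everywhere by continuity. -/
theorem laplacianInChart_eq_of_weak (g : SmoothMetric n M) {ν : ℝ} (φ : EnergySpace g)
    {e : OpenPartialHomeomorph M 𝔼} (he : e ∈ IsManifold.maximalAtlas (𝓡 n) ∞ M)
    (hφ : ∀ ψ : 𝔼 → ℝ, ContDiff ℝ ∞ ψ → HasCompactSupport ψ → tsupport ψ ⊆ e.target →
      ∫ u, φ (e.symm u) *
        divFormOp (laplaceCoeff g e) (fun u => (ν - 1) * density g e u) ψ u = 0)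
    {u : 𝔼} (hu : u ∈ e.target) : laplacianInChart g e φ u = (ν - 1) * φ (e.symm u) := by
  have hw := contDiffOn_comp_chart_symm he φ.contMDiff.contMDiffOn
  have hρ := contDiffOn_density g he
  have hL : ContDiffOn ℝ ∞ (laplacianInChart g e φ) e.target :=
    ((hρ.inv fun u hu => (density_pos g he hu).ne').mul (ContDiffOn.sum fun i _ =>
      contDiffOn_partialDeriv e.open_target (hρ.mul (ContDiffOn.sum fun j _ =>
        (contDiffOn_gram_inv g he i j).mul (contDiffOn_partialDeriv e.open_target hw j))) i)).neg
  set R : 𝔼 → ℝ := fun u => density g e u * (laplacianInChart g e φ u - (ν - 1) * φ (e.symm u))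
  have hR : ContDiffOn ℝ ∞ R e.target := hρ.mul (hL.sub (contDiffOn_const.mul hw))
  have hae : ∀ᵐ u : 𝔼, u ∈ e.target → R u = 0 := by
    refine IsOpen.ae_eq_zero_of_integral_contDiff_smul_eq_zero e.open_target
      (hR.continuousOn.locallyIntegrableOn e.open_target.measurableSet) fun ψ hψ hc ht => ?_
    have h1 := inner_ofChart_eq_neg_integral_divFormOp g he hψ hc ht φ
    rw [inner_ofChart_eq_integral_laplacian, sub_eq_add_neg, add_right_inj] at h1
    have hint : ∀ q : 𝔼 → ℝ, ContDiffOn ℝ ∞ q e.target → Integrable fun u => q u * ψ u := by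
      intro q hq
      simp only [mul_comm (q _)]
      exact (contDiff_mul_of_tsupport_subset e.open_target hψ ht
        hq).continuous.integrable_of_hasCompactSupport hc.mul_right
    have hi1 := hint _ (hρ.mul hL)
    have hi2 := hint _ (hρ.mul hw)
    have hi3 : Integrable fun u =>
        φ (e.symm u) * divFormOp (laplaceCoeff g e) (fun _ => 0) ψ u := by
      simp only [mul_comm (φ _)]
      exact (contDiff_mul_of_tsupport_subset e.open_target (contDiff_divFormOp e.open_target
        (contDiffOn_laplaceCoeff g he) contDiffOn_const hψ ht)
        ((tsupport_divFormOp_subset _ _ _).trans ht)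
        hw).continuous.integrable_of_hasCompactSupport (HasCompactSupport.mul_right
        (IsCompact.of_isClosed_subset hc isClosed_closure (tsupport_divFormOp_subset _ _ _)))
    have h2 := hφ ψ hψ hc ht
    have h3 : ∀ u, φ (e.symm u) *
        divFormOp (laplaceCoeff g e) (fun u => (ν - 1) * density g e u) ψ u =
        φ (e.symm u) * divFormOp (laplaceCoeff g e) (fun _ => 0) ψ u +
          (ν - 1) * (density g e u * (φ ∘ e.symm) u * ψ u) := by
      intro u
      simp only [divFormOp, Function.comp_apply]
      ring
    simp only [h3] at h2
    rw [integral_add hi3 (hi2.const_mul _), integral_const_mul] at h2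
    have h4 : ∀ u, ψ u • R u = density g e u * laplacianInChart g e φ u * ψ u -
        (ν - 1) * (density g e u * (φ ∘ e.symm) u * ψ u) := by
      intro u
      simp only [R, smul_eq_mul, Function.comp_apply]
      ring
    simp only [h4]
    rw [integral_sub hi1 (hi2.const_mul _), integral_const_mul, h1]
    linarith
  have h0 : Set.EqOn R (fun _ => 0) e.target :=
    Measure.eqOn_open_of_ae_eq ((ae_restrict_iff' e.open_target.measurableSet).2 hae)
      e.open_target hR.continuousOn continuousOn_const
  have := (mul_eq_zero.1 (h0 hu)).resolve_left (density_pos g he hu).ne'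
  linarith

theorem exists_isEigenbasis (hn : 0 < n) (g : SmoothMetric n M) :
    ∃ φ : ℕ → M → ℝ, IsEigenbasis g φ := by
  obtain ⟨B, ν, hν, hB0, hB⟩ := exists_weak_eigenfunctions hn g
  have hweak : ∀ j, ∀ e ∈ IsManifold.maximalAtlas (𝓡 n) ∞ M, ∀ ψ : 𝔼 → ℝ, ContDiff ℝ ∞ ψ →
      HasCompactSupport ψ → tsupport ψ ⊆ e.target → ∫ u, B j (e.symm u) *
        divFormOp (laplaceCoeff g e) (fun u => (ν j - 1) * density g e u) ψ u = 0 := by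
    intro j e he ψ hψ hc ht
    obtain ⟨w, hw, hwf⟩ := hB j
    exact integral_mul_divFormOp_eq_zero g hw hwf he hψ hc ht
  have hsmooth : ∀ j, ∃ φ : M → ℝ, ContMDiff (𝓡 n) 𝓘(ℝ, ℝ) ∞ φ ∧
      B j =ᵐ[riemannianVolume g] φ := fun j => exists_contMDiff_ae_eq fun x =>
    exists_smooth_local_representative g (IsManifold.chart_mem_maximalAtlas x)
      (hweak j _ (IsManifold.chart_mem_maximalAtlas x)) (mem_chart_source 𝔼 x)
  choose φ hφ hφB using hsmooth
  -- The form is that of `1 + Δ`, whence the shift of the eigenvalues by one.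
  refine ⟨φ, ⟨fun j => ν j - 1, fun i j hij => sub_le_sub_right (hν hij) 1, fun j => ⟨hφ j, ?_⟩⟩,
    ⟨B, hφB⟩, fun x => ?_⟩
  · intro e he u hu
    refine laplacianInChart_eq_of_weak g ⟨⟨φ j, hφ j⟩⟩ he (fun ψ hψ hc ht => ?_) hu
    rw [← hweak j e he ψ hψ hc ht]
    refine integral_congr_ae ?_
    have h1 := (ae_chart_iff g he).1 ((hφB j).mono fun x hx (_ : x ∈ e.source) => hx)
    filter_upwards [h1] with u hu
    by_cases hut : u ∈ e.target
    · rw [hu hut]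
      rfl
    · rw [image_eq_zero_of_notMem_tsupport fun h =>
        hut (ht (tsupport_divFormOp_subset _ _ _ h)), mul_zero, mul_zero]
  · have h1 : φ 0 =ᵐ[riemannianVolume g]
        fun _ => 1 / √((riemannianVolume g).real Set.univ) := (hφB 0).symm.trans hB0
    exact congrFun ((Continuous.ae_eq_iff_eq _ (hφ 0).continuous continuous_const).1 h1) x

end Regularity

end EigenmapRegistration

/-! ### Invariance under isometries -/

namespace EigenmapRegistration

section Isometry

variable {n : ℕ} {M : Type*} [TopologicalSpace M] [ChartedSpace (EuclideanSpace ℝ (Fin n)) M]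
  [IsManifold (𝓡 n) ∞ M] {M' : Type*} [TopologicalSpace M']
  [ChartedSpace (EuclideanSpace ℝ (Fin n)) M'] [IsManifold (𝓡 n) ∞ M']

local notation "𝔼" => EuclideanSpace ℝ (Fin n)

omit [IsManifold (𝓡 n) ∞ M'] in
-- Charts are transported through `D`. In corresponding charts the metric, the density and the
-- Laplacian have identical coordinate expressions, which reduces the invariance statements below to
-- equalities of functions.
theorem transDiffeomorph_mem_maximalAtlas (D : Diffeomorph (𝓡 n) (𝓡 n) M M' ∞)
    {e' : OpenPartialHomeomorph M' 𝔼} (he' : e' ∈ IsManifold.maximalAtlas (𝓡 n) ∞ M') :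
    D.toHomeomorph.transOpenPartialHomeomorph e' ∈ IsManifold.maximalAtlas (𝓡 n) ∞ M := by
  refine OpenPartialHomeomorph.mem_maximalAtlas_of_contMDiffOn (I := 𝓡 n) _ ?_ ?_
  · exact (contMDiffOn_of_mem_maximalAtlas he').comp D.contMDiff.contMDiffOn fun x hx => hx
  · exact D.symm.contMDiff.comp_contMDiffOn (contMDiffOn_symm_of_mem_maximalAtlas he')

theorem gram_eq_of_isometry {g : SmoothMetric n M} {g' : SmoothMetric n M'}
    (D : Diffeomorph (𝓡 n) (𝓡 n) M M' ∞)
    (hD : ∀ (x : M) (v w : TangentSpace (𝓡 n) x),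
      g'.inner (D x) (mfderiv (𝓡 n) (𝓡 n) D x v) (mfderiv (𝓡 n) (𝓡 n) D x w) = g.inner x v w)
    {e : OpenPartialHomeomorph M 𝔼} {e' : OpenPartialHomeomorph M' 𝔼}
    (hs : ∀ u, e'.symm u = D (e.symm u)) : gram g e = gram g' e' := by
  funext u
  ext i j
  have hfun : (e'.symm : 𝔼 → M') = D ∘ e.symm := funext hs
  have key : ∀ v : 𝔼, frame e' u v = mfderiv (𝓡 n) (𝓡 n) D (e.symm u) (frame e u v) := by
    intro v
    by_cases hd : MDifferentiableAt (𝓡 n) (𝓡 n) e.symm u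
    · have h1 : mfderiv (𝓡 n) (𝓡 n) (D ∘ e.symm) u =
        (mfderiv (𝓡 n) (𝓡 n) D (e.symm u)).comp (mfderiv (𝓡 n) (𝓡 n) e.symm u) :=
        mfderiv_comp u (D.contMDiff.mdifferentiable (by simp) _) hd
      have h2 : frame e' u v = mfderiv (𝓡 n) (𝓡 n) (D ∘ e.symm) u v := by
        rw [← hfun]
        rfl
      rw [h2, h1]
      rfl
    -- The equality is wanted at every `u`, also off the target. Where one parametrization is not
    -- differentiable neither is the other, and both derivatives take the default value zero.
    · have hd' : ¬ MDifferentiableAt (𝓡 n) (𝓡 n) e'.symm u := by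
        intro h
        have h3 : MDifferentiableAt (𝓡 n) (𝓡 n) (D.symm ∘ e'.symm) u :=
          (D.symm.contMDiff.mdifferentiable (by simp) _).comp u h
        refine hd ?_
        convert h3 using 1
        funext v
        simp [hs]
      have h4 : frame e u = 0 := mfderiv_zero_of_not_mdifferentiableAt hd
      have h5 : frame e' u = 0 := mfderiv_zero_of_not_mdifferentiableAt hd'
      rw [h4, h5]
      exact (map_zero (mfderiv (𝓡 n) (𝓡 n) D (e.symm u))).symm
  rw [gram_apply, gram_apply, key, key, hs]
  exact (hD _ _ _).symm

theorem density_eq_of_isometry {g : SmoothMetric n M} {g' : SmoothMetric n M'}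
    (D : Diffeomorph (𝓡 n) (𝓡 n) M M' ∞)
    (hD : ∀ (x : M) (v w : TangentSpace (𝓡 n) x),
      g'.inner (D x) (mfderiv (𝓡 n) (𝓡 n) D x v) (mfderiv (𝓡 n) (𝓡 n) D x w) = g.inner x v w)
    {e : OpenPartialHomeomorph M 𝔼} {e' : OpenPartialHomeomorph M' 𝔼}
    (hs : ∀ u, e'.symm u = D (e.symm u)) : density g e = density g' e' := by
  funext u
  rw [density, density, gram_eq_of_isometry D hD hs]

theorem laplacianInChart_comp_isometry {g : SmoothMetric n M} {g' : SmoothMetric n M'}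
    (D : Diffeomorph (𝓡 n) (𝓡 n) M M' ∞)
    (hD : ∀ (x : M) (v w : TangentSpace (𝓡 n) x),
      g'.inner (D x) (mfderiv (𝓡 n) (𝓡 n) D x v) (mfderiv (𝓡 n) (𝓡 n) D x w) = g.inner x v w)
    {e : OpenPartialHomeomorph M 𝔼} {e' : OpenPartialHomeomorph M' 𝔼}
    (hs : ∀ u, e'.symm u = D (e.symm u)) (f : M' → ℝ) :
    laplacianInChart g e (f ∘ D) = laplacianInChart g' e' f := by
  have h1 : gradInChart g e (f ∘ D) = gradInChart g' e' f := by
    funext u i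
    have h2 : (f ∘ D) ∘ e.symm = f ∘ e'.symm := funext fun v => by simp [hs]
    rw [gradInChart, gradInChart, gram_eq_of_isometry D hD hs, h2]
  funext u
  rw [laplacianInChart, laplacianInChart, h1, divInChart, divInChart,
    density_eq_of_isometry D hD hs]

variable [MeasurableSpace M] [BorelSpace M] [MeasurableSpace M'] [BorelSpace M']

theorem map_chartVolume_of_isometry {g : SmoothMetric n M} {g' : SmoothMetric n M'}
    (D : Diffeomorph (𝓡 n) (𝓡 n) M M' ∞)
    (hD : ∀ (x : M) (v w : TangentSpace (𝓡 n) x),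
      g'.inner (D x) (mfderiv (𝓡 n) (𝓡 n) D x v) (mfderiv (𝓡 n) (𝓡 n) D x w) = g.inner x v w)
    {e : OpenPartialHomeomorph M 𝔼} {e' : OpenPartialHomeomorph M' 𝔼}
    (ht : e'.target = e.target) (hs : ∀ u, e'.symm u = D (e.symm u)) :
    (chartVolume g e).map D = chartVolume g' e' := by
  have hm : AEMeasurable e.symm ((volume.restrict e.target).withDensity
      (fun u => ENNReal.ofReal (density g e u))) :=
    (aemeasurable_chart_symm e).mono_ac (withDensity_absolutelyContinuous _ _)
  rw [chartVolume, chartVolume, AEMeasurable.map_map_of_aemeasurable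
    D.continuous.measurable.aemeasurable hm, density_eq_of_isometry D hD hs, ht]
  congr 1
  exact (funext hs).symm

/-- Each chart volume is carried to the chart volume of the transported chart. Taking suprema gives
one inequality for `D` and the other for its inverse. -/
theorem measurePreserving_of_isometry {g : SmoothMetric n M} {g' : SmoothMetric n M'}
    (D : Diffeomorph (𝓡 n) (𝓡 n) M M' ∞)
    (hD : ∀ (x : M) (v w : TangentSpace (𝓡 n) x),
      g'.inner (D x) (mfderiv (𝓡 n) (𝓡 n) D x v) (mfderiv (𝓡 n) (𝓡 n) D x w) = g.inner x v w) :
    MeasurePreserving D (riemannianVolume g) (riemannianVolume g') := by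
  have hm : Measurable D := D.continuous.measurable
  have hm' : Measurable D.symm := D.symm.continuous.measurable
  refine ⟨hm, le_antisymm ?_ ?_⟩
  · have h1 : riemannianVolume g ≤ (riemannianVolume g').map D.symm := by
      refine iSup₂_le fun e he => ?_
      have h2 := map_chartVolume_of_isometry D hD (e := e)
        (e' := D.symm.toHomeomorph.transOpenPartialHomeomorph e) rfl fun u => rfl
      have h3 : chartVolume g e = (chartVolume g'
          (D.symm.toHomeomorph.transOpenPartialHomeomorph e)).map D.symm := by
        rw [← h2, Measure.map_map hm' hm]
        have : D.symm ∘ D = id := funext fun x => D.symm_apply_apply x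
        rw [this, Measure.map_id]
      rw [h3]
      exact Measure.map_mono (le_iSup₂_of_le _ (transDiffeomorph_mem_maximalAtlas D.symm he) le_rfl)
        hm'
    calc (riemannianVolume g).map D ≤ ((riemannianVolume g').map D.symm).map D :=
          Measure.map_mono h1 hm
      _ = riemannianVolume g' := by
          rw [Measure.map_map hm hm']
          have : D ∘ D.symm = id := funext fun x => D.apply_symm_apply x
          rw [this, Measure.map_id]
  · refine iSup₂_le fun e' he' => ?_
    have h2 := map_chartVolume_of_isometry D hD
      (e := D.toHomeomorph.transOpenPartialHomeomorph e') (e' := e') rfl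
      fun u => (D.apply_symm_apply _).symm
    rw [← h2]
    exact Measure.map_mono (le_iSup₂_of_le _ (transDiffeomorph_mem_maximalAtlas D he') le_rfl) hm

/-- Composition with `f` is a linear isometry of `L²` spaces, surjective since composition with `f'`
is a right inverse, so it transports Hilbert bases. -/
theorem exists_hilbertBasis_comp_measurePreserving {α β : Type*} [MeasurableSpace α]
    [MeasurableSpace β] {μ : Measure α} {μ' : Measure β} {f : α → β} {f' : β → α}
    (hf : MeasurePreserving f μ μ') (hf' : MeasurePreserving f' μ' μ) (hff' : f' ∘ f = id)
    (B : HilbertBasis ℕ ℝ (Lp ℝ 2 μ')) :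
    ∃ B' : HilbertBasis ℕ ℝ (Lp ℝ 2 μ), ∀ j, B' j =ᵐ[μ] B j ∘ f := by
  have hsurj : Function.Surjective (Lp.compMeasurePreservingₗᵢ (E := ℝ) (p := 2) ℝ f hf) := by
    intro h
    refine ⟨Lp.compMeasurePreserving f' hf' h, ?_⟩
    refine Lp.ext ?_
    have h1 := Lp.coeFn_compMeasurePreserving (Lp.compMeasurePreserving f' hf' h) hf
    have h2 := hf.quasiMeasurePreserving.ae_eq_comp (Lp.coeFn_compMeasurePreserving h hf')
    refine h1.trans (h2.trans ?_)
    rw [Function.comp_assoc, hff', Function.comp_id]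
  set U := LinearIsometryEquiv.ofSurjective _ hsurj
  refine ⟨HilbertBasis.ofRepr (U.symm.trans B.repr), fun j => ?_⟩
  have h1 : HilbertBasis.ofRepr (U.symm.trans B.repr) j = U (B j) := by
    rw [← HilbertBasis.repr_symm_single, ← HilbertBasis.repr_symm_single]
    rfl
  rw [h1]
  exact Lp.coeFn_compMeasurePreserving (B j) hf

theorem IsEigenbasis.comp_isometry {g : SmoothMetric n M} {g' : SmoothMetric n M'}
    (D : Diffeomorph (𝓡 n) (𝓡 n) M M' ∞)
    (hD : ∀ (x : M) (v w : TangentSpace (𝓡 n) x),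
      g'.inner (D x) (mfderiv (𝓡 n) (𝓡 n) D x v) (mfderiv (𝓡 n) (𝓡 n) D x w) = g.inner x v w)
    {b : ℕ → M' → ℝ} (hb : IsEigenbasis g' b) : IsEigenbasis g fun j => b j ∘ D := by
  obtain ⟨⟨lam, hmono, hsol⟩, ⟨B, hB⟩, h0⟩ := hb
  have hmp := measurePreserving_of_isometry D hD
  have hmp' : MeasurePreserving D.symm (riemannianVolume g') (riemannianVolume g) := by
    refine ⟨D.symm.continuous.measurable, ?_⟩
    rw [← hmp.map_eq, Measure.map_map D.symm.continuous.measurable hmp.measurable]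
    have : D.symm ∘ D = id := funext fun x => D.symm_apply_apply x
    rw [this, Measure.map_id]
  refine ⟨⟨lam, hmono, fun j => ⟨(hsol j).1.comp D.contMDiff, fun e he u hu => ?_⟩⟩, ?_, fun x => ?_⟩
  · have h1 := (hsol j).2 _ (transDiffeomorph_mem_maximalAtlas D.symm he) u hu
    rw [laplacianInChart_comp_isometry D hD (e := e)
      (e' := D.symm.toHomeomorph.transOpenPartialHomeomorph e) fun u => rfl]
    exact h1
  · obtain ⟨B', hB'⟩ := exists_hilbertBasis_comp_measurePreserving hmp hmp'
      (funext fun x => D.symm_apply_apply x) B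
    exact ⟨B', fun j => (hB' j).trans (hmp.quasiMeasurePreserving.ae_eq_comp (hB j))⟩
  · have h1 : (riemannianVolume g).real Set.univ = (riemannianVolume g').real Set.univ := by
      rw [Measure.real, Measure.real, ← hmp.measure_preimage nullMeasurableSet_univ,
        Set.preimage_univ]
    exact (h0 (D x)).trans (by rw [h1])

omit [BorelSpace M] in
-- The infimum is attained at some finite `k ≤ m`, because the infimum of the empty set would be
-- `⊤`. The first `k` coordinates already separate points, and the remaining ones cannot spoil this.
theorem injective_eigenmap {g : SmoothMetric n M} {b : ℕ → M → ℝ} (hb : IsEigenbasis g b) {m : ℕ}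
    (hm : maximalEmbeddingDimension g ≤ m) : Function.Injective (eigenmap b m) := by
  unfold maximalEmbeddingDimension at hm
  set S := {k : ℕ∞ | ∃ m : ℕ, k = m ∧ ∀ φ : ℕ → M → ℝ, IsEigenbasis g φ →
    Manifold.IsSmoothEmbedding (𝓡 n) (𝓡 m) ∞ (eigenmap φ m)}
  have hne : S.Nonempty := by
    by_contra h
    rw [Set.not_nonempty_iff_eq_empty] at h
    rw [h, sInf_empty, top_le_iff] at hm
    exact ENat.natCast_ne_top m hm
  obtain ⟨k, hk, hemb⟩ := csInf_mem hne
  rw [hk, Nat.cast_le] at hm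
  intro x y hxy
  refine (hemb b hb).isEmbedding.injective ?_
  ext j
  exact congrFun (congrArg WithLp.ofLp hxy) (Fin.castLE hm j)

end Isometry

end EigenmapRegistration

/-! ### The closest-point map of a transported eigenbasis -/

open EigenmapRegistration in
theorem propositionT {n : ℕ} (hn : 0 < n)
    {M : Type*} [TopologicalSpace M] [T2Space M] [CompactSpace M] [ConnectedSpace M]
    [ChartedSpace (EuclideanSpace ℝ (Fin n)) M] [IsManifold (𝓡 n) ∞ M]
    [MeasurableSpace M] [BorelSpace M]
    {M' : Type*} [TopologicalSpace M'] [T2Space M'] [CompactSpace M'] [ConnectedSpace M']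
    [ChartedSpace (EuclideanSpace ℝ (Fin n)) M'] [IsManifold (𝓡 n) ∞ M']
    [MeasurableSpace M'] [BorelSpace M']
    (g : SmoothMetric n M) (g' : SmoothMetric n M')
    (hiso : ∃ F : M → M', IsRiemannianIsometry g g' F)
    (m : ℕ) (hm : maximalEmbeddingDimension g ≤ m) (hm' : maximalEmbeddingDimension g' ≤ m) :
    ∃ (b : ℕ → M → ℝ) (b' : ℕ → M' → ℝ), IsEigenbasis g b ∧ IsEigenbasis g' b' ∧
      (∃ α : M → M', IsClosestPointMap b b' m α) ∧
      ∀ α : M → M', IsClosestPointMap b b' m α → IsRiemannianIsometry g g' α := by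
  obtain ⟨F, ⟨D, hDF⟩, hF⟩ := hiso
  subst hDF
  obtain ⟨b', hb'⟩ := exists_isEigenbasis hn g'
  -- With the pulled back basis the two eigenmaps agree along `D` by definition, so the minimum is
  -- zero and minimizers are exactly the points with the same eigenmap value.
  have hzero : ∀ x, ‖eigenmap b' m (D x) - eigenmap (fun j => b' j ∘ D) m x‖ = 0 := fun x => by
    rw [norm_eq_zero, sub_eq_zero]
    rfl
  refine ⟨fun j => b' j ∘ D, b', hb'.comp_isometry D hF, hb', ⟨D, fun x x' => ?_⟩, fun α hα => ?_⟩
  · rw [hzero]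
    exact norm_nonneg _
  · have hαD : α = D := funext fun x => by
      have h := hα x (D x)
      rw [hzero] at h
      exact injective_eigenmap hb' hm' (sub_eq_zero.1 (norm_le_zero_iff.1 h))
    rw [hαD]
    exact ⟨⟨D, rfl⟩, hF⟩
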